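/- Let $n\ge 1$, let $0=x_0<x_1<\dots<x_n$ and $m_0,\dots,m_n>0$ be real numbers, and let $X$ be the (persistent) gap diffusion with finite state space $\{x_0,\dots,x_n\}$ and speed measure $m=\sum_i m_i\delta_{x_i}$, reflected at both ends: the Markov process with right-continuous paths with left limits whose generator is $D_mD_x$, that is, it jumps from $x_i$ only to neighbouring points $x_j$, $j=i\pm1$, at rate $1/(m_i|x_j-x_i|)$. Let $P_0$ be its law started at $x_0=0$, and let $a_0=1/(m_0(x_1-x_0))$ be the rate of the exponential holding time at $0$. Let $\tau(t)=\int_0^t 1_{\{X_s=0\}}\,ds$ be the local time at $0$, $\tau^{-1}(t)=\inf\{s:\tau(s)>t\}$ its right-continuous inverse, and $c(t)$ the number of jumps away from $0$ in the time interval $(0,\tau^{-1}(t)]$. Then $P_0$-almost surely $\tau^{-1}(t)<\infty$ for all $t\ge 0$, and there is a probability density $S$ on $(0,\infty)$ such that the following hold. (1) For every $t>0$, $P_0(c(t)=1)>0$ and $P_0(\tau^{-1}(t)-t\in dx\mid c(t)=1)=S(x)\,dx$; in particular this conditional law (the excursion law) does not depend on $t$. (2) Under $P_0$ the process $\tau^{-1}(t)-t$,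 $t\ge 0$, is a compound Poisson process with jump rate $a_0$ and jump law $S(x)\,dx$: it starts at $0$, has right-continuous paths with left limits and independent increments, and its increments over time intervals of length $t$ have the law $\sum_{k\ge 0}e^{-a_0t}\frac{(a_0t)^k}{k!}S^{k*}$. (3) The Lévy measure $n(dx)$ of $\tau^{-1}$ is $a_0S(x)\,dx$, and its drift is $1$: for a number $b\ge0$ and a measure $n$ on $(0,\infty)$ with $\int(1-e^{-x})\,n(dx)<\infty$, the formula $E_0[e^{-z\tau^{-1}(t)}]=\exp\bigl(-t\,[\,bz+\int_0^\infty(1-e^{-zx})\,n(dx)]\bigr)$ holds for all $z,t\ge0$ if and only if $b=1$ and $n(dx)=a_0S(x)\,dx$. (4) If the local time at $0$ is normalized to be $a_0\tau$ (so that excursions from $0$ occur at unit rate), then the Lévy measure of its right-continuous inverse is exactly $n(dx)=S(x)\,dx$, and its drift is $1/a_0$, in the same sense. -/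

import Mathlib

open MeasureTheory ProbabilityTheory Filter Topology
open scoped NNReal ENNReal

noncomputable section

/-- A speed measure with finite support on `[0, ∞)`: the measure `∑ i, mass i • δ_{pos i}`,
carried by points `0 = pos 0 < pos 1 < ⋯ < pos n`, all masses being positive and finite. -/
structure FiniteSpeedMeasure (n : ℕ) where
  /-- the points of the support, in natural scale -/
  pos : Fin (n + 1) → ℝ
  /-- the masses of the points -/
  mass : Fin (n + 1) → ℝ
  pos_zero : pos 0 = 0
  pos_strictMono : StrictMono pos
  mass_pos : ∀ i, 0 < mass i

namespace FiniteSpeedMeasure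

variable {n : ℕ}

/-- The rate of the jumps from the `i`-th point to the `j`-th one: it is
`1 / (mass i * |pos j - pos i|)` if the two points are neighbours and `0` otherwise. -/
def jumpRate (m : FiniteSpeedMeasure n) (i j : Fin (n + 1)) : ℝ :=
  if (i : ℕ) + 1 = (j : ℕ) ∨ (j : ℕ) + 1 = (i : ℕ) then
    (m.mass i * |m.pos j - m.pos i|)⁻¹ else 0

/-- The rate of the exponential holding time at the `i`-th point. -/
def holdingRate (m : FiniteSpeedMeasure n) (i : Fin (n + 1)) : ℝ := ∑ j, m.jumpRate i j

/-- The generator `D_m D_x` of the gap diffusion, as a matrix. With the slopes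
`f⁺ i = (f (i + 1) - f i) / (pos (i + 1) - pos i)` for `i < n` and `f⁺ n = 0` (reflection), and
`f⁻ i = f⁺ (i - 1)` for `0 < i` and `f⁻ 0 = 0` (reflection), it is
`(D_m D_x f) i = (f⁺ i - f⁻ i) / mass i`. -/
def generator (m : FiniteSpeedMeasure n) : Matrix (Fin (n + 1)) (Fin (n + 1)) ℝ :=
  Matrix.of fun i j => if i = j then -m.holdingRate i else m.jumpRate i j

/-- The transition probabilities `p_t(i, j)`, the entries of `exp (t D_m D_x)`. -/
def transition (m : FiniteSpeedMeasure n) (t : ℝ) : Matrix (Fin (n + 1)) (Fin (n + 1)) ℝ :=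
  NormedSpace.exp (t • m.generator)

end FiniteSpeedMeasure

/-- A path is right-continuous and has left limits. -/
def IsCadlagPath {E : Type*} [TopologicalSpace E] (x : ℝ≥0 → E) : Prop :=
  ∀ t, ContinuousWithinAt x (Set.Ici t) t ∧ ∃ l, Tendsto x (𝓝[<] t) (𝓝 l)

/-- `X` under the probabilities `P a` (the process starting at the `a`-th point) is the gap
diffusion with speed measure `m`: the Markov process with right-continuous paths with left limits,
with generator `D_m D_x`, on the support of `m`. The `i`-th point of the support is labelled by
`i`. -/
structure IsGapDiffusion {n : ℕ} (m : FiniteSpeedMeasure n) {W : Type*} [MeasurableSpace W]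
    (X : ℝ≥0 → W → Fin (n + 1)) (P : Fin (n + 1) → Measure W) : Prop where
  isProbabilityMeasure : ∀ a, IsProbabilityMeasure (P a)
  measurable : ∀ t, Measurable (X t)
  cadlag : ∀ w, IsCadlagPath fun t => X t w
  /-- the Markov property with the given start and transition probabilities -/
  finite_dimensional : ∀ (a : Fin (n + 1)) (k : ℕ) (t : Fin (k + 1) → ℝ≥0), Monotone t →
    ∀ e : Fin (k + 1) → Fin (n + 1),
      (P a).real {w | ∀ i, X (t i) w = e i} =
        m.transition (t 0) a (e 0) *
          ∏ i : Fin k, m.transition ((t i.succ : ℝ) - (t i.castSucc : ℝ)) (e i.castSucc) (e i.succ)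

section LocalTime

variable {n : ℕ} {W : Type*}

/-- The local time at the `a`-th point: the time spent there up to time `t`. -/
def localTime (X : ℝ≥0 → W → Fin (n + 1)) (a : Fin (n + 1)) (t : ℝ≥0) (w : W) : ℝ :=
  (volume {s : ℝ | 0 ≤ s ∧ s ≤ t ∧ X s.toNNReal w = a}).toReal

/-- The right-continuous inverse of a nondecreasing function. -/
def rightInverse (A : ℝ≥0 → ℝ) (t : ℝ≥0) : ℝ≥0 := sInf {s : ℝ≥0 | (t : ℝ) < A s}

/-- The inverse local time at the point `0`. -/
def invLocalTime (X : ℝ≥0 → W → Fin (n + 1)) (t : ℝ≥0) (w : W) : ℝ≥0 :=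
  rightInverse (fun s => localTime X 0 s w) t

/-- The number of jumps away from the point `0` before the local time at `0` exceeds `t`. -/
def jumpCount (X : ℝ≥0 → W → Fin (n + 1)) (t : ℝ≥0) (w : W) : ℕ∞ :=
  Set.encard {s : ℝ≥0 | 0 < s ∧ s ≤ invLocalTime X t w ∧
    (∀ᶠ r in 𝓝[<] s, X r w = 0) ∧ X s w ≠ 0}

/-- The conditional law, given exactly one jump away from `0`, of the inverse local time at `t`
minus `t`. -/
def excursionLaw [MeasurableSpace W] (X : ℝ≥0 → W → Fin (n + 1)) (P₀ : Measure W) (t : ℝ≥0) :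
    Measure ℝ :=
  (ProbabilityTheory.cond P₀ {w | jumpCount X t w = 1}).map
    fun w => (invLocalTime X t w : ℝ) - (t : ℝ)

end LocalTime

/-- The convolution powers of a measure on the line. -/
def convPower (S : Measure ℝ) : ℕ → Measure ℝ
  | 0 => Measure.dirac 0
  | k + 1 => Measure.conv S (convPower S k)

/-- The compound Poisson law `∑ k, e^{-r} r^k / k! • S^{*k}`. -/
def compoundPoissonLaw (r : ℝ) (S : Measure ℝ) : Measure ℝ :=
  Measure.sum fun k : ℕ =>
    ENNReal.ofReal (Real.exp (-r) * r ^ k / (k.factorial : ℝ)) • convPower S k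

/-- `Y` is a compound Poisson process with jump rate `r` and jump law `S`. -/
structure IsCompoundPoissonProcess {Ω : Type*} [MeasurableSpace Ω] (μ : Measure Ω)
    (Y : ℝ≥0 → Ω → ℝ) (r : ℝ) (S : Measure ℝ) : Prop where
  aemeasurable : ∀ t, AEMeasurable (Y t) μ
  start : ∀ᵐ ω ∂μ, Y 0 ω = 0
  cadlag : ∀ᵐ ω ∂μ, IsCadlagPath fun t => Y t ω
  indep_increments : HasIndepIncrements Y μ
  law_increment : ∀ s t : ℝ≥0,
    μ.map (fun ω => Y (s + t) ω - Y s ω) = compoundPoissonLaw (r * t) S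

/-- The nonnegative process `Y` with stationary independent increments has drift `b` and Lévy
measure `ν`: `ν` is a measure on `(0, ∞)` with `∫ (1 - e^{-s}) ν(ds) < ∞`, and
`E[e^{-z Y(t)}] = e^{-t (b z + ∫ (1 - e^{-z s}) ν(ds))}` for all `z, t ≥ 0`. -/
structure HasDriftLevyMeasure {Ω : Type*} [MeasurableSpace Ω] (μ : Measure Ω)
    (Y : ℝ≥0 → Ω → ℝ) (b : ℝ) (ν : Measure ℝ) : Prop where
  drift_nonneg : 0 ≤ b
  null_nonpos : ν (Set.Iic 0) = 0
  lintegral_lt_top : ∫⁻ s, ENNReal.ofReal (1 - Real.exp (-s)) ∂ν < ∞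
  laplace : ∀ (z : ℝ) (t : ℝ≥0), 0 ≤ z →
    ∫ ω, Real.exp (-(z * Y t ω)) ∂μ =
      Real.exp (-(t * (b * z + ∫ s, (1 - Real.exp (-(z * s))) ∂ν)))

end

/-! The inverse local time is identified through Laplace transforms, with the Markov property used
only at fixed times. Write `T r` for the inverse local time at level `r` and `G z` for the Green
function `∫ e^{-zt} p_t(0,0) dt`. For an event `A` in the past of `T s`, let `g r` be the
expectation of `e^{-z T r}` on `A`, killed when the total local time does not exceed `r`. The
substitution of real time for local time turns a tail integral of `g` into an integral of `e^{-zv}`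
over zeros `v` of the path, and a double tail integral into one over pairs of zeros `v < y`. For
fixed `v`, the Markov property evaluates the integral over `y` as `e^{-zv} G z`. Hence the double
tail of `g` is `G z` times its single tail, from every level `a ≥ s` on; as `g` is right-continuous,
this forces `g r = g s * e^{-(r-s)/G z}` (`lintegral_double_eq`, `exponential_of_tail_integral`,
`partialLaplace_eq`). Since `A` is an arbitrary past event, the increments are independent of the
past and stationary.

The exponent `1 / G z` comes from linear algebra (`exists_excursion_density`). The Laplace transform
`u` of the hitting time of `0` solves the resolvent equation of the process absorbed at `0`, whose
generator differs from the original one only in row `0`. Evaluating the original resolvent on `u`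
gives `(z + a₀ (1 - Ŝ z)) * G z = 1`, where `S` is the hitting density from the neighbour of `0`.
This is the exponent of a unit drift plus a compound Poisson process. Letting `z → 0` shows that the
local time is unbounded (`ae_recurrent`), and uniqueness of Laplace transforms gives the law of the
increments (`map_excess_increment`).

The jump count is recovered pathwise. The excess `T t - t` grows exactly at the local times of the
departures from `0`, and distinct departures have distinct local times. So there is exactly one
departure if and only if the excess grows on exactly one interval of every sufficiently fine
partition (`eventually_existsUnique_excess_lt_iff`). By independence the probability of such growth,
jointly with the excess lying in `B`, tends to `a₀ t S(B) e^{-a₀ t}`; conditioning leaves `S`.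

Drift and Lévy measure are unique because the differences `Φ (k+1) - Φ k` of the exponent are the
Laplace transform, at the integers, of the finite measure `driftLevySum`. -/

/-! ### Uniqueness of Laplace transforms on the half-line -/

section Laplace

/-- The Laplace transform of a measure on the line. -/
noncomputable def laplaceTransform (μ : Measure ℝ) (z : ℝ) : ℝ≥0∞ :=
  ∫⁻ x, ENNReal.ofReal (Real.exp (-(z * x))) ∂μ

lemma measurable_ofReal_exp_neg_mul (z : ℝ) :
    Measurable fun x : ℝ => ENNReal.ofReal (Real.exp (-(z * x))) := by fun_prop

lemma ae_nonneg_of_measure_Iio {μ : Measure ℝ} (h : μ (Set.Iio 0) = 0) : ∀ᵐ x ∂μ, 0 ≤ x := by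
  rw [ae_iff]
  convert h using 2
  ext x
  simp

lemma ae_pos_of_measure_Iic {μ : Measure ℝ} (h : μ (Set.Iic 0) = 0) : ∀ᵐ x ∂μ, 0 < x := by
  rw [ae_iff]
  convert h using 2
  ext x
  simp

lemma integral_exp_neg_mul_eq_toReal (μ : Measure ℝ) (z : ℝ) :
    ∫ x, Real.exp (-(z * x)) ∂μ = (laplaceTransform μ z).toReal := by
  rw [integral_eq_lintegral_of_nonneg_ae]
  · rfl
  · exact Eventually.of_forall fun x => (Real.exp_pos _).le
  · exact Measurable.aestronglyMeasurable (by fun_prop)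

/-- The exponential `e^{-x}` as a bounded continuous function on the half-line. -/
noncomputable def expNegBounded : BoundedContinuousFunction ℝ≥0 ℝ :=
  BoundedContinuousFunction.ofNormedAddCommGroup (fun x : ℝ≥0 => Real.exp (-(x : ℝ)))
    (by fun_prop) 1 (fun x => by simp)

lemma expNegBounded_apply (x : ℝ≥0) : expNegBounded x = Real.exp (-(x : ℝ)) := rfl

/-- The polynomials in `e^{-x}` form an algebra of bounded continuous functions that separates
points, hence determines finite measures. A monomial of degree `k` integrates to the Laplace
transform at `k`, so the integers suffice; `k = 0` accounts for the constants. -/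
lemma nnreal_measure_ext_of_laplace {μ ν : Measure ℝ≥0} [IsFiniteMeasure μ] [IsFiniteMeasure ν]
    (h : ∀ k : ℕ, ∫ x : ℝ≥0, Real.exp (-(k * (x : ℝ))) ∂μ = ∫ x : ℝ≥0, Real.exp (-(k * (x : ℝ))) ∂ν) :
    μ = ν := by
  let A : StarSubalgebra ℝ (BoundedContinuousFunction ℝ≥0 ℝ) :=
    { Algebra.adjoin ℝ {expNegBounded} with
      star_mem' := fun {a} ha => by
        have : star a = a := by ext x; simp
        rw [this]; exact ha }
  refine ext_of_forall_mem_subalgebra_integral_eq_of_polish (A := A) ?_ ?_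
  · intro x y hxy
    refine ⟨fun t => expNegBounded t, ?_, ?_⟩
    · refine ⟨BoundedContinuousFunction.toContinuousMapStarₐ ℝ expNegBounded, ?_, rfl⟩
      exact ⟨expNegBounded, Algebra.subset_adjoin rfl, rfl⟩
    · intro he
      apply hxy
      simp only [expNegBounded_apply, Real.exp_eq_exp, neg_inj] at he
      exact_mod_cast he
  · intro g hg
    have hg' : g ∈ Algebra.adjoin ℝ {expNegBounded} := hg
    rw [Algebra.adjoin_singleton_eq_range_aeval] at hg'
    obtain ⟨p, rfl⟩ := hg'
    induction p using Polynomial.induction_on' with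
    | add p q hp hq =>
      have hp' := hp (by
        change _ ∈ Algebra.adjoin ℝ {expNegBounded}
        rw [Algebra.adjoin_singleton_eq_range_aeval]; exact ⟨p, rfl⟩)
      have hq' := hq (by
        change _ ∈ Algebra.adjoin ℝ {expNegBounded}
        rw [Algebra.adjoin_singleton_eq_range_aeval]; exact ⟨q, rfl⟩)
      simp only [map_add, BoundedContinuousFunction.coe_add, Pi.add_apply] at hp' hq' ⊢
      rw [integral_add, integral_add, hp', hq'] <;>
      exact BoundedContinuousFunction.integrable _ _
    | monomial k a =>
      have key : ∀ x : ℝ≥0, ((Polynomial.aeval expNegBounded) (Polynomial.monomial k a)) x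
          = a * Real.exp (-(k * (x : ℝ))) := by
        intro x
        simp only [Polynomial.aeval_monomial, BoundedContinuousFunction.coe_mul, Pi.mul_apply,
          BoundedContinuousFunction.coe_pow, Pi.pow_apply, expNegBounded_apply]
        rw [← Real.exp_nat_mul]
        congr 2
        ring
      have key' : ∀ ρ : Measure ℝ≥0, ∫ x, ((Polynomial.aeval expNegBounded)
          (Polynomial.monomial k a)) x ∂ρ = a * ∫ x : ℝ≥0, Real.exp (-(k * (x : ℝ))) ∂ρ := by
        intro ρ
        rw [← integral_const_mul]
        exact integral_congr_ae (Eventually.of_forall key)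
      exact (key' μ).trans (by rw [h]; exact (key' ν).symm)

lemma measure_ext_of_laplaceTransform {μ ν : Measure ℝ} [IsFiniteMeasure μ] [IsFiniteMeasure ν]
    (hμ : μ (Set.Iio 0) = 0) (hν : ν (Set.Iio 0) = 0)
    (h : ∀ k : ℕ, laplaceTransform μ k = laplaceTransform ν k) : μ = ν := by
  have key : ∀ ρ : Measure ℝ, ρ (Set.Iio 0) = 0 →
      (ρ.map Real.toNNReal).map ((↑) : ℝ≥0 → ℝ) = ρ := by
    intro ρ hρ
    rw [Measure.map_map (by fun_prop) (by fun_prop)]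
    conv_rhs => rw [← Measure.map_id (μ := ρ)]
    refine Measure.map_congr ?_
    filter_upwards [ae_nonneg_of_measure_Iio hρ] with x hx
    simp [hx]
  have key2 : ∀ ρ : Measure ℝ, ρ (Set.Iio 0) = 0 → ∀ k : ℕ,
      ∫ x : ℝ≥0, Real.exp (-(k * (x : ℝ))) ∂(ρ.map Real.toNNReal)
        = (laplaceTransform ρ k).toReal := by
    intro ρ hρ k
    rw [integral_map (by fun_prop) (Measurable.aestronglyMeasurable (by fun_prop)),
      ← integral_exp_neg_mul_eq_toReal]
    refine integral_congr_ae ?_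
    filter_upwards [ae_nonneg_of_measure_Iio hρ] with x hx
    simp [hx]
  rw [← key μ hμ, ← key ν hν]
  congr 1
  have := Measure.isFiniteMeasure_map μ Real.toNNReal
  have := Measure.isFiniteMeasure_map ν Real.toNNReal
  refine nnreal_measure_ext_of_laplace fun k => ?_
  rw [key2 μ hμ, key2 ν hν, h]

end Laplace

/-! ### Uniqueness of the drift and the Lévy measure -/

section Levy

/-- Bernoulli's inequality for `(e^{-s})^k`. It makes integrability of `1 - e^{-s}` sufficient for
all integer arguments. -/
lemma one_sub_exp_neg_nat_mul_le (k : ℕ) {s : ℝ} :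
    1 - Real.exp (-(k * s)) ≤ k * (1 - Real.exp (-s)) := by
  have h := one_add_mul_le_pow (a := Real.exp (-s) - 1) (by linarith [Real.exp_pos (-s)]) k
  have e : Real.exp (-(k * s)) = (1 + (Real.exp (-s) - 1)) ^ k := by
    rw [show 1 + (Real.exp (-s) - 1) = Real.exp (-s) by ring, ← Real.exp_nat_mul]
    congr 1; ring
  rw [e]; nlinarith

lemma integrable_one_sub_exp {ν : Measure ℝ} (h0 : ν (Set.Iic 0) = 0)
    (h1 : ∫⁻ s, ENNReal.ofReal (1 - Real.exp (-s)) ∂ν < ∞) (k : ℕ) :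
    Integrable (fun s => 1 - Real.exp (-(k * s))) ν := by
  have hb : Integrable (fun s => 1 - Real.exp (-s)) ν := by
    refine ⟨Measurable.aestronglyMeasurable (by fun_prop), ?_⟩
    rw [hasFiniteIntegral_iff_ofReal]
    · exact h1
    · filter_upwards [ae_pos_of_measure_Iic h0] with s hs
      simp [hs.le]
  refine (hb.const_mul (k : ℝ)).mono' (Measurable.aestronglyMeasurable (by fun_prop)) ?_
  filter_upwards [ae_pos_of_measure_Iic h0] with s hs
  rw [Real.norm_of_nonneg]
  · exact one_sub_exp_neg_nat_mul_le k
  · simp only [sub_nonneg, Real.exp_le_one_iff, Left.neg_nonpos_iff]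
    positivity

/-- A drift and a Lévy measure give a finite measure, with an atom at `0`, that determines them. -/
noncomputable def driftLevySum (b : ℝ) (ν : Measure ℝ) : Measure ℝ :=
  ENNReal.ofReal b • Measure.dirac 0 + ν.withDensity fun s => ENNReal.ofReal (1 - Real.exp (-s))

/-- Since `(1 - e^{-s}) e^{-ks} = (1 - e^{-(k+1)s}) - (1 - e^{-ks})`, weighting by `1 - e^{-s}`
amounts to taking differences of the exponent, and the drift contributes the constant `b`. -/
lemma laplaceTransform_driftLevySum {b : ℝ} (hb : 0 ≤ b) {ν : Measure ℝ} (h0 : ν (Set.Iic 0) = 0)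
    (h1 : ∫⁻ s, ENNReal.ofReal (1 - Real.exp (-s)) ∂ν < ∞) (k : ℕ) :
    laplaceTransform (driftLevySum b ν) k = ENNReal.ofReal
      ((b * ((k + 1 : ℕ) : ℝ) + ∫ s, (1 - Real.exp (-(((k + 1 : ℕ) : ℝ) * s))) ∂ν) -
        (b * k + ∫ s, (1 - Real.exp (-(k * s))) ∂ν)) := by
  have e : (b * ((k + 1 : ℕ) : ℝ) + ∫ s, (1 - Real.exp (-(((k + 1 : ℕ) : ℝ) * s))) ∂ν) -
        (b * k + ∫ s, (1 - Real.exp (-(k * s))) ∂ν) =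
      b + ∫ s, (1 - Real.exp (-s)) * Real.exp (-(k * s)) ∂ν := by
    have : ∀ s : ℝ, (1 - Real.exp (-s)) * Real.exp (-(k * s)) =
        (1 - Real.exp (-(((k + 1 : ℕ) : ℝ) * s))) - (1 - Real.exp (-(k * s))) := by
      intro s
      have : Real.exp (-(((k + 1 : ℕ) : ℝ) * s)) = Real.exp (-s) * Real.exp (-(k * s)) := by
        rw [← Real.exp_add]; congr 1; push_cast; ring
      rw [this]; ring
    simp_rw [this]
    rw [integral_sub (integrable_one_sub_exp h0 h1 (k + 1)) (integrable_one_sub_exp h0 h1 k)]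
    push_cast
    ring
  have hnn : ∀ᵐ s ∂ν, 0 ≤ (1 - Real.exp (-s)) * Real.exp (-(k * s)) := by
    filter_upwards [ae_pos_of_measure_Iic h0] with s hs
    have : 0 ≤ 1 - Real.exp (-s) := by simp [hs.le]
    positivity
  rw [e, ENNReal.ofReal_add hb (integral_nonneg_of_ae hnn), laplaceTransform, driftLevySum,
    lintegral_add_measure, lintegral_smul_measure,
    lintegral_withDensity_eq_lintegral_mul _ (by fun_prop) (by fun_prop),
    ofReal_integral_eq_lintegral_ofReal ?_ hnn]
  · simp only [lintegral_dirac, mul_zero, neg_zero, Real.exp_zero, ENNReal.ofReal_one, smul_eq_mul,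
      mul_one, Pi.mul_apply]
    congr 1
    refine lintegral_congr_ae ?_
    filter_upwards [ae_pos_of_measure_Iic h0] with s hs
    rw [ENNReal.ofReal_mul]
    simp [hs.le]
  · have hb := integrable_one_sub_exp h0 h1 1
    simp only [Nat.cast_one, one_mul] at hb
    refine hb.mono (Measurable.aestronglyMeasurable (by fun_prop)) ?_
    filter_upwards [ae_pos_of_measure_Iic h0] with s hs
    rw [norm_mul]
    refine mul_le_of_le_one_right (norm_nonneg _) ?_
    rw [Real.norm_of_nonneg (Real.exp_pos _).le, Real.exp_le_one_iff]
    have : (0 : ℝ) ≤ k * s := by positivity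
    linarith

/-- The finite measures `driftLevySum` agree, having the same Laplace transform at the integers. The
drift is their atom at `0`, which the Lévy measures do not charge; the rest is the Lévy measure up
to an invertible density. -/
lemma drift_levy_unique {b b' : ℝ} {ν ν' : Measure ℝ} (hb : 0 ≤ b) (hb' : 0 ≤ b')
    (h0 : ν (Set.Iic 0) = 0) (h0' : ν' (Set.Iic 0) = 0)
    (h1 : ∫⁻ s, ENNReal.ofReal (1 - Real.exp (-s)) ∂ν < ∞)
    (h1' : ∫⁻ s, ENNReal.ofReal (1 - Real.exp (-s)) ∂ν' < ∞)
    (h : ∀ k : ℕ, b * k + ∫ s, (1 - Real.exp (-(k * s))) ∂ν =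
      b' * k + ∫ s, (1 - Real.exp (-(k * s))) ∂ν') : b = b' ∧ ν = ν' := by
  have fin : ∀ (b : ℝ) (ν : Measure ℝ), ∫⁻ s, ENNReal.ofReal (1 - Real.exp (-s)) ∂ν < ∞ →
      IsFiniteMeasure (driftLevySum b ν) := by
    intro b ν h
    constructor
    simp only [driftLevySum, Measure.coe_add, Measure.coe_smul, Pi.add_apply, Pi.smul_apply,
      measure_univ, smul_eq_mul, mul_one, withDensity_apply _ MeasurableSet.univ,
      Measure.restrict_univ]
    exact ENNReal.add_lt_top.2 ⟨ENNReal.ofReal_lt_top, h⟩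
  have null : ∀ (ν : Measure ℝ), ν (Set.Iic 0) = 0 →
      (ν.withDensity fun s => ENNReal.ofReal (1 - Real.exp (-s))) (Set.Iic 0) = 0 :=
    fun ν h => withDensity_absolutelyContinuous _ _ h
  have neg : ∀ (b : ℝ) (ν : Measure ℝ), ν (Set.Iic 0) = 0 →
      driftLevySum b ν (Set.Iio 0) = 0 := by
    intro b ν h
    simp only [driftLevySum, Measure.coe_add, Measure.coe_smul, Pi.add_apply, Pi.smul_apply]
    rw [measure_mono_null Set.Iio_subset_Iic_self (null ν h)]
    simp
  have atom : ∀ (b : ℝ) (ν : Measure ℝ), ν (Set.Iic 0) = 0 →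
      driftLevySum b ν {0} = ENNReal.ofReal b := by
    intro b ν h
    simp only [driftLevySum, Measure.coe_add, Measure.coe_smul, Pi.add_apply, Pi.smul_apply]
    rw [measure_mono_null (by simp) (null ν h)]
    simp
  have := fin b ν h1
  have := fin b' ν' h1'
  have key : driftLevySum b ν = driftLevySum b' ν' := by
    refine measure_ext_of_laplaceTransform (neg b ν h0) (neg b' ν' h0') fun k => ?_
    rw [laplaceTransform_driftLevySum hb h0 h1, laplaceTransform_driftLevySum hb' h0' h1', h, h]
  have hbb : b = b' := by
    have := congrArg (fun ρ => ρ {0}) key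
    simp only [atom b ν h0, atom b' ν' h0'] at this
    exact (ENNReal.ofReal_eq_ofReal_iff hb hb').1 this
  refine ⟨hbb, ?_⟩
  subst hbb
  have hd : (ν.withDensity fun s => ENNReal.ofReal (1 - Real.exp (-s))) =
      ν'.withDensity fun s => ENNReal.ofReal (1 - Real.exp (-s)) := by
    ext B hB
    have := congrArg (fun ρ => ρ B) key
    simp only [driftLevySum, Measure.coe_add, Measure.coe_smul, Pi.add_apply, Pi.smul_apply] at this
    refine (ENNReal.add_right_inj ?_).1 this
    exact ENNReal.mul_ne_top ENNReal.ofReal_ne_top (measure_ne_top _ _)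
  -- The density `1 - e^{-s}` is positive and finite on `(0, ∞)`, which carries `ν`, so it can be
  -- divided out.
  have recover : ∀ (ν : Measure ℝ), ν (Set.Iic 0) = 0 →
      (ν.withDensity fun s => ENNReal.ofReal (1 - Real.exp (-s))).withDensity
        (fun s => (ENNReal.ofReal (1 - Real.exp (-s)))⁻¹) = ν := by
    intro ν h
    refine withDensity_inv_same (by fun_prop) ?_ (by simp)
    filter_upwards [ae_pos_of_measure_Iic h] with s hs
    simp [hs]
  rw [← recover ν h0, ← recover ν' h0', hd]

end Levy

/-! ### Compound Poisson laws: Laplace transform, atom at zero, small rates -/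

section CompoundPoisson

lemma isProbabilityMeasure_convPower (S : Measure ℝ) [IsProbabilityMeasure S] (k : ℕ) :
    IsProbabilityMeasure (convPower S k) := by
  induction k with
  | zero => exact Measure.dirac.isProbabilityMeasure
  | succ k ih => rw [convPower]; infer_instance

lemma laplaceTransform_le_one {μ : Measure ℝ} [IsProbabilityMeasure μ] (h : μ (Set.Iio 0) = 0)
    {z : ℝ} (hz : 0 ≤ z) : laplaceTransform μ z ≤ 1 := by
  calc laplaceTransform μ z ≤ ∫⁻ _, 1 ∂μ := by
        refine lintegral_mono_ae ?_
        filter_upwards [ae_nonneg_of_measure_Iio h] with x hx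
        rw [← ENNReal.ofReal_one]
        exact ENNReal.ofReal_le_ofReal (by simpa using mul_nonneg hz hx)
    _ = 1 := by simp

lemma laplaceTransform_conv (μ ν : Measure ℝ) [SFinite μ] [SFinite ν] (z : ℝ) :
    laplaceTransform (Measure.conv μ ν) z = laplaceTransform μ z * laplaceTransform ν z := by
  rw [laplaceTransform, Measure.lintegral_conv (measurable_ofReal_exp_neg_mul z)]
  have : ∀ x y : ℝ, ENNReal.ofReal (Real.exp (-(z * (x + y)))) =
      ENNReal.ofReal (Real.exp (-(z * x))) * ENNReal.ofReal (Real.exp (-(z * y))) := by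
    intro x y
    rw [← ENNReal.ofReal_mul (Real.exp_pos _).le, ← Real.exp_add]
    congr 2; ring
  simp_rw [this]
  simp_rw [lintegral_const_mul _ (measurable_ofReal_exp_neg_mul z)]
  rw [lintegral_mul_const _ (measurable_ofReal_exp_neg_mul z)]
  rfl

lemma laplaceTransform_convPower (S : Measure ℝ) [IsProbabilityMeasure S] (z : ℝ) (k : ℕ) :
    laplaceTransform (convPower S k) z = laplaceTransform S z ^ k := by
  induction k with
  | zero => simp [convPower, laplaceTransform]
  | succ k ih =>
    have := isProbabilityMeasure_convPower S k
    rw [convPower, laplaceTransform_conv, ih, pow_succ']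

/-- The generating function of the Poisson law: with `s` a Laplace transform it gives that of the
compound law, and with `s = 1` the total mass. -/
lemma hasSum_exp_mul_pow_div_factorial (r s : ℝ) :
    HasSum (fun k : ℕ => Real.exp (-r) * r ^ k / (k.factorial : ℝ) * s ^ k)
      (Real.exp (-(r * (1 - s)))) := by
  have h := (NormedSpace.exp_series_hasSum_exp' (𝕂 := ℝ) (r * s)).mul_left (Real.exp (-r))
  rw [← Real.exp_eq_exp_ℝ, ← Real.exp_add] at h
  convert! h using 1
  · ext k
    simp only [smul_eq_mul, mul_pow]
    ring
  · congr 1; ring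

lemma laplaceTransform_compoundPoissonLaw {r : ℝ} (hr : 0 ≤ r) (S : Measure ℝ)
    [IsProbabilityMeasure S] (hS : S (Set.Iio 0) = 0) {z : ℝ} (hz : 0 ≤ z) :
    laplaceTransform (compoundPoissonLaw r S) z =
      ENNReal.ofReal (Real.exp (-(r * (1 - (laplaceTransform S z).toReal)))) := by
  have h1 := laplaceTransform_le_one hS hz
  set s := (laplaceTransform S z).toReal with hs
  have hs0 : 0 ≤ s := ENNReal.toReal_nonneg
  have e : laplaceTransform S z = ENNReal.ofReal s := by
    rw [hs, ENNReal.ofReal_toReal (ne_top_of_le_ne_top ENNReal.one_ne_top h1)]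
  rw [laplaceTransform, compoundPoissonLaw, lintegral_sum_measure]
  have hsum := hasSum_exp_mul_pow_div_factorial r s
  rw [← hsum.tsum_eq, ENNReal.ofReal_tsum_of_nonneg (fun k => by positivity) hsum.summable]
  refine tsum_congr fun k => ?_
  rw [lintegral_smul_measure, ENNReal.ofReal_mul (by positivity), ENNReal.ofReal_pow hs0, ← e,
    ← laplaceTransform_convPower]
  rfl

lemma isProbabilityMeasure_compoundPoissonLaw {r : ℝ} (hr : 0 ≤ r) (S : Measure ℝ)
    [IsProbabilityMeasure S] : IsProbabilityMeasure (compoundPoissonLaw r S) := by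
  constructor
  have hsum := hasSum_exp_mul_pow_div_factorial r 1
  have : ∀ k, (convPower S k) Set.univ = 1 := fun k =>
    (isProbabilityMeasure_convPower S k).measure_univ
  simp only [one_pow, mul_one, sub_self, mul_zero, neg_zero, Real.exp_zero] at hsum
  rw [compoundPoissonLaw, Measure.sum_apply _ MeasurableSet.univ]
  simp only [Measure.smul_apply, this, smul_eq_mul, mul_one]
  rw [← ENNReal.ofReal_tsum_of_nonneg (fun k => by positivity) hsum.summable, hsum.tsum_eq]
  simp

lemma conv_Iic_zero {μ ν : Measure ℝ} [SFinite μ] [SFinite ν] (hμ : μ (Set.Iic 0) = 0)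
    (hν : ν (Set.Iio 0) = 0) : Measure.conv μ ν (Set.Iic 0) = 0 := by
  have h : ∀ᵐ p : ℝ × ℝ ∂(μ.prod ν), 0 < p.1 + p.2 := by
    rw [Measure.ae_prod_iff_ae_ae (measurableSet_lt (by fun_prop) (by fun_prop))]
    filter_upwards [ae_pos_of_measure_Iic hμ] with x hx
    filter_upwards [ae_nonneg_of_measure_Iio hν] with y hy
    positivity
  rw [Measure.conv, Measure.map_apply (by fun_prop) measurableSet_Iic]
  rw [ae_iff] at h
  convert h using 2
  ext p
  simp

/-- A sum of at least one positive jump and nonnegative others is positive. Hence the mass of the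
compound law at `0` is that of the term without jumps. -/
lemma convPower_succ_Iic_zero (S : Measure ℝ) [IsProbabilityMeasure S] (hS : S (Set.Iic 0) = 0)
    (k : ℕ) : convPower S (k + 1) (Set.Iic 0) = 0 := by
  have := isProbabilityMeasure_convPower S k
  rw [convPower]
  refine conv_Iic_zero hS ?_
  induction k with
  | zero => simp [convPower]
  | succ k ih =>
    have := isProbabilityMeasure_convPower S k
    exact measure_mono_null Set.Iio_subset_Iic_self (conv_Iic_zero hS (ih this))

lemma compoundPoissonLaw_apply (r : ℝ) (S : Measure ℝ) {B : Set ℝ} (hB : MeasurableSet B) :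
    compoundPoissonLaw r S B = ENNReal.ofReal (Real.exp (-r)) * Measure.dirac 0 B +
      ∑' k : ℕ, ENNReal.ofReal (Real.exp (-r) * r ^ (k + 1) / ((k + 1).factorial : ℝ)) *
        convPower S (k + 1) B := by
  rw [compoundPoissonLaw, Measure.sum_apply _ hB, tsum_eq_zero_add' ENNReal.summable]
  simp [convPower]

lemma compoundPoissonLaw_Iio (r : ℝ) (S : Measure ℝ) [IsProbabilityMeasure S]
    (hS : S (Set.Iic 0) = 0) : compoundPoissonLaw r S (Set.Iio 0) = 0 := by
  rw [compoundPoissonLaw_apply _ _ measurableSet_Iio]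
  simp [measure_mono_null Set.Iio_subset_Iic_self (convPower_succ_Iic_zero S hS _)]

lemma compoundPoissonLaw_Iic (r : ℝ) (S : Measure ℝ) [IsProbabilityMeasure S]
    (hS : S (Set.Iic 0) = 0) :
    compoundPoissonLaw r S (Set.Iic 0) = ENNReal.ofReal (Real.exp (-r)) := by
  rw [compoundPoissonLaw_apply _ _ measurableSet_Iic]
  simp [convPower_succ_Iic_zero S hS _]

/-- As the rate tends to `0`, the compound Poisson law off `0` is its rate times the jump law, up
to an error of second order. -/
lemma tendsto_mul_compoundPoissonLaw {r : ℝ} (hr : 0 ≤ r) (S : Measure ℝ) [IsProbabilityMeasure S]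
    (hS : S (Set.Iic 0) = 0) {B : Set ℝ} (hB : MeasurableSet B) :
    Tendsto (fun N : ℕ => (N : ℝ≥0∞) * compoundPoissonLaw (r / N) S (B ∩ Set.Ioi 0)) atTop
      (𝓝 (ENNReal.ofReal r * S B)) := by
  have hSB : S (B ∩ Set.Ioi 0) = S B := by
    refine measure_inter_conull ?_
    convert hS using 2
    ext x; simp
  have expand : ∀ x : ℝ, 0 ≤ x → compoundPoissonLaw x S (B ∩ Set.Ioi 0) =
      ENNReal.ofReal (Real.exp (-x) * x) * S B +
      ∑' k : ℕ, ENNReal.ofReal (Real.exp (-x) * x ^ (k + 2) / ((k + 2).factorial : ℝ)) *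
        convPower S (k + 2) (B ∩ Set.Ioi 0) := by
    intro x hx
    rw [compoundPoissonLaw_apply _ _ (hB.inter measurableSet_Ioi), tsum_eq_zero_add' ENNReal.summable]
    have : convPower S (0 + 1) (B ∩ Set.Ioi 0) = S B := by
      simp [convPower, hSB]
    rw [this]
    have hd : (Measure.dirac (0 : ℝ)) (B ∩ Set.Ioi 0) = 0 := by
      rw [Measure.dirac_apply' _ (hB.inter measurableSet_Ioi)]; simp
    rw [hd]
    simp
  -- Two or more jumps: `(k + 2)! ≥ k!` allows `x ^ 2` to be factored out of a Poisson series of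
  -- total mass one.
  have upper : ∀ x : ℝ, 0 ≤ x →
      ∑' k : ℕ, ENNReal.ofReal (Real.exp (-x) * x ^ (k + 2) / ((k + 2).factorial : ℝ)) *
        convPower S (k + 2) (B ∩ Set.Ioi 0) ≤ ENNReal.ofReal (x ^ 2) := by
    intro x hx
    have hs := (hasSum_exp_mul_pow_div_factorial x 1).mul_left (x ^ 2)
    calc _ ≤ ∑' k : ℕ, ENNReal.ofReal (x ^ 2 *
          (Real.exp (-x) * x ^ k / (k.factorial : ℝ) * 1 ^ k)) := by
          refine ENNReal.tsum_le_tsum fun k => ?_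
          have := isProbabilityMeasure_convPower S (k + 2)
          refine (mul_le_of_le_one_right zero_le prob_le_one).trans ?_
          refine ENNReal.ofReal_le_ofReal ?_
          have h2 : (k.factorial : ℝ) ≤ (k + 2).factorial := by
            exact_mod_cast Nat.factorial_le (by omega)
          have h3 : (0 : ℝ) < k.factorial := by exact_mod_cast Nat.factorial_pos k
          calc Real.exp (-x) * x ^ (k + 2) / ((k + 2).factorial : ℝ)
              ≤ Real.exp (-x) * x ^ (k + 2) / (k.factorial : ℝ) := by gcongr
            _ = _ := by ring
      _ = ENNReal.ofReal (x ^ 2) := by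
          rw [← ENNReal.ofReal_tsum_of_nonneg (fun k => by positivity) hs.summable, hs.tsum_eq]
          simp
  have hx : Tendsto (fun N : ℕ => r / (N : ℝ)) atTop (𝓝 0) :=
    tendsto_const_div_atTop_nhds_zero_nat r
  have lim1 : Tendsto (fun N : ℕ => ENNReal.ofReal (Real.exp (-(r / N)) * r) * S B) atTop
      (𝓝 (ENNReal.ofReal r * S B)) := by
    refine ENNReal.Tendsto.mul_const (ENNReal.tendsto_ofReal ?_) (Or.inr (measure_ne_top _ _))
    have : Tendsto (fun N : ℕ => Real.exp (-(r / N)) * r) atTop (𝓝 (Real.exp (-0) * r)) :=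
      ((Real.continuous_exp.tendsto _).comp hx.neg).mul_const r
    simpa using this
  have lim2 : Tendsto (fun N : ℕ => ENNReal.ofReal (Real.exp (-(r / N)) * r) * S B +
      ENNReal.ofReal (r * (r / N))) atTop (𝓝 (ENNReal.ofReal r * S B)) := by
    have : Tendsto (fun N : ℕ => ENNReal.ofReal (r * (r / N))) atTop (𝓝 0) := by
      have := ENNReal.tendsto_ofReal (hx.const_mul r)
      simpa using this
    simpa using lim1.add this
  have scale : ∀ N : ℕ, 0 < N → (N : ℝ≥0∞) * (ENNReal.ofReal (Real.exp (-(r / N)) * (r / N)) * S B)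
      = ENNReal.ofReal (Real.exp (-(r / N)) * r) * S B := by
    intro N hN
    rw [← mul_assoc, ← ENNReal.ofReal_natCast, ← ENNReal.ofReal_mul (by positivity)]
    congr 2
    field_simp
  refine tendsto_of_tendsto_of_tendsto_of_le_of_le' lim1 lim2 ?_ ?_
  · filter_upwards [eventually_gt_atTop 0] with N hN
    rw [expand _ (by positivity), mul_add, scale N hN]
    exact le_self_add
  · filter_upwards [eventually_gt_atTop 0] with N hN
    rw [expand _ (by positivity), mul_add, scale N hN]
    gcongr
    refine (mul_le_mul_right (upper (r / N) (by positivity)) _).trans ?_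
    rw [← ENNReal.ofReal_natCast, ← ENNReal.ofReal_mul (by positivity)]
    refine ENNReal.ofReal_le_ofReal (le_of_eq ?_)
    field_simp

end CompoundPoisson

/-! ### Semigroups of rate matrices and their resolvents -/

section RateMatrix

variable {ι : Type*} [Fintype ι] [DecidableEq ι]

section Norm

open scoped Matrix.Norms.Operator

lemma hasDerivAt_exp_smul_mulVec (Q : Matrix ι ι ℝ) (f : ι → ℝ) (i : ι) (t : ℝ) :
    HasDerivAt (fun t : ℝ => (NormedSpace.exp (t • Q)).mulVec f i)
      ((NormedSpace.exp (t • Q)).mulVec (Q.mulVec f) i) t := by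
  have h := hasDerivAt_exp_smul_const (𝕂 := ℝ) Q t
  rw [Matrix.mulVec_mulVec]
  let φ : Matrix ι ι ℝ →ₗ[ℝ] ℝ :=
    { toFun := fun M => M.mulVec f i
      map_add' := fun A B => by simp [Matrix.add_mulVec]
      map_smul' := fun c A => by simp [Matrix.smul_mulVec] }
  exact (LinearMap.toContinuousLinearMap φ).hasFDerivAt.comp_hasDerivAt t h

lemma exp_entry_nonneg {A : Matrix ι ι ℝ} (hA : ∀ i j, 0 ≤ A i j) (i j : ι) :
    0 ≤ NormedSpace.exp A i j := by
  have hpow : ∀ (k : ℕ) (i j : ι), 0 ≤ (A ^ k) i j := by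
    intro k
    induction k with
    | zero => intro i j; rw [pow_zero, Matrix.one_apply]; split_ifs <;> norm_num
    | succ k ih =>
      intro i j
      rw [pow_succ, Matrix.mul_apply]
      exact Finset.sum_nonneg fun l _ => mul_nonneg (ih i l) (hA l j)
  have h := NormedSpace.exp_series_hasSum_exp' (𝕂 := ℝ) A
  have h' := (Pi.hasSum.1 ((Pi.hasSum.1 h) i)) j
  refine h'.nonneg fun k => ?_
  exact mul_nonneg (by positivity) (hpow k i j)

/-- Adding the scalar matrix `c` makes all entries nonnegative, because `c` dominates every diagonal
entry in absolute value. Scalars commute with `A`, so the exponential only changes by the positive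
factor `e^{-c}`. -/
lemma exp_entry_nonneg_of_offDiag {A : Matrix ι ι ℝ} (hA : ∀ i j, i ≠ j → 0 ≤ A i j) (i j : ι) :
    0 ≤ NormedSpace.exp A i j := by
  set c : ℝ := ∑ k, |A k k| with hc
  have e : A = (A + c • (1 : Matrix ι ι ℝ)) + algebraMap ℝ (Matrix ι ι ℝ) (-c) := by
    rw [Algebra.algebraMap_eq_smul_one, neg_smul, add_neg_cancel_right]
  have hcomm : Commute (A + c • (1 : Matrix ι ι ℝ)) (algebraMap ℝ (Matrix ι ι ℝ) (-c)) :=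
    (Algebra.commutes (-c) _).symm
  have hscalar : NormedSpace.exp (algebraMap ℝ (Matrix ι ι ℝ) (-c)) =
      algebraMap ℝ (Matrix ι ι ℝ) (Real.exp (-c)) := by
    rw [Real.exp_eq_exp_ℝ]
    exact (NormedSpace.algebraMap_exp_comm (𝔸 := Matrix ι ι ℝ) (-c)).symm
  have hexp : NormedSpace.exp A = Real.exp (-c) • NormedSpace.exp (A + c • (1 : Matrix ι ι ℝ)) := by
    conv_lhs => rw [e, Matrix.exp_add_of_commute _ _ hcomm, hscalar]
    rw [← Algebra.commutes, ← Algebra.smul_def]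
  rw [hexp, Matrix.smul_apply, smul_eq_mul]
  refine mul_nonneg (Real.exp_pos _).le (exp_entry_nonneg (fun k l => ?_) i j)
  rw [Matrix.add_apply, Matrix.smul_apply, Matrix.one_apply]
  split_ifs with hkl
  · subst hkl
    have h1 : |A k k| ≤ c := Finset.single_le_sum (f := fun k => |A k k|)
      (fun _ _ => abs_nonneg _) (Finset.mem_univ k)
    simp only [smul_eq_mul, mul_one]
    linarith [neg_abs_le (A k k)]
  · simpa using hA k l hkl

lemma exp_smul_mulVec_comm (Q : Matrix ι ι ℝ) (f : ι → ℝ) (t : ℝ) :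
    (NormedSpace.exp (t • Q)).mulVec (Q.mulVec f) = Q.mulVec ((NormedSpace.exp (t • Q)).mulVec f) := by
  rw [Matrix.mulVec_mulVec, Matrix.mulVec_mulVec]
  congr 1
  exact (((Commute.refl Q).smul_left t).exp_left).eq

lemma exp_add_smul_mulVec (Q : Matrix ι ι ℝ) (f : ι → ℝ) (s t : ℝ) :
    (NormedSpace.exp ((s + t) • Q)).mulVec f =
      (NormedSpace.exp (s • Q)).mulVec ((NormedSpace.exp (t • Q)).mulVec f) := by
  rw [add_smul, Matrix.exp_add_of_commute _ _ (((Commute.refl Q).smul_left s).smul_right t),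
    Matrix.mulVec_mulVec]

end Norm

lemma exp_zero_smul_mulVec (Q : Matrix ι ι ℝ) (f : ι → ℝ) :
    (NormedSpace.exp ((0 : ℝ) • Q)).mulVec f = f := by
  rw [zero_smul, NormedSpace.exp_zero, Matrix.one_mulVec]

lemma continuous_exp_smul_mulVec (Q : Matrix ι ι ℝ) (f : ι → ℝ) (i : ι) :
    Continuous fun t : ℝ => (NormedSpace.exp (t • Q)).mulVec f i :=
  continuous_iff_continuousAt.2 fun t => (hasDerivAt_exp_smul_mulVec Q f i t).continuousAt

/-- A matrix of jump rates: nonnegative off the diagonal, with vanishing row sums. -/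
structure IsRateMatrix (Q : Matrix ι ι ℝ) : Prop where
  offDiag : ∀ i j, i ≠ j → 0 ≤ Q i j
  row_sum : ∀ i, ∑ j, Q i j = 0

namespace IsRateMatrix

variable {Q : Matrix ι ι ℝ}

lemma exp_nonneg (hQ : IsRateMatrix Q) {t : ℝ} (ht : 0 ≤ t) (i j : ι) :
    0 ≤ NormedSpace.exp (t • Q) i j :=
  exp_entry_nonneg_of_offDiag
    (fun k l hkl => by simpa using mul_nonneg ht (hQ.offDiag k l hkl)) i j

/-- Vanishing row sums mean that `Q` kills the constant vector, so the semigroup applied to it has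
zero derivative. -/
lemma exp_row_sum (hQ : IsRateMatrix Q) (t : ℝ) (i : ι) :
    ∑ j, NormedSpace.exp (t • Q) i j = 1 := by
  have h0 : Q.mulVec 1 = 0 := by
    ext i; simpa [Matrix.mulVec, dotProduct] using hQ.row_sum i
  have hd := fun t => hasDerivAt_exp_smul_mulVec Q 1 i t
  simp only [h0, Matrix.mulVec_zero] at hd
  have := is_const_of_deriv_eq_zero (fun t => (hd t).differentiableAt) (fun t => (hd t).deriv) t 0
  rw [exp_zero_smul_mulVec] at this
  simpa [Matrix.mulVec, dotProduct] using this

lemma exp_le_one (hQ : IsRateMatrix Q) {t : ℝ} (ht : 0 ≤ t) (i j : ι) :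
    NormedSpace.exp (t • Q) i j ≤ 1 := by
  rw [← hQ.exp_row_sum t i]
  exact Finset.single_le_sum (f := fun j => NormedSpace.exp (t • Q) i j)
    (fun j _ => hQ.exp_nonneg ht i j) (Finset.mem_univ j)

lemma abs_exp_mulVec_le (hQ : IsRateMatrix Q) {t : ℝ} (ht : 0 ≤ t) (f : ι → ℝ) (i : ι) :
    |(NormedSpace.exp (t • Q)).mulVec f i| ≤ ∑ j, |f j| := by
  rw [Matrix.mulVec, dotProduct]
  refine (Finset.abs_sum_le_sum_abs _ _).trans (Finset.sum_le_sum fun j _ => ?_)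
  rw [abs_mul, abs_of_nonneg (hQ.exp_nonneg ht i j)]
  exact mul_le_of_le_one_left (abs_nonneg _) (hQ.exp_le_one ht i j)

lemma integrableOn_exp_mulVec (hQ : IsRateMatrix Q) {z : ℝ} (hz : 0 < z) (f : ι → ℝ) (i : ι) :
    IntegrableOn (fun t : ℝ => Real.exp (-(z * t)) * (NormedSpace.exp (t • Q)).mulVec f i)
      (Set.Ioi 0) := by
  have h := (integrableOn_exp_mul_Ioi (a := -z) (by linarith) 0).mul_const (∑ j, |f j|)
  refine Integrable.mono' h ?_ ?_
  · exact (Continuous.mul (by fun_prop) (continuous_exp_smul_mulVec Q f i)).aestronglyMeasurable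
  · filter_upwards [ae_restrict_mem measurableSet_Ioi] with t ht
    rw [norm_mul, Real.norm_of_nonneg (Real.exp_pos _).le, Real.norm_eq_abs, neg_mul]
    gcongr
    exact hQ.abs_exp_mulVec_le (le_of_lt ht) f i

/-- The resolvent equation. -/
lemma integral_exp_mulVec (hQ : IsRateMatrix Q) {z : ℝ} (hz : 0 < z) (f : ι → ℝ) (i : ι) :
    ∫ t in Set.Ioi (0 : ℝ), Real.exp (-(z * t)) *
      (NormedSpace.exp (t • Q)).mulVec (z • f - Q.mulVec f) i = f i := by
  -- The integrand is the derivative of `-e^{-zt} e^{tQ} f`, which equals `-f` at `0` and decays at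
  -- infinity because the semigroup is bounded.
  have hd : ∀ t : ℝ, HasDerivAt
      (fun t : ℝ => -(Real.exp (-(z * t)) * (NormedSpace.exp (t • Q)).mulVec f i))
      (Real.exp (-(z * t)) * (NormedSpace.exp (t • Q)).mulVec (z • f - Q.mulVec f) i) t := by
    intro t
    have h1 : HasDerivAt (fun t : ℝ => Real.exp (-(z * t))) (Real.exp (-(z * t)) * -z) t := by
      have := ((hasDerivAt_id t).const_mul z).neg.exp
      simpa using this
    convert! (h1.mul (hasDerivAt_exp_smul_mulVec Q f i t)).neg using 1
    simp only [Matrix.mulVec_sub, Matrix.mulVec_smul, Pi.sub_apply, Pi.smul_apply, smul_eq_mul]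
    ring
  have hlim : Tendsto
      (fun t : ℝ => -(Real.exp (-(z * t)) * (NormedSpace.exp (t • Q)).mulVec f i)) atTop (𝓝 0) := by
    rw [← neg_zero]
    refine Tendsto.neg (squeeze_zero_norm' (a := fun t => Real.exp (-(z * t)) * ∑ j, |f j|) ?_ ?_)
    · filter_upwards [eventually_ge_atTop 0] with t ht
      rw [norm_mul, Real.norm_of_nonneg (Real.exp_pos _).le, Real.norm_eq_abs]
      gcongr
      exact hQ.abs_exp_mulVec_le ht f i
    · rw [← zero_mul (∑ j, |f j|)]
      refine Tendsto.mul_const _ (Real.tendsto_exp_neg_atTop_nhds_zero.comp ?_)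
      exact tendsto_id.const_mul_atTop hz
  rw [integral_Ioi_of_hasDerivAt_of_tendsto (hd 0).continuousAt.continuousWithinAt
    (fun t _ => hd t) (hQ.integrableOn_exp_mulVec hz _ i) hlim]
  simp

end IsRateMatrix

end RateMatrix

/-! ### The hitting time of zero and the identity for the Green function -/

namespace FiniteSpeedMeasure

variable {n : ℕ} (m : FiniteSpeedMeasure n)

lemma jumpRate_nonneg (i j : Fin (n + 1)) : 0 ≤ m.jumpRate i j := by
  rw [jumpRate]
  split_ifs
  · exact inv_nonneg.2 (mul_nonneg (m.mass_pos i).le (abs_nonneg _))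
  · exact le_rfl

lemma jumpRate_pos {i j : Fin (n + 1)} (h : (i : ℕ) + 1 = j ∨ (j : ℕ) + 1 = i) :
    0 < m.jumpRate i j := by
  rw [jumpRate, if_pos h]
  refine inv_pos.2 (mul_pos (m.mass_pos i) (abs_pos.2 (sub_ne_zero.2 fun he => ?_)))
  have := m.pos_strictMono.injective he
  subst this
  omega

lemma jumpRate_self (i : Fin (n + 1)) : m.jumpRate i i = 0 := by
  rw [jumpRate, if_neg (by omega)]

lemma holdingRate_zero (hn : 1 ≤ n) :
    m.holdingRate 0 = m.jumpRate 0 ⟨1, by omega⟩ := by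
  rw [holdingRate]
  refine Finset.sum_eq_single _ (fun j _ hj => ?_) (by simp)
  rw [jumpRate, if_neg]
  rintro (h | h)
  · exact hj (Fin.ext (by simpa using h.symm))
  · simp at h

lemma holdingRate_zero_pos (hn : 1 ≤ n) : 0 < m.holdingRate 0 := by
  rw [m.holdingRate_zero hn]
  exact m.jumpRate_pos (Or.inl (by simp))

lemma generator_eq (i j : Fin (n + 1)) :
    m.generator i j = m.jumpRate i j - if i = j then m.holdingRate i else 0 := by
  simp only [generator, Matrix.of_apply]
  split_ifs with h
  · subst h; rw [jumpRate_self]; ring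
  · ring

lemma isRateMatrix_generator : IsRateMatrix m.generator where
  offDiag i j hij := by
    rw [generator_eq, if_neg hij, sub_zero]; exact m.jumpRate_nonneg i j
  row_sum i := by
    simp_rw [generator_eq]
    rw [Finset.sum_sub_distrib]
    simp [holdingRate]

/-- The generator of the process absorbed at `0`. -/
noncomputable def absorbedGenerator : Matrix (Fin (n + 1)) (Fin (n + 1)) ℝ :=
  Matrix.of fun i j => if i = 0 then 0 else m.generator i j

lemma isRateMatrix_absorbedGenerator : IsRateMatrix m.absorbedGenerator where
  offDiag i j hij := by
    simp only [absorbedGenerator, Matrix.of_apply]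
    split_ifs
    · exact le_rfl
    · exact m.isRateMatrix_generator.offDiag i j hij
  row_sum i := by
    simp only [absorbedGenerator, Matrix.of_apply]
    split_ifs
    · simp
    · exact m.isRateMatrix_generator.row_sum i

lemma absorbedGenerator_mulVec_zero (f : Fin (n + 1) → ℝ) : m.absorbedGenerator.mulVec f 0 = 0 := by
  simp [absorbedGenerator, Matrix.mulVec, dotProduct]

lemma absorbedGenerator_mulVec (f : Fin (n + 1) → ℝ) {i : Fin (n + 1)} (hi : i ≠ 0) :
    m.absorbedGenerator.mulVec f i = m.generator.mulVec f i := by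
  simp [absorbedGenerator, Matrix.mulVec, dotProduct, hi]

lemma generator_mulVec (f : Fin (n + 1) → ℝ) (i : Fin (n + 1)) :
    m.generator.mulVec f i = ∑ j, m.jumpRate i j * (f j - f i) := by
  simp only [Matrix.mulVec, dotProduct, generator_eq, sub_mul, mul_sub, Finset.sum_sub_distrib,
    ← Finset.sum_mul]
  congr 1
  simp [holdingRate]

/-- Harmonic functions of the absorbed process are minimal at `0`. -/
lemma le_of_absorbedGenerator_mulVec_eq_zero {f : Fin (n + 1) → ℝ}
    (hf : m.absorbedGenerator.mulVec f = 0) (i : Fin (n + 1)) : f 0 ≤ f i := by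
  obtain ⟨k, -, hk⟩ := Finset.exists_min_image Finset.univ f Finset.univ_nonempty
  -- At a minimum other than `0`, the equation is a vanishing sum of nonnegative terms. The left
  -- neighbour, reached at a positive rate, is thus also a minimum, and descending leads to `0`.
  have step : ∀ (l : ℕ) (hl : l < n + 1), f ⟨l, hl⟩ = f k → f 0 = f k := by
    intro l
    induction l with
    | zero => intro hl h; exact h
    | succ l ih =>
      intro hl h
      refine ih (by omega) ?_
      have h0 := congrFun hf ⟨l + 1, hl⟩
      rw [absorbedGenerator_mulVec _ _ (by simp [Fin.ext_iff]), generator_mulVec, Pi.zero_apply,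
        Finset.sum_eq_zero_iff_of_nonneg] at h0
      · have h1 := h0 ⟨l, by omega⟩ (Finset.mem_univ _)
        rcases mul_eq_zero.1 h1 with h2 | h2
        · exact absurd h2 (m.jumpRate_pos (Or.inr rfl)).ne'
        · linarith
      · intro j _
        refine mul_nonneg (m.jumpRate_nonneg _ _) ?_
        rw [h]
        linarith [hk j (Finset.mem_univ _)]
  rw [step k k.2 rfl]
  exact hk i (Finset.mem_univ _)

/-- The probability of having been absorbed at `0` before time `x`. -/
noncomputable def absorbedProb (x : ℝ) (i : Fin (n + 1)) : ℝ :=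
  (NormedSpace.exp (x • m.absorbedGenerator)).mulVec (Pi.single 0 1) i

/-- The density of the time of absorption at `0`. -/
noncomputable def absorptionDensity (x : ℝ) (i : Fin (n + 1)) : ℝ :=
  (NormedSpace.exp (x • m.absorbedGenerator)).mulVec
    (m.absorbedGenerator.mulVec (Pi.single 0 1)) i

lemma hasDerivAt_absorbedProb (x : ℝ) (i : Fin (n + 1)) :
    HasDerivAt (fun x => m.absorbedProb x i) (m.absorptionDensity x i) x :=
  hasDerivAt_exp_smul_mulVec _ _ _ _

lemma absorptionDensity_nonneg {x : ℝ} (hx : 0 ≤ x) (i : Fin (n + 1)) :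
    0 ≤ m.absorptionDensity x i := by
  rw [absorptionDensity, Matrix.mulVec, dotProduct]
  refine Finset.sum_nonneg fun j _ =>
    mul_nonneg (m.isRateMatrix_absorbedGenerator.exp_nonneg hx i j) ?_
  by_cases hj : j = 0
  · subst hj; rw [absorbedGenerator_mulVec_zero]
  · rw [Matrix.mulVec_single_one]
    exact m.isRateMatrix_absorbedGenerator.offDiag j 0 hj

lemma absorbedProb_eq (x : ℝ) (i : Fin (n + 1)) :
    m.absorbedProb x i = NormedSpace.exp (x • m.absorbedGenerator) i 0 := by
  rw [absorbedProb, Matrix.mulVec_single_one]; rfl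

lemma absorbedProb_zero (i : Fin (n + 1)) : m.absorbedProb 0 i = Pi.single (M := fun _ => ℝ) 0 1 i := by
  rw [absorbedProb, exp_zero_smul_mulVec]

lemma monotoneOn_absorbedProb (i : Fin (n + 1)) :
    MonotoneOn (fun x => m.absorbedProb x i) (Set.Ici 0) := by
  refine monotoneOn_of_deriv_nonneg (convex_Ici 0)
    (fun x _ => (m.hasDerivAt_absorbedProb x i).continuousAt.continuousWithinAt)
    (fun x _ => (m.hasDerivAt_absorbedProb x i).differentiableAt.differentiableWithinAt) ?_
  intro x hx
  rw [interior_Ici] at hx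
  rw [(m.hasDerivAt_absorbedProb x i).deriv]
  exact m.absorptionDensity_nonneg (le_of_lt hx) i

/-- The limit `L` exists by monotonicity and boundedness. The semigroup property makes it invariant,
hence annihilated by the absorbed generator, so it is minimal at `0`. There it is at least `1`, and
everywhere it is at most `1`: absorption is certain. -/
lemma tendsto_absorbedProb (i : Fin (n + 1)) :
    Tendsto (fun x => m.absorbedProb x i) atTop (𝓝 1) := by
  have hle : ∀ x, 0 ≤ x → ∀ i, m.absorbedProb x i ≤ 1 := fun x hx i => by
    rw [absorbedProb_eq]; exact m.isRateMatrix_absorbedGenerator.exp_le_one hx i 0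
  have hex : ∀ i, ∃ l, Tendsto (fun x => m.absorbedProb x i) atTop (𝓝 l) := by
    intro i
    have hm : Monotone fun x => m.absorbedProb (max x 0) i := fun x y hxy =>
      m.monotoneOn_absorbedProb i (Set.mem_Ici.2 (le_max_right _ _))
        (Set.mem_Ici.2 (le_max_right _ _)) (max_le_max_right 0 hxy)
    have hb : BddAbove (Set.range fun x => m.absorbedProb (max x 0) i) :=
      ⟨1, by rintro _ ⟨x, rfl⟩; exact hle _ (le_max_right _ _) i⟩
    refine ⟨_, (tendsto_atTop_ciSup hm hb).congr' ?_⟩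
    filter_upwards [eventually_ge_atTop 0] with x hx
    rw [max_eq_left hx]
  choose L hL using hex
  have hinv : ∀ y : ℝ, (NormedSpace.exp (y • m.absorbedGenerator)).mulVec L = L := by
    intro y
    ext i
    have h1 : Tendsto (fun x => m.absorbedProb (y + x) i) atTop (𝓝 (L i)) :=
      (hL i).comp (tendsto_atTop_add_const_left _ y tendsto_id)
    have h2 : Tendsto (fun x => m.absorbedProb (y + x) i) atTop
        (𝓝 ((NormedSpace.exp (y • m.absorbedGenerator)).mulVec L i)) := by
      simp only [absorbedProb, exp_add_smul_mulVec]
      change Tendsto (fun x => (NormedSpace.exp (y • m.absorbedGenerator)).mulVec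
        (m.absorbedProb x) i) _ _
      simp only [Matrix.mulVec, dotProduct]
      exact tendsto_finsetSum _ fun j _ => (hL j).const_mul _
    exact tendsto_nhds_unique h2 h1
  have hharm : m.absorbedGenerator.mulVec L = 0 := by
    ext i
    have h1 := hasDerivAt_exp_smul_mulVec m.absorbedGenerator L i 0
    simp only [hinv] at h1
    rw [exp_zero_smul_mulVec] at h1
    exact h1.unique (hasDerivAt_const _ _)
  have h0 : 1 ≤ L 0 := by
    refine ge_of_tendsto (hL 0) ?_
    filter_upwards [eventually_ge_atTop 0] with x hx
    have := m.monotoneOn_absorbedProb 0 Set.self_mem_Ici hx hx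
    simpa [absorbedProb_zero] using this
  have h1 : L i ≤ 1 := le_of_tendsto (hL i) (by
    filter_upwards [eventually_ge_atTop 0] with x hx using hle x hx i)
  have h2 := m.le_of_absorbedGenerator_mulVec_eq_zero hharm i
  have : L i = 1 := by linarith
  rw [← this]; exact hL i

lemma integrableOn_absorptionDensity (i : Fin (n + 1)) :
    IntegrableOn (fun x => m.absorptionDensity x i) (Set.Ioi 0) :=
  integrableOn_Ioi_deriv_of_nonneg'
    (fun x _ => m.hasDerivAt_absorbedProb x i)
    (fun _ hx => m.absorptionDensity_nonneg (le_of_lt hx) i) (m.tendsto_absorbedProb i)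

lemma integral_absorptionDensity {i : Fin (n + 1)} (hi : i ≠ 0) :
    ∫ x in Set.Ioi 0, m.absorptionDensity x i = 1 := by
  rw [integral_Ioi_of_hasDerivAt_of_nonneg'
    (fun x _ => m.hasDerivAt_absorbedProb x i)
    (fun x hx => m.absorptionDensity_nonneg (le_of_lt hx) i) (m.tendsto_absorbedProb i),
    absorbedProb_zero]
  simp [hi]

/-- The Laplace transform of the time of absorption at `0`. -/
noncomputable def absorptionLaplace (z : ℝ) (i : Fin (n + 1)) : ℝ :=
  z * ∫ x in Set.Ioi 0, Real.exp (-(z * x)) * m.absorbedProb x i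

/-- This is the resolvent equation for the indicator of `0`, with the absorbed generator moved
across its semigroup and outside the integral. -/
lemma absorptionLaplace_resolvent {z : ℝ} (hz : 0 < z) :
    z • m.absorptionLaplace z - m.absorbedGenerator.mulVec (m.absorptionLaplace z) =
      Pi.single 0 z := by
  ext i
  have h := m.isRateMatrix_absorbedGenerator.integral_exp_mulVec hz (Pi.single 0 1) i
  have hint : ∀ j, IntegrableOn (fun x => Real.exp (-(z * x)) * m.absorbedProb x j) (Set.Ioi 0) :=
    fun j => m.isRateMatrix_absorbedGenerator.integrableOn_exp_mulVec hz (Pi.single 0 1) j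
  have e : ∀ x : ℝ, Real.exp (-(z * x)) * (NormedSpace.exp (x • m.absorbedGenerator)).mulVec
      (z • Pi.single 0 1 - m.absorbedGenerator.mulVec (Pi.single 0 1)) i =
      z * (Real.exp (-(z * x)) * m.absorbedProb x i) -
        ∑ j, m.absorbedGenerator i j * (Real.exp (-(z * x)) * m.absorbedProb x j) := by
    intro x
    rw [Matrix.mulVec_sub, exp_smul_mulVec_comm, Matrix.mulVec_smul]
    simp only [Pi.sub_apply, Pi.smul_apply, smul_eq_mul]
    rw [mul_sub]
    congr 1
    · rw [absorbedProb]; ring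
    · rw [Matrix.mulVec, dotProduct, Finset.mul_sum]
      refine Finset.sum_congr rfl fun j _ => ?_
      rw [absorbedProb]; ring
  simp_rw [e] at h
  rw [integral_sub ((hint i).const_mul z)
    (integrable_finsetSum _ fun j _ => (hint j).const_mul _),
    integral_finsetSum _ (fun j _ => (hint j).const_mul _)] at h
  simp only [integral_const_mul] at h
  have h' := congrArg (fun y => z * y) h
  simp only [Pi.sub_apply, Pi.smul_apply, smul_eq_mul, Matrix.mulVec, dotProduct,
    absorptionLaplace] at h' ⊢
  rw [mul_sub, Finset.mul_sum] at h'
  rw [show (Pi.single 0 z : Fin (n + 1) → ℝ) i = z * (Pi.single 0 1 : Fin (n + 1) → ℝ) i by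
    by_cases hi : i = 0 <;> simp [hi], ← h']
  congr 1
  refine Finset.sum_congr rfl fun j _ => ?_
  ring

lemma absorptionLaplace_zero {z : ℝ} (hz : 0 < z) : m.absorptionLaplace z 0 = 1 := by
  have := congrFun (m.absorptionLaplace_resolvent hz) 0
  simp only [Pi.sub_apply, Pi.smul_apply, smul_eq_mul, absorbedGenerator_mulVec_zero,
    Pi.single_eq_same, sub_zero] at this
  exact mul_left_cancel₀ hz.ne' (by linarith)

/-- Integration by parts, in the form of the resolvent equation; the boundary term vanishes since
absorption has not occurred at time zero when `i ≠ 0`. -/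
lemma integral_exp_mul_absorptionDensity {z : ℝ} (hz : 0 < z) {i : Fin (n + 1)} (hi : i ≠ 0) :
    ∫ x in Set.Ioi 0, Real.exp (-(z * x)) * m.absorptionDensity x i =
      m.absorptionLaplace z i := by
  have h := m.isRateMatrix_absorbedGenerator.integral_exp_mulVec hz (Pi.single 0 1) i
  have h1 := m.isRateMatrix_absorbedGenerator.integrableOn_exp_mulVec hz (Pi.single 0 1) i
  have h2 := m.isRateMatrix_absorbedGenerator.integrableOn_exp_mulVec hz
    (m.absorbedGenerator.mulVec (Pi.single 0 1)) i
  simp only [Matrix.mulVec_sub, Matrix.mulVec_smul, Pi.sub_apply, Pi.smul_apply, smul_eq_mul,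
    mul_sub, mul_left_comm _ z] at h
  rw [integral_sub (h1.const_mul z) h2, integral_const_mul] at h
  rw [Pi.single_eq_of_ne hi] at h
  rw [absorptionLaplace]
  simp only [absorptionDensity, absorbedProb]
  linarith

/-- The two generators differ only in row `0`. There the transform equals `1`, and the only jump
goes to the neighbouring point at rate `holdingRate 0`, which produces the factor `1 -
absorptionLaplace z 1`. -/
lemma generator_resolvent (hn : 1 ≤ n) {z : ℝ} (hz : 0 < z) :
    z • m.absorptionLaplace z - m.generator.mulVec (m.absorptionLaplace z) =
      Pi.single 0 (z + m.holdingRate 0 * (1 - m.absorptionLaplace z ⟨1, by omega⟩)) := by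
  have h := m.absorptionLaplace_resolvent hz
  ext i
  by_cases hi : i = 0
  · subst hi
    simp only [Pi.sub_apply, Pi.smul_apply, smul_eq_mul, Pi.single_eq_same,
      m.absorptionLaplace_zero hz, generator_mulVec]
    rw [Finset.sum_eq_single (⟨1, by omega⟩ : Fin (n + 1)), ← m.holdingRate_zero hn]
    · ring
    · intro j _ hj
      rw [jumpRate, if_neg, zero_mul]
      rintro (h | h)
      · exact hj (Fin.ext (by simpa using h.symm))
      · simp at h
    · simp
  · have := congrFun h i
    rw [Pi.sub_apply, absorbedGenerator_mulVec _ _ hi] at this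
    rw [Pi.sub_apply, this]
    simp [hi]

/-- The law of the duration of an excursion from `0`, with its Laplace transform. -/
theorem exists_excursion_density (hn : 1 ≤ n) :
    ∃ S : ℝ → ℝ≥0∞, Measurable S ∧ IsProbabilityMeasure (volume.withDensity S) ∧
      volume.withDensity S (Set.Iic 0) = 0 ∧ ∀ z : ℝ, 0 < z →
        (z + m.holdingRate 0 * (1 - (laplaceTransform (volume.withDensity S) z).toReal)) *
          ∫ t in Set.Ioi 0, Real.exp (-(z * t)) * m.transition t 0 0 = 1 := by
  set one : Fin (n + 1) := ⟨1, by omega⟩ with hone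
  have hone0 : one ≠ 0 := by simp [hone, Fin.ext_iff]
  -- An excursion starts with a jump from `0` to its only neighbour, so its duration is distributed
  -- as the absorption time from there.
  set S : ℝ → ℝ≥0∞ := (Set.Ioi (0 : ℝ)).indicator
    fun x => ENNReal.ofReal (m.absorptionDensity x one) with hS
  have hmeas : Measurable fun x => ENNReal.ofReal (m.absorptionDensity x one) :=
    (continuous_exp_smul_mulVec _ _ _).measurable.ennreal_ofReal
  have hSm : Measurable S := hmeas.indicator measurableSet_Ioi
  have hnn : ∀ᵐ x ∂volume.restrict (Set.Ioi (0 : ℝ)), 0 ≤ m.absorptionDensity x one := by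
    filter_upwards [ae_restrict_mem measurableSet_Ioi] with x hx
    exact m.absorptionDensity_nonneg (le_of_lt hx) one
  refine ⟨S, hSm, ⟨?_⟩, ?_, fun z hz => ?_⟩
  · rw [withDensity_apply _ MeasurableSet.univ, Measure.restrict_univ, hS,
      lintegral_indicator measurableSet_Ioi,
      ← ofReal_integral_eq_lintegral_ofReal (m.integrableOn_absorptionDensity one) hnn,
      m.integral_absorptionDensity hone0, ENNReal.ofReal_one]
  · rw [withDensity_apply _ measurableSet_Iic, setLIntegral_eq_zero_iff measurableSet_Iic hSm]
    exact Eventually.of_forall fun x hx => Set.indicator_of_notMem (by simpa using hx) _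
  · have hL : (laplaceTransform (volume.withDensity S) z).toReal = m.absorptionLaplace z one := by
      rw [← m.integral_exp_mul_absorptionDensity hz hone0, integral_eq_lintegral_of_nonneg_ae,
        laplaceTransform, lintegral_withDensity_eq_lintegral_mul _ hSm
          (measurable_ofReal_exp_neg_mul z)]
      · rw [← lintegral_indicator measurableSet_Ioi]
        congr 1
        refine lintegral_congr fun x => ?_
        by_cases hx : x ∈ Set.Ioi (0 : ℝ)
        · simp only [hS, Pi.mul_apply, Set.indicator_of_mem hx]
          rw [mul_comm, ENNReal.ofReal_mul (Real.exp_pos _).le]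
        · simp [hS, Set.indicator_of_notMem hx]
      · filter_upwards [hnn] with x hx
        exact mul_nonneg (Real.exp_pos _).le hx
      · exact (Continuous.mul (by fun_prop)
          (continuous_exp_smul_mulVec _ _ _)).aestronglyMeasurable
    -- The vector `z f - Q f` is concentrated at `0`, so the resolvent equation at `0` involves only
    -- the return probabilities, and its right side is `f 0 = 1`.
    have h := m.isRateMatrix_generator.integral_exp_mulVec hz (m.absorptionLaplace z) 0
    rw [m.generator_resolvent hn hz, m.absorptionLaplace_zero hz] at h
    rw [hL, ← integral_const_mul]
    refine Eq.trans ?_ h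
    refine setIntegral_congr_fun measurableSet_Ioi fun t _ => ?_
    simp only [Matrix.mulVec_single, transition, Pi.smul_apply, MulOpposite.smul_eq_mul_unop,
      MulOpposite.unop_op, Matrix.col_apply]
    ring

end FiniteSpeedMeasure

/-! ### Occupation times, their right-continuous inverses, and the change of variables -/

section Occupation

/-- Lebesgue measure on the half-line. -/
noncomputable def halfLine : Measure ℝ≥0 := (volume.restrict (Set.Ici (0 : ℝ))).map Real.toNNReal

lemma lintegral_halfLine {f : ℝ≥0 → ℝ≥0∞} (hf : Measurable f) :
    ∫⁻ t, f t ∂halfLine = ∫⁻ t in Set.Ici (0 : ℝ), f t.toNNReal :=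
  lintegral_map hf measurable_real_toNNReal

lemma halfLine_apply {A : Set ℝ≥0} (hA : MeasurableSet A) :
    halfLine A = volume {t : ℝ | 0 ≤ t ∧ t.toNNReal ∈ A} := by
  rw [halfLine, Measure.map_apply measurable_real_toNNReal hA,
    Measure.restrict_apply (measurable_real_toNNReal hA), Set.inter_comm]
  rfl

lemma halfLine_Iic (t : ℝ≥0) : halfLine (Set.Iic t) = t := by
  rw [halfLine_apply measurableSet_Iic]
  have : {s : ℝ | 0 ≤ s ∧ s.toNNReal ∈ Set.Iic t} = Set.Icc 0 (t : ℝ) := by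
    ext s
    simp only [Set.mem_Iic, Set.mem_ofPred_eq, Set.mem_Icc, Real.toNNReal_le_iff_le_coe]
  rw [this, Real.volume_Icc]
  simp

lemma halfLine_Ioc {a b : ℝ≥0} (hab : a ≤ b) :
    halfLine (Set.Ioc a b) = ENNReal.ofReal ((b : ℝ) - a) := by
  rw [← Set.Iic_sdiff_Iic, measure_sdiff (Set.Iic_subset_Iic.2 hab)
    measurableSet_Iic.nullMeasurableSet (by simp [halfLine_Iic]), halfLine_Iic, halfLine_Iic,
    ENNReal.ofReal_sub _ (NNReal.coe_nonneg a), ENNReal.ofReal_coe_nnreal, ENNReal.ofReal_coe_nnreal]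

instance : NullSingletonClass halfLine where
  measure_singleton t := by
    rw [halfLine_apply (measurableSet_singleton t)]
    refine measure_mono_null (t := {(t : ℝ)}) ?_ (by simp)
    rintro s ⟨h0, h1⟩
    simp only [Set.mem_singleton_iff] at h1 ⊢
    rw [← h1, Real.coe_toNNReal _ h0]

instance : SigmaFinite halfLine := by
  refine ⟨⟨⟨fun k => Set.Iic (k : ℝ≥0), fun _ => trivial, fun k => ?_, ?_⟩⟩⟩
  · rw [halfLine_Iic]; exact ENNReal.coe_lt_top
  · refine Set.eq_univ_of_forall fun t => Set.mem_iUnion.2 ?_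
    obtain ⟨k, hk⟩ := exists_nat_ge t
    exact ⟨k, hk⟩

/-- The time spent in `A` up to time `t`. -/
noncomputable def occupation (A : Set ℝ≥0) (t : ℝ≥0) : ℝ := (halfLine (A ∩ Set.Iic t)).toReal

variable {A : Set ℝ≥0}

lemma halfLine_inter_Iic_ne_top (A : Set ℝ≥0) (t : ℝ≥0) : halfLine (A ∩ Set.Iic t) ≠ ∞ :=
  ne_top_of_le_ne_top (by simp [halfLine_Iic]) (measure_mono Set.inter_subset_right)

lemma ofReal_occupation (A : Set ℝ≥0) (t : ℝ≥0) :
    ENNReal.ofReal (occupation A t) = halfLine (A ∩ Set.Iic t) :=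
  ENNReal.ofReal_toReal (halfLine_inter_Iic_ne_top A t)

lemma occupation_zero (A : Set ℝ≥0) : occupation A 0 = 0 := by
  have : halfLine (A ∩ Set.Iic 0) = 0 :=
    measure_mono_null Set.inter_subset_right (by simp [halfLine_Iic])
  simp [occupation, this]

lemma occupation_mono (A : Set ℝ≥0) : Monotone (occupation A) := fun _ t hst =>
  ENNReal.toReal_mono (halfLine_inter_Iic_ne_top A t)
    (measure_mono (Set.inter_subset_inter_right A (Set.Iic_subset_Iic.2 hst)))

lemma occupation_sub (hA : MeasurableSet A) {s t : ℝ≥0} (hst : s ≤ t) :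
    occupation A t - occupation A s = (halfLine (A ∩ Set.Ioc s t)).toReal := by
  have hne : halfLine (A ∩ Set.Ioc s t) ≠ ∞ :=
    ne_top_of_le_ne_top (halfLine_inter_Iic_ne_top A t)
      (measure_mono (Set.inter_subset_inter_right A fun _ h => h.2))
  have h : halfLine (A ∩ Set.Iic t) = halfLine (A ∩ Set.Iic s) + halfLine (A ∩ Set.Ioc s t) := by
    rw [← measure_union _ (hA.inter measurableSet_Ioc), ← Set.inter_union_distrib_left,
      Set.Iic_union_Ioc_eq_Iic hst]
    refine Set.disjoint_left.2 fun x hx hx' => ?_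
    exact absurd hx.2 (not_le.2 hx'.2.1)
  rw [occupation, occupation, h, ENNReal.toReal_add (halfLine_inter_Iic_ne_top A s) hne]
  ring

lemma occupation_sub_le (hA : MeasurableSet A) {s t : ℝ≥0} (hst : s ≤ t) :
    occupation A t - occupation A s ≤ (t : ℝ) - s := by
  rw [occupation_sub hA hst]
  have h0 : (0 : ℝ) ≤ (t : ℝ) - s := sub_nonneg.2 hst
  refine ENNReal.toReal_le_of_le_ofReal h0 ?_
  rw [← halfLine_Ioc hst]
  exact measure_mono Set.inter_subset_right

lemma continuous_occupation (hA : MeasurableSet A) : Continuous (occupation A) := by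
  have key : ∀ s t : ℝ≥0, s ≤ t → |occupation A t - occupation A s| ≤ |(t : ℝ) - s| := by
    intro s t hst
    rw [abs_of_nonneg (sub_nonneg.2 (occupation_mono A hst)),
      abs_of_nonneg (sub_nonneg.2 (NNReal.coe_le_coe.2 hst))]
    exact occupation_sub_le hA hst
  refine (LipschitzWith.of_dist_le_mul (K := 1) fun s t => ?_).continuous
  rw [NNReal.coe_one, one_mul, Real.dist_eq, NNReal.dist_eq]
  rcases le_total s t with h | h
  · rw [abs_sub_comm, abs_sub_comm (s : ℝ)]; exact key s t h
  · exact key t s h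

/-- By continuity, an occupation time above `t` at `v` is already above `t` slightly earlier, so the
infimum is strictly below `v`. The level must be exceeded somewhere, since the infimum of the empty
set is `0`. -/
lemma rightInverse_lt_iff (hA : MeasurableSet A) {t v : ℝ≥0} (hv : ∃ s, (t : ℝ) < occupation A s) :
    rightInverse (occupation A) t < v ↔ (t : ℝ) < occupation A v := by
  constructor
  · intro h
    obtain ⟨s, hs, hsv⟩ := exists_lt_of_csInf_lt hv h
    exact lt_of_lt_of_le hs (occupation_mono A hsv.le)
  · intro h
    have hv0 : 0 < v := by
      rcases eq_zero_or_pos v with h0 | h0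
      · rw [h0, occupation_zero] at h
        exact absurd h (not_lt.2 t.2)
      · exact h0
    have hev : ∀ᶠ s in 𝓝[<] v, (t : ℝ) < occupation A s :=
      (((continuous_occupation hA).tendsto v).mono_left nhdsWithin_le_nhds).eventually_const_lt h
    have hne : (𝓝[<] v).NeBot := nhdsLT_neBot_of_exists_lt ⟨0, hv0⟩
    obtain ⟨s, hs, hsv⟩ := (hev.and self_mem_nhdsWithin).exists
    exact lt_of_le_of_lt (csInf_le (OrderBot.bddBelow _) hs) hsv

lemma rightInverse_eq_zero {t : ℝ≥0} (hv : ¬ ∃ s, (t : ℝ) < occupation A s) :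
    rightInverse (occupation A) t = 0 := by
  have : {s : ℝ≥0 | (t : ℝ) < occupation A s} = ∅ := by
    ext s
    simp only [Set.mem_ofPred_eq, Set.mem_empty_iff_false, iff_false]
    exact fun h => hv ⟨s, h⟩
  rw [rightInverse, this, NNReal.sInf_empty]

lemma occupation_rightInverse (hA : MeasurableSet A) {t : ℝ≥0}
    (hv : ∃ s, (t : ℝ) < occupation A s) : occupation A (rightInverse (occupation A) t) = t := by
  set T := rightInverse (occupation A) t with hT
  refine le_antisymm (not_lt.1 fun h => ?_) ?_
  · exact lt_irrefl _ ((rightInverse_lt_iff hA hv).2 h)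
  · have hlim : Tendsto (occupation A) (𝓝[>] T) (𝓝 (occupation A T)) :=
      ((continuous_occupation hA).tendsto T).mono_left nhdsWithin_le_nhds
    refine ge_of_tendsto hlim ?_
    filter_upwards [self_mem_nhdsWithin] with v hv'
    exact ((rightInverse_lt_iff hA hv).1 hv').le

lemma exists_occupation_gt_mono {s t : ℝ≥0} (hst : s ≤ t)
    (hv : ∃ v, (t : ℝ) < occupation A v) : ∃ v, (s : ℝ) < occupation A v := by
  obtain ⟨v, h⟩ := hv
  exact ⟨v, lt_of_le_of_lt (NNReal.coe_le_coe.2 hst) h⟩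

lemma rightInverse_mono {s t : ℝ≥0} (hst : s ≤ t)
    (hv : ∃ v, (t : ℝ) < occupation A v) :
    rightInverse (occupation A) s ≤ rightInverse (occupation A) t :=
  csInf_le_csInf (OrderBot.bddBelow _) hv
    fun _ h => lt_of_le_of_lt (NNReal.coe_le_coe.2 hst) h

lemma continuousWithinAt_rightInverse (hA : MeasurableSet A) {t : ℝ≥0}
    (hv : ∃ v, (t : ℝ) < occupation A v) :
    ContinuousWithinAt (rightInverse (occupation A)) (Set.Ici t) t := by
  refine tendsto_order.2 ⟨fun v h => ?_, fun v h => ?_⟩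
  · obtain ⟨u, hu⟩ := hv
    have : Set.Iio (Real.toNNReal (occupation A u)) ∈ 𝓝 t :=
      Iio_mem_nhds (Real.lt_toNNReal_iff_coe_lt.2 hu)
    filter_upwards [self_mem_nhdsWithin, mem_nhdsWithin_of_mem_nhds this] with s hs hs'
    exact lt_of_lt_of_le h (rightInverse_mono hs ⟨u, Real.lt_toNNReal_iff_coe_lt.1 hs'⟩)
  · have h' := (rightInverse_lt_iff hA hv).1 h
    have : Set.Iio (Real.toNNReal (occupation A v)) ∈ 𝓝 t :=
      Iio_mem_nhds (Real.lt_toNNReal_iff_coe_lt.2 h')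
    filter_upwards [mem_nhdsWithin_of_mem_nhds this] with s hs'
    have hs := Real.lt_toNNReal_iff_coe_lt.1 hs'
    exact (rightInverse_lt_iff hA ⟨v, hs⟩).2 hs

lemma exists_occupation_gt_iff_nat {t : ℝ≥0} :
    (∃ s, (t : ℝ) < occupation A s) ↔ ∃ k : ℕ, (t : ℝ) < occupation A k := by
  refine ⟨fun ⟨s, hs⟩ => ?_, fun ⟨k, hk⟩ => ⟨k, hk⟩⟩
  obtain ⟨k, hk⟩ := exists_nat_ge s
  exact ⟨k, lt_of_lt_of_le hs (occupation_mono A hk)⟩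

lemma measurableSet_exists_occupation_gt :
    MeasurableSet {t : ℝ≥0 | ∃ s, (t : ℝ) < occupation A s} := by
  simp_rw [exists_occupation_gt_iff_nat, Set.ofPred_exists]
  exact MeasurableSet.iUnion fun k => measurableSet_lt (by fun_prop) measurable_const

/-- The second alternative is the convention that the inverse is `0` at levels never exceeded;
testing integer times keeps the condition countable. -/
lemma rightInverse_lt_iff' (hA : MeasurableSet A) (t v : ℝ≥0) :
    rightInverse (occupation A) t < v ↔
      (t : ℝ) < occupation A v ∨ ((¬ ∃ k : ℕ, (t : ℝ) < occupation A k) ∧ 0 < v) := by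
  rw [← exists_occupation_gt_iff_nat]
  by_cases hv : ∃ s, (t : ℝ) < occupation A s
  · rw [rightInverse_lt_iff hA hv]; simp [hv]
  · rw [rightInverse_eq_zero hv]
    simp only [hv, not_false_eq_true, true_and]
    exact ⟨Or.inr, fun h => h.resolve_left fun h' => hv ⟨v, h'⟩⟩

lemma measurable_rightInverse (hA : MeasurableSet A) : Measurable (rightInverse (occupation A)) := by
  refine measurable_of_Iio fun v => ?_
  have : rightInverse (occupation A) ⁻¹' Set.Iio v = {t : ℝ≥0 | (t : ℝ) < occupation A v} ∪
      ({t : ℝ≥0 | ∃ s, (t : ℝ) < occupation A s}ᶜ ∩ {_t | 0 < v}) := by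
    ext t
    simp only [Set.mem_preimage, Set.mem_Iio, rightInverse_lt_iff' hA,
      ← exists_occupation_gt_iff_nat]
    rfl
  rw [this]
  exact (measurableSet_lt (by fun_prop) measurable_const).union
    (measurableSet_exists_occupation_gt.compl.inter (MeasurableSet.const _))

/-- The right-continuous inverse of the occupation time maps Lebesgue measure to Lebesgue measure
on the set. -/
lemma map_rightInverse (hA : MeasurableSet A) :
    (halfLine.restrict {t | ∃ s, (t : ℝ) < occupation A s}).map (rightInverse (occupation A)) =
      halfLine.restrict A := by
  -- The levels mapped below `v` form the interval `[0, occupation A v)`, so both measures agree on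
  -- the π-system of initial intervals.
  have hfin : ∀ v : ℝ≥0, (halfLine.restrict {t | ∃ s, (t : ℝ) < occupation A s}).map
      (rightInverse (occupation A)) (Set.Iio v) = ENNReal.ofReal (occupation A v) := by
    intro v
    rw [Measure.map_apply (measurable_rightInverse hA) measurableSet_Iio,
      Measure.restrict_apply (measurable_rightInverse hA measurableSet_Iio)]
    have : rightInverse (occupation A) ⁻¹' Set.Iio v ∩ {t | ∃ s, (t : ℝ) < occupation A s} =
        Set.Iio (occupation A v).toNNReal := by
      ext t
      simp only [Set.mem_inter_iff, Set.mem_preimage, Set.mem_Iio, Set.mem_ofPred_eq,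
        Real.lt_toNNReal_iff_coe_lt]
      constructor
      · rintro ⟨h1, h2⟩
        exact (rightInverse_lt_iff hA h2).1 h1
      · intro h
        exact ⟨(rightInverse_lt_iff hA ⟨v, h⟩).2 h, ⟨v, h⟩⟩
    rw [this, measure_congr Iio_ae_eq_Iic, halfLine_Iic]
    rfl
  refine Measure.ext_of_generateFrom_of_iUnion (Set.range Set.Iio) (fun k : ℕ => Set.Iio (k : ℝ≥0))
    ?_ isPiSystem_Iio ?_ (fun k => ⟨_, rfl⟩) (fun k => ?_) ?_
  · rw [← borel_eq_generateFrom_Iio]; exact BorelSpace.measurable_eq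
  · refine Set.eq_univ_of_forall fun t => Set.mem_iUnion.2 ?_
    obtain ⟨k, hk⟩ := exists_nat_gt t
    exact ⟨k, hk⟩
  · rw [hfin]; exact ENNReal.ofReal_ne_top
  · rintro _ ⟨v, rfl⟩
    rw [hfin, Measure.restrict_apply measurableSet_Iio, Set.inter_comm, ofReal_occupation]
    exact measure_congr (Filter.EventuallyEq.rfl.inter Iio_ae_eq_Iic.symm)

lemma lintegral_comp_rightInverse (hA : MeasurableSet A) {f : ℝ≥0 → ℝ≥0∞} (hf : Measurable f) :
    ∫⁻ t in {t | ∃ s, (t : ℝ) < occupation A s}, f (rightInverse (occupation A) t) ∂halfLine =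
      ∫⁻ v in A, f v ∂halfLine := by
  rw [← map_rightInverse hA, lintegral_map hf (measurable_rightInverse hA)]

/-- A function of the inverse occupation time, killed when the total occupation time is
exhausted. -/
noncomputable def killedInverse (A : Set ℝ≥0) (f : ℝ≥0 → ℝ≥0∞) (t : ℝ≥0) : ℝ≥0∞ :=
  {t : ℝ≥0 | ∃ s, (t : ℝ) < occupation A s}.indicator
    (fun t => f (rightInverse (occupation A) t)) t

/-- The occupation time at `rightInverse (occupation A) t` is `t`, so the restriction `a < t`
becomes `a < occupation A v` after the change of variables. -/
lemma setLIntegral_killedInverse (hA : MeasurableSet A) {f : ℝ≥0 → ℝ≥0∞} (hf : Measurable f)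
    (a : ℝ≥0) :
    ∫⁻ t in Set.Ioi a, killedInverse A f t ∂halfLine =
      ∫⁻ v in A, {v | (a : ℝ) < occupation A v}.indicator f v ∂halfLine := by
  have hm : MeasurableSet {v | (a : ℝ) < occupation A v} :=
    measurableSet_lt measurable_const (occupation_mono A).measurable
  rw [← lintegral_comp_rightInverse hA (hf.indicator hm), ← lintegral_indicator measurableSet_Ioi,
    ← lintegral_indicator measurableSet_exists_occupation_gt]
  refine lintegral_congr fun t => ?_
  simp only [killedInverse, Set.indicator_apply, Set.mem_ofPred_eq, Set.mem_Ioi]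
  by_cases hv : ∃ s, (t : ℝ) < occupation A s
  · simp [hv, occupation_rightInverse hA hv]
  · simp [hv]

/-- The inner tail is itself a function of the inverse at `t`, since `t < occupation A w` means that
`w` lies beyond it. The change of variables therefore applies once more, leaving pairs of points of
`A` in increasing order. -/
lemma setLIntegral_setLIntegral_killedInverse (hA : MeasurableSet A) {f : ℝ≥0 → ℝ≥0∞}
    (hf : Measurable f) (a : ℝ≥0) :
    ∫⁻ t in Set.Ioi a, ∫⁻ r in Set.Ioi t, killedInverse A f r ∂halfLine ∂halfLine =
      ∫⁻ v in A, {v | (a : ℝ) < occupation A v}.indicator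
        (fun v => ∫⁻ w in A, (Set.Ioi v).indicator f w ∂halfLine) v ∂halfLine := by
  have hΨ : Measurable fun v => ∫⁻ w in A, (Set.Ioi v).indicator f w ∂halfLine := by
    refine Antitone.measurable fun v v' h => lintegral_mono fun w => ?_
    exact Set.indicator_le_indicator_of_subset (Set.Ioi_subset_Ioi h) (fun _ => zero_le) w
  rw [← setLIntegral_killedInverse hA hΨ]
  refine lintegral_congr fun t => ?_
  rw [setLIntegral_killedInverse hA hf, killedInverse]
  by_cases hv : ∃ s, (t : ℝ) < occupation A s
  · rw [Set.indicator_of_mem (by exact hv)]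
    congr 1
    ext v
    simp only [Set.indicator_apply, Set.mem_ofPred_eq, Set.mem_Ioi, rightInverse_lt_iff hA hv]
  · rw [Set.indicator_of_notMem (by exact hv)]
    have hnot : ∀ v, v ∉ {v | (t : ℝ) < occupation A v} := fun v h => hv ⟨v, h⟩
    simp only [Set.indicator_of_notMem (hnot _), lintegral_zero]

end Occupation

/-! ### Joint measurability from right-continuity -/

section RightContinuousFamily

variable {W : Type*} [MeasurableSpace W]

/-- Each approximant takes countably many values as `t` varies and approaches `t` from the right,
where a right-continuous family is eventually constant. -/
lemma tendsto_floor_add_one_div (t : ℝ≥0) :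
    Tendsto (fun k : ℕ => ((⌊((k : ℝ≥0) + 1) * t⌋₊ : ℝ≥0) + 1) / ((k : ℝ≥0) + 1)) atTop
      (𝓝[≥] t) := by
  refine tendsto_nhdsWithin_iff.2 ⟨?_, Eventually.of_forall fun k => ?_⟩
  · have hup : Tendsto (fun k : ℕ => t + 1 / ((k : ℝ≥0) + 1)) atTop (𝓝 t) := by
      have := (tendsto_one_div_add_atTop_nhds_zero_nat (𝕜 := ℝ≥0)).const_add t
      simpa using this
    refine tendsto_of_tendsto_of_tendsto_of_le_of_le tendsto_const_nhds hup (fun k => ?_) fun k => ?_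
    · change t ≤ _
      rw [le_div_iff₀ (by positivity), mul_comm]
      exact (Nat.lt_floor_add_one _).le
    · change _ ≤ t + 1 / ((k : ℝ≥0) + 1)
      rw [div_le_iff₀ (by positivity), add_mul t, one_div, inv_mul_cancel₀ (by positivity),
        mul_comm t]
      gcongr
      exact Nat.floor_le (by positivity)
  · change t ≤ _
    rw [le_div_iff₀ (by positivity), mul_comm]
    exact (Nat.lt_floor_add_one _).le

/-- A right-continuous family of measurable sets is jointly measurable. -/
lemma measurableSet_prod_of_rightContinuous {B : ℝ≥0 → Set W} (hB : ∀ t, MeasurableSet (B t))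
    (hc : ∀ w t, ∀ᶠ s in 𝓝[≥] t, (w ∈ B s ↔ w ∈ B t)) :
    MeasurableSet {p : ℝ≥0 × W | p.2 ∈ B p.1} := by
  let d : ℕ → ℝ≥0 → ℝ≥0 := fun k t => ((⌊((k : ℝ≥0) + 1) * t⌋₊ : ℝ≥0) + 1) / ((k : ℝ≥0) + 1)
  have e : {p : ℝ≥0 × W | p.2 ∈ B p.1} =
      ⋃ K : ℕ, ⋂ k : ℕ, ⋂ _ : K ≤ k, {p : ℝ≥0 × W | p.2 ∈ B (d k p.1)} := by
    ext p
    simp only [Set.mem_ofPred_eq, Set.mem_iUnion, Set.mem_iInter]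
    have hev := (tendsto_floor_add_one_div p.1).eventually (hc p.2 p.1)
    obtain ⟨K, hK⟩ := eventually_atTop.1 hev
    exact ⟨fun h => ⟨K, fun k hk => (hK k hk).2 h⟩,
      fun ⟨K', hK'⟩ => (hK (max K K') (le_max_left _ _)).1 (hK' _ (le_max_right _ _))⟩
  rw [e]
  refine MeasurableSet.iUnion fun K => MeasurableSet.iInter fun k => MeasurableSet.iInter fun _ => ?_
  have e2 : {p : ℝ≥0 × W | p.2 ∈ B (d k p.1)} = ⋃ j : ℕ,
      {t : ℝ≥0 | ⌊((k : ℝ≥0) + 1) * t⌋₊ = j} ×ˢ B (((j : ℝ≥0) + 1) / ((k : ℝ≥0) + 1)) := by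
    ext p
    simp [d]
  rw [e2]
  refine MeasurableSet.iUnion fun j => MeasurableSet.prod ?_ (hB _)
  exact (Nat.measurable_floor.comp (measurable_const.mul measurable_id))
    (measurableSet_singleton j)

lemma measurable_occupation_of_rightContinuous {B : ℝ≥0 → Set W} (hB : ∀ t, MeasurableSet (B t))
    (hc : ∀ w t, ∀ᶠ s in 𝓝[≥] t, (w ∈ B s ↔ w ∈ B t)) (v : ℝ≥0) :
    Measurable fun w => occupation {t | w ∈ B t} v := by
  have h := (measurableSet_prod_of_rightContinuous hB hc).inter
    (measurableSet_Iic.preimage measurable_fst : MeasurableSet (Prod.fst ⁻¹' (Set.Iic v) :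
      Set (ℝ≥0 × W)))
  exact (measurable_measure_prodMk_right (μ := halfLine) h).ennreal_toReal

end RightContinuousFamily

/-! ### The zero set of the path and the σ-algebras of the past -/

section SamplePaths

lemma measurable_nnreal_of_Iio {W : Type*} (mW : MeasurableSpace W) {f : W → ℝ≥0}
    (hf : ∀ r, MeasurableSet (f ⁻¹' Set.Iio r)) : Measurable f :=
  measurable_of_Iio hf

variable {n : ℕ} {W : Type*}

/-- The set of times spent at `0`. -/
def zeroSet (X : ℝ≥0 → W → Fin (n + 1)) (w : W) : Set ℝ≥0 := {t | X t w = 0}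

/-- The events that depend on the process up to time `v`. -/
@[reducible]
def pastAlgebra (X : ℝ≥0 → W → Fin (n + 1)) (v : ℝ≥0) : MeasurableSpace W :=
  MeasurableSpace.generateFrom {B | ∃ (s : Finset ℝ≥0) (e : ℝ≥0 → Fin (n + 1)),
    (∀ u ∈ s, u ≤ v) ∧ B = {w | ∀ u ∈ s, X u w = e u}}

variable {X : ℝ≥0 → W → Fin (n + 1)}

lemma measurable_pastAlgebra {u v : ℝ≥0} (huv : u ≤ v) : Measurable[pastAlgebra X v] (X u) := by
  refine @measurable_to_countable' _ _ _ _ (pastAlgebra X v) (X u) fun i => ?_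
  refine MeasurableSpace.measurableSet_generateFrom ⟨{u}, fun _ => i, by simpa using huv, ?_⟩
  ext w; simp

lemma measurableSet_past_eq {u v : ℝ≥0} (huv : u ≤ v) (i : Fin (n + 1)) :
    MeasurableSet[pastAlgebra X v] {w | X u w = i} :=
  measurable_pastAlgebra huv (measurableSet_singleton i)

lemma measurableSet_cylinder [MeasurableSpace W] (hX : ∀ t, Measurable (X t)) (s : Finset ℝ≥0)
    (e : ℝ≥0 → Fin (n + 1)) : MeasurableSet {w | ∀ u ∈ s, X u w = e u} := by
  have : {w | ∀ u ∈ s, X u w = e u} = ⋂ u ∈ s, X u ⁻¹' {e u} := by ext w; simp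
  rw [this]
  exact Finset.measurableSet_biInter s fun u _ => hX u (measurableSet_singleton _)

lemma pastAlgebra_le [mW : MeasurableSpace W] (hX : ∀ t, Measurable (X t)) (v : ℝ≥0) :
    pastAlgebra X v ≤ mW := by
  refine MeasurableSpace.generateFrom_le ?_
  rintro _ ⟨s, e, -, rfl⟩
  exact measurableSet_cylinder hX s e

lemma pastAlgebra_mono {u v : ℝ≥0} (huv : u ≤ v) : pastAlgebra X u ≤ pastAlgebra X v := by
  refine MeasurableSpace.generateFrom_mono ?_
  rintro _ ⟨s, e, hs, rfl⟩
  exact ⟨s, e, fun x hx => (hs x hx).trans huv, rfl⟩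

/-- A path in the intersection supplies consistent states at all the times of both cylinders; an
empty intersection need not be considered. -/
lemma isPiSystem_cylinder (v : ℝ≥0) : IsPiSystem {B | ∃ (s : Finset ℝ≥0) (e : ℝ≥0 → Fin (n + 1)),
    (∀ u ∈ s, u ≤ v) ∧ B = {w | ∀ u ∈ s, X u w = e u}} := by
  classical
  rintro _ ⟨s, e, hs, rfl⟩ _ ⟨s', e', hs', rfl⟩ ⟨w₀, h₀, h₀'⟩
  refine ⟨s ∪ s', fun u => X u w₀, fun u hu => ?_, ?_⟩
  · rcases Finset.mem_union.1 hu with h | h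
    exacts [hs u h, hs' u h]
  · ext w
    constructor
    · rintro ⟨h, h'⟩ u hu
      rcases Finset.mem_union.1 hu with hu | hu
      · exact (h u hu).trans (h₀ u hu).symm
      · exact (h' u hu).trans (h₀' u hu).symm
    · intro h
      exact ⟨fun u hu => (h u (Finset.mem_union_left _ hu)).trans (h₀ u hu),
        fun u hu => (h u (Finset.mem_union_right _ hu)).trans (h₀' u hu)⟩

section Cadlag

variable (hc : ∀ w, IsCadlagPath fun t => X t w)
include hc

lemma eventually_eq_of_cadlag (w : W) (t : ℝ≥0) : ∀ᶠ s in 𝓝[≥] t, X s w = X t w := by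
  have h := (hc w t).1
  rw [ContinuousWithinAt, nhds_discrete, tendsto_pure] at h
  exact h

lemma eventually_mem_zeroSet_iff (w : W) (t : ℝ≥0) :
    ∀ᶠ s in 𝓝[≥] t, (s ∈ zeroSet X w ↔ t ∈ zeroSet X w) := by
  filter_upwards [eventually_eq_of_cadlag hc w t] with s hs
  simp [zeroSet, hs]

/-- For a single path, the largest σ-algebra on `W` can be used, and right-continuity alone
suffices. -/
lemma measurableSet_zeroSet (w : W) : MeasurableSet (zeroSet X w) := by
  let _ : MeasurableSpace W := ⊤
  have h := measurableSet_prod_of_rightContinuous (B := fun t => {w | t ∈ zeroSet X w})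
    (fun _ => trivial) (eventually_mem_zeroSet_iff hc)
  exact measurable_prodMk_right (y := w) h

lemma measurableSet_prod_zeroSet [MeasurableSpace W] (hX : ∀ t, Measurable (X t)) :
    MeasurableSet {p : ℝ≥0 × W | p.1 ∈ zeroSet X p.2} :=
  measurableSet_prod_of_rightContinuous (B := fun t => {w | t ∈ zeroSet X w})
    (fun t => hX t (measurableSet_singleton 0)) (eventually_mem_zeroSet_iff hc)

/-- Freezing the path at time `v` does not change the occupation time up to `v`, and makes every
section an event of the past of `v`. -/
lemma measurable_occupation_pastAlgebra (v : ℝ≥0) :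
    Measurable[pastAlgebra X v] fun w => occupation (zeroSet X w) v := by
  have h := @measurable_occupation_of_rightContinuous W (pastAlgebra X v)
    (fun s => {w | X (min s v) w = 0}) (fun s => measurableSet_past_eq (min_le_right s v) 0) ?_ v
  · convert h using 2 with w
    rw [occupation, occupation]
    congr 2
    ext s
    simp only [zeroSet, Set.mem_inter_iff, Set.mem_ofPred_eq, Set.mem_Iic, and_congr_left_iff]
    intro hs
    rw [min_eq_left hs]
  · intro w t
    rcases lt_or_ge t v with htv | htv
    · filter_upwards [eventually_eq_of_cadlag hc w t,
        mem_nhdsWithin_of_mem_nhds (Iio_mem_nhds htv)] with s hs hsv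
      rw [min_eq_left (le_of_lt hsv), min_eq_left htv.le, hs]
    · filter_upwards [self_mem_nhdsWithin] with s hs
      rw [min_eq_right htv, min_eq_right (htv.trans hs)]

lemma measurable_occupation [MeasurableSpace W] (hX : ∀ t, Measurable (X t)) (v : ℝ≥0) :
    Measurable fun w => occupation (zeroSet X w) v :=
  (measurable_occupation_pastAlgebra hc v).mono (pastAlgebra_le hX v) le_rfl

lemma localTime_eq_occupation (t : ℝ≥0) (w : W) :
    localTime X 0 t w = occupation (zeroSet X w) t := by
  rw [localTime, occupation, halfLine_apply ((measurableSet_zeroSet hc w).inter measurableSet_Iic)]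
  congr 2
  ext s
  simp only [zeroSet, Set.mem_ofPred_eq, Set.mem_inter_iff, Set.mem_Iic,
    Real.toNNReal_le_iff_le_coe]
  tauto

lemma invLocalTime_eq_rightInverse (t : ℝ≥0) (w : W) :
    invLocalTime X t w = rightInverse (occupation (zeroSet X w)) t := by
  rw [invLocalTime]
  simp_rw [localTime_eq_occupation hc]

lemma measurableSet_exists_occupation_gt_left [MeasurableSpace W] (hX : ∀ t, Measurable (X t))
    (t : ℝ≥0) : MeasurableSet {w | ∃ s, (t : ℝ) < occupation (zeroSet X w) s} := by
  simp_rw [exists_occupation_gt_iff_nat, Set.ofPred_exists]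
  exact MeasurableSet.iUnion fun k => measurableSet_lt measurable_const (measurable_occupation hc hX k)

lemma measurableSet_prod_exists_occupation_gt [MeasurableSpace W] (hX : ∀ t, Measurable (X t)) :
    MeasurableSet {p : ℝ≥0 × W | ∃ s, (p.1 : ℝ) < occupation (zeroSet X p.2) s} := by
  simp_rw [exists_occupation_gt_iff_nat, Set.ofPred_exists]
  exact MeasurableSet.iUnion fun k => measurableSet_lt (by fun_prop)
    ((measurable_occupation hc hX k).comp measurable_snd)

lemma measurable_prod_rightInverse [MeasurableSpace W] (hX : ∀ t, Measurable (X t)) :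
    Measurable fun p : ℝ≥0 × W => rightInverse (occupation (zeroSet X p.2)) p.1 := by
  refine measurable_of_Iio fun v => ?_
  have : (fun p : ℝ≥0 × W => rightInverse (occupation (zeroSet X p.2)) p.1) ⁻¹' Set.Iio v =
      {p : ℝ≥0 × W | (p.1 : ℝ) < occupation (zeroSet X p.2) v} ∪
      ({p : ℝ≥0 × W | ∃ s, (p.1 : ℝ) < occupation (zeroSet X p.2) s}ᶜ ∩ {_t | 0 < v}) := by
    ext p
    simp only [Set.mem_preimage, Set.mem_Iio, rightInverse_lt_iff' (measurableSet_zeroSet hc _),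
      ← exists_occupation_gt_iff_nat]
    rfl
  rw [this]
  exact (measurableSet_lt (by fun_prop) ((measurable_occupation hc hX v).comp measurable_snd)).union
    ((measurableSet_prod_exists_occupation_gt hc hX).compl.inter (MeasurableSet.const _))

lemma measurable_rightInverse_right [MeasurableSpace W] (hX : ∀ t, Measurable (X t)) (t : ℝ≥0) :
    Measurable fun w => rightInverse (occupation (zeroSet X w)) t :=
  (measurable_prod_rightInverse hc hX).comp measurable_prodMk_left

lemma measurable_prod_killedInverse [MeasurableSpace W] (hX : ∀ t, Measurable (X t))
    {f : ℝ≥0 → ℝ≥0∞} (hf : Measurable f) :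
    Measurable fun p : ℝ≥0 × W => killedInverse (zeroSet X p.2) f p.1 := by
  have : (fun p : ℝ≥0 × W => killedInverse (zeroSet X p.2) f p.1) =
      {p : ℝ≥0 × W | ∃ s, (p.1 : ℝ) < occupation (zeroSet X p.2) s}.indicator
        (fun p => f (rightInverse (occupation (zeroSet X p.2)) p.1)) := rfl
  rw [this]
  exact (hf.comp (measurable_prod_rightInverse hc hX)).indicator
    (measurableSet_prod_exists_occupation_gt hc hX)

/-- The events that depend on the process up to the time when the local time exceeds `a`. -/
@[reducible]
def pastLocalAlgebra [MeasurableSpace W] (a : ℝ≥0) :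
    MeasurableSpace W where
  -- Where the level `a` is exceeded, the event `a < occupation (zeroSet X w) v` says that the
  -- inverse local time at `a` is less than `v`. Ambient measurability is imposed separately because
  -- the second condition does not see the paths on which `a` is never exceeded.
  MeasurableSet' A := MeasurableSet A ∧
    ∀ v, MeasurableSet[pastAlgebra X v] (A ∩ {w | (a : ℝ) < occupation (zeroSet X w) v})
  measurableSet_empty := ⟨MeasurableSet.empty, fun v => by
    rw [Set.empty_inter]; exact @MeasurableSet.empty _ (pastAlgebra X v)⟩
  measurableSet_compl A hA := ⟨hA.1.compl, fun v => by
    have h : MeasurableSet[pastAlgebra X v] {w | (a : ℝ) < occupation (zeroSet X w) v} :=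
      measurable_occupation_pastAlgebra hc v measurableSet_Ioi
    have e : Aᶜ ∩ {w | (a : ℝ) < occupation (zeroSet X w) v} =
        {w | (a : ℝ) < occupation (zeroSet X w) v} \
          (A ∩ {w | (a : ℝ) < occupation (zeroSet X w) v}) := by
      ext w; simp only [Set.mem_inter_iff, Set.mem_compl_iff, Set.mem_sdiff]; tauto
    rw [e]
    exact @MeasurableSet.diff _ (pastAlgebra X v) _ _ h (hA.2 v)⟩
  measurableSet_iUnion f hf := ⟨MeasurableSet.iUnion fun k => (hf k).1, fun v => by
    rw [Set.iUnion_inter]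
    exact @MeasurableSet.iUnion _ _ (pastAlgebra X v) _ _ fun k => (hf k).2 v⟩

lemma pastLocalAlgebra_le [mW : MeasurableSpace W] (a : ℝ≥0) :
    pastLocalAlgebra hc a ≤ mW := fun _ h => h.1

/-- Once the local time at `v` exceeds `a ≥ u`, the inverse at `u` is already less than `v`.
Comparing it with `r` then only requires the local time at `min r v`. -/
lemma measurable_rightInverse_pastLocalAlgebra [MeasurableSpace W] (hX : ∀ t, Measurable (X t))
    {u a : ℝ≥0} (hua : u ≤ a) :
    Measurable[pastLocalAlgebra hc a] fun w => rightInverse (occupation (zeroSet X w)) u := by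
  refine measurable_nnreal_of_Iio (pastLocalAlgebra hc a) fun r => ⟨?_, fun v => ?_⟩
  · exact measurable_rightInverse_right hc hX u measurableSet_Iio
  · have ha : MeasurableSet[pastAlgebra X v] {w | (a : ℝ) < occupation (zeroSet X w) v} :=
      measurable_occupation_pastAlgebra hc v measurableSet_Ioi
    have hu : MeasurableSet[pastAlgebra X v] {w | (u : ℝ) < occupation (zeroSet X w) (min r v)} :=
      pastAlgebra_mono (min_le_right r v) _
        (measurable_occupation_pastAlgebra hc (min r v) measurableSet_Ioi)
    convert @MeasurableSet.inter _ (pastAlgebra X v) _ _ hu ha using 1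
    ext w
    simp only [Set.mem_inter_iff, Set.mem_preimage, Set.mem_Iio, Set.mem_ofPred_eq,
      and_congr_left_iff]
    intro h
    have hu' : (u : ℝ) < occupation (zeroSet X w) v :=
      lt_of_le_of_lt (NNReal.coe_le_coe.2 hua) h
    rw [rightInverse_lt_iff (measurableSet_zeroSet hc w) ⟨v, hu'⟩]
    rcases le_total r v with hrv | hrv
    · rw [min_eq_left hrv]
    · rw [min_eq_right hrv]
      exact iff_of_true (lt_of_lt_of_le hu' (occupation_mono _ hrv)) hu'

end Cadlag

end SamplePaths

/-! ### The Markov property at a fixed time -/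

section Markov

variable {n : ℕ} {m : FiniteSpeedMeasure n} {W : Type*} [MeasurableSpace W]
  {P : Fin (n + 1) → Measure W} {X : ℝ≥0 → W → Fin (n + 1)}

lemma FiniteSpeedMeasure.transition_nonneg (m : FiniteSpeedMeasure n) {t : ℝ} (ht : 0 ≤ t)
    (i j : Fin (n + 1)) : 0 ≤ m.transition t i j :=
  m.isRateMatrix_generator.exp_nonneg ht i j

lemma FiniteSpeedMeasure.continuous_transition (m : FiniteSpeedMeasure n) (i j : Fin (n + 1)) :
    Continuous fun t => m.transition t i j := by
  have := continuous_exp_smul_mulVec m.generator (Pi.single j 1) i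
  simp only [Matrix.mulVec_single_one] at this
  exact this

lemma FiniteSpeedMeasure.transition_zero (m : FiniteSpeedMeasure n) : m.transition 0 = 1 := by
  rw [FiniteSpeedMeasure.transition, zero_smul, NormedSpace.exp_zero]

namespace IsGapDiffusion

/-- The Markov property at a fixed time for events in the past that fix all the states at finitely
many times. -/
lemma measure_cylinder_inter (hX : IsGapDiffusion m X P) (a i j : Fin (n + 1)) {v w : ℝ≥0}
    (hvw : v ≤ w) (s : Finset ℝ≥0) (e : ℝ≥0 → Fin (n + 1)) (hs : ∀ u ∈ s, u ≤ v) :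
    P a ({ω | ∀ u ∈ s, X u ω = e u} ∩ {ω | X v ω = i} ∩ {ω | X w ω = j}) =
      ENNReal.ofReal (m.transition ((w : ℝ) - v) i j) *
        P a ({ω | ∀ u ∈ s, X u ω = e u} ∩ {ω | X v ω = i}) := by
  classical
  have := hX.isProbabilityMeasure a
  -- If the past prescribes a state other than `i` at time `v`, both sides vanish. Otherwise `v` is
  -- adjoined with state `i` and becomes the last of the sorted times, so that appending `w` adds
  -- exactly one transition factor.
  by_cases hcons : v ∈ s ∧ e v ≠ i
  · have h0 : {ω | ∀ u ∈ s, X u ω = e u} ∩ {ω | X v ω = i} = ∅ := by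
      ext ω
      simp only [Set.mem_inter_iff, Set.mem_ofPred_eq, Set.mem_empty_iff_false, iff_false, not_and]
      intro h h'
      exact hcons.2 ((h v hcons.1).symm.trans h')
    rw [h0]; simp
  · set s' := insert v s with hs'
    set e' := Function.update e v i with he'
    obtain ⟨k, hk⟩ : ∃ k, s'.card = k + 1 :=
      ⟨s'.card - 1, by have : 0 < s'.card := Finset.card_pos.2 ⟨v, by simp [hs']⟩
                       omega⟩
    set t : Fin (k + 1) → ℝ≥0 := fun l => s'.orderEmbOfFin hk l with ht
    have hle : ∀ u ∈ s', u ≤ v := by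
      intro u hu
      rcases Finset.mem_insert.1 hu with rfl | hu
      exacts [le_rfl, hs u hu]
    have htmono : Monotone t := fun l l' h => (s'.orderEmbOfFin hk).monotone h
    have hrange : ∀ u ∈ s', ∃ i, t i = u := by
      intro u hu
      have : u ∈ Set.range (s'.orderEmbOfFin hk) := by
        rw [Finset.range_orderEmbOfFin]; exact hu
      exact this
    have hmem : ∀ i, t i ∈ s' := fun i => Finset.orderEmbOfFin_mem s' hk i
    have hlast : t (Fin.last k) = v := by
      refine le_antisymm (hle _ (hmem _)) ?_
      obtain ⟨l, hl⟩ := hrange v (by simp [hs'])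
      rw [← hl]
      exact htmono (Fin.le_last l)
    have hset : {ω | ∀ u ∈ s, X u ω = e u} ∩ {ω | X v ω = i} =
        {ω | ∀ l, X (t l) ω = e' (t l)} := by
      ext ω
      simp only [Set.mem_inter_iff, Set.mem_ofPred_eq]
      constructor
      · rintro ⟨h, h'⟩ l
        by_cases hl : t l = v
        · rw [hl, he', Function.update_self, h']
        · rw [he', Function.update_of_ne hl]
          exact h _ ((Finset.mem_insert.1 (hmem l)).resolve_left hl)
      · intro h
        have hall : ∀ u ∈ s', X u ω = e' u := by
          intro u hu
          obtain ⟨l, rfl⟩ := hrange u hu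
          exact h l
        have hv : X v ω = i := by
          rw [hall v (by simp [hs']), he', Function.update_self]
        refine ⟨fun u hu => ?_, hv⟩
        by_cases huv : u = v
        · subst huv
          rw [hv]
          by_contra hne
          exact hcons ⟨hu, fun h => hne h.symm⟩
        · rw [hall u (Finset.mem_insert_of_mem hu), he', Function.update_of_ne huv]
    set t' : Fin (k + 1 + 1) → ℝ≥0 := Fin.snoc t w with ht'
    set f' : Fin (k + 1 + 1) → Fin (n + 1) := Fin.snoc (fun l => e' (t l)) j with hf'
    have hset' : {ω | ∀ u ∈ s, X u ω = e u} ∩ {ω | X v ω = i} ∩ {ω | X w ω = j} =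
        {ω | ∀ l, X (t' l) ω = f' l} := by
      rw [hset]
      ext ω
      simp only [Set.mem_inter_iff, Set.mem_ofPred_eq, Fin.forall_fin_succ' (n := k + 1), ht', hf',
        Fin.snoc_castSucc, Fin.snoc_last]
    have htmono' : Monotone t' := by
      refine Fin.monotone_iff_le_succ.2 fun l => ?_
      refine Fin.lastCases ?_ (fun l => ?_) l
      · rw [Fin.succ_last, ht', Fin.snoc_last, Fin.snoc_castSucc, hlast]; exact hvw
      · rw [Fin.succ_castSucc, ht', Fin.snoc_castSucc, Fin.snoc_castSucc]
        exact htmono (Fin.castSucc_le_succ l)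
    have h1 := hX.finite_dimensional a k t htmono (fun l => e' (t l))
    have h2 := hX.finite_dimensional a (k + 1) t' htmono' f'
    rw [Fin.prod_univ_castSucc] at h2
    have h00 : (0 : Fin (k + 1 + 1)) = Fin.castSucc 0 := rfl
    simp only [Fin.succ_last, Fin.succ_castSucc] at h2
    rw [h00] at h2
    simp only [ht', hf', Fin.snoc_castSucc, Fin.snoc_last] at h2
    rw [← mul_assoc, ← h1, hlast, show e' v = i by rw [he', Function.update_self]] at h2
    rw [hset', hset, ← ofReal_measureReal, ← ofReal_measureReal, ht', hf', h2, mul_comm,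
      ENNReal.ofReal_mul (m.transition_nonneg (sub_nonneg.2 (NNReal.coe_le_coe.2 hvw)) _ _)]

/-- The Markov property at a fixed time. -/
lemma measure_past_inter (hX : IsGapDiffusion m X P) (a i j : Fin (n + 1)) {v w : ℝ≥0}
    (hvw : v ≤ w) {B : Set W} (hB : MeasurableSet[pastAlgebra X v] B) :
    P a (B ∩ {ω | X v ω = i} ∩ {ω | X w ω = j}) =
      ENNReal.ofReal (m.transition ((w : ℝ) - v) i j) * P a (B ∩ {ω | X v ω = i}) := by
  have := hX.isProbabilityMeasure a
  have hv : MeasurableSet {ω | X v ω = i} := hX.measurable v (measurableSet_singleton i)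
  have hw : MeasurableSet {ω | X w ω = j} := hX.measurable w (measurableSet_singleton j)
  have key : ((P a).restrict {ω | X w ω = j}).restrict {ω | X v ω = i} B =
      (ENNReal.ofReal (m.transition ((w : ℝ) - v) i j) • (P a).restrict {ω | X v ω = i}) B := by
    -- Both sides are finite measures of the past event; they agree on the cylinders, a generating
    -- π-system, and the empty cylinder compares their total masses.
    have gen : ∀ C ∈ {B | ∃ (s : Finset ℝ≥0) (e : ℝ≥0 → Fin (n + 1)),
        (∀ u ∈ s, u ≤ v) ∧ B = {w | ∀ u ∈ s, X u w = e u}},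
        ((P a).restrict {ω | X w ω = j}).restrict {ω | X v ω = i} C =
        (ENNReal.ofReal (m.transition ((w : ℝ) - v) i j) • (P a).restrict {ω | X v ω = i}) C := by
      rintro _ ⟨s, e, hs, rfl⟩
      have hm := measurableSet_cylinder hX.measurable s e
      rw [Measure.restrict_apply hm, Measure.restrict_apply (hm.inter hv), Measure.smul_apply,
        Measure.restrict_apply hm, smul_eq_mul, hX.measure_cylinder_inter a i j hvw s e hs]
    refine ext_on_measurableSpace_of_generate_finite _ _ gen (pastAlgebra_le hX.measurable v) rfl
      (isPiSystem_cylinder v) ?_ hB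
    exact gen Set.univ ⟨∅, fun _ => 0, by simp, by ext; simp⟩
  have hB' := pastAlgebra_le hX.measurable v _ hB
  rwa [Measure.restrict_apply hB', Measure.restrict_apply (hB'.inter hv), Measure.smul_apply,
    Measure.restrict_apply hB', smul_eq_mul] at key

/-- The process starts at the given point. -/
lemma ae_start (hX : IsGapDiffusion m X P) (a : Fin (n + 1)) : ∀ᵐ ω ∂P a, X 0 ω = a := by
  have := hX.isProbabilityMeasure a
  have h := hX.finite_dimensional a 0 (fun _ => 0) monotone_const (fun _ => a)
  simp only [NNReal.coe_zero, m.transition_zero, Matrix.one_apply_eq, Finset.univ_eq_empty,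
    Finset.prod_empty, mul_one] at h
  have hall : {ω | ∀ _ : Fin (0 + 1), X 0 ω = a} = {ω | X 0 ω = a} := by ext ω; simp
  rw [hall] at h
  have hm : MeasurableSet {ω | X 0 ω = a} := hX.measurable 0 (measurableSet_singleton a)
  exact (prob_compl_eq_zero_iff hm).2 ((ENNReal.toReal_eq_one_iff _).1 h)

end IsGapDiffusion

end Markov

/-! ### Exponential decay from an equation for tail integrals -/

section TailIntegral

lemma hasDerivWithinAt_tail_integral {f F : ℝ → ℝ} {s x : ℝ} (hf : IntegrableOn f (Set.Ioi s))
    (hF : ∀ y ≥ s, F y = ∫ t in Set.Ioi y, f t) (hx : s ≤ x)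
    (hc : ContinuousWithinAt f (Set.Ioi x) x) :
    HasDerivWithinAt F (-f x) (Set.Ici x) x := by
  have hfx : IntegrableOn f (Set.Ioi x) := hf.mono_set (Set.Ioi_subset_Ioi hx)
  have h1 : HasDerivWithinAt (fun u => ∫ t in x..u, f t) (f x) (Set.Ici x) x :=
    intervalIntegral.integral_hasDerivWithinAt_right IntervalIntegrable.refl
      ⟨Set.Ioi x, self_mem_nhdsWithin, hfx.aestronglyMeasurable⟩ hc
  have h2 := h1.const_sub (F x)
  refine h2.congr (fun y hy => ?_) (by simp)
  rw [hF y (hx.trans hy), hF x hx, ← intervalIntegral.integral_Ioi_sub_Ioi hfx hy]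
  ring

/-- The second equation gives the right derivative `-H / R` of `H`, so `H` is exponential. The first
gives the right derivative `-G`, by right-continuity of `G`; hence `G = H / R` at every point, not
only almost everywhere. -/
lemma exponential_of_tail_integral {G H : ℝ → ℝ} {s R : ℝ} (hR : 0 < R)
    (hG : IntegrableOn G (Set.Ioi s)) (hH : IntegrableOn H (Set.Ioi s))
    (h1 : ∀ x ≥ s, H x = ∫ t in Set.Ioi x, G t)
    (h2 : ∀ x ≥ s, R * H x = ∫ t in Set.Ioi x, H t)
    (hc : ∀ x ≥ s, ContinuousWithinAt G (Set.Ioi x) x) {x : ℝ} (hx : s ≤ x) :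
    G x = G s * Real.exp (-((x - s) / R)) := by
  have hHc : ContinuousOn H (Set.Ici s) := by
    have h3 : ∀ x ∈ Set.Ici s, H x = R⁻¹ * ∫ t in Set.Ioi x, H t := by
      intro x hx
      rw [← h2 x hx]
      field_simp
    exact (hH.continuousOn_Ici_primitive_Ioi.const_smul R⁻¹).congr h3
  have hd : ∀ x ≥ s, HasDerivWithinAt H (-(R⁻¹ * H x)) (Set.Ici x) x := by
    intro x hx
    have := hasDerivWithinAt_tail_integral (F := fun x => R * H x) hH h2 hx
      ((hHc x hx).mono fun z hz => hx.trans (le_of_lt hz))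
    have h' := this.const_mul R⁻¹
    simp only [mul_neg] at h'
    refine h'.congr (fun y _ => ?_) ?_ <;> field_simp
  have hGH : ∀ x ≥ s, G x = R⁻¹ * H x := by
    intro x hx
    have := (uniqueDiffWithinAt_Ici x).eq_deriv _ (hd x hx)
      (hasDerivWithinAt_tail_integral hG h1 hx (hc x hx))
    linarith
  have hexp : ∀ y : ℝ, HasDerivAt (fun x => Real.exp ((x - s) / R))
      (Real.exp ((y - s) / R) * (1 / R)) y := by
    intro y
    exact (((hasDerivAt_id y).sub_const s).div_const R).exp
  have hconst := constant_of_has_deriv_right_zero (f := fun x => H x * Real.exp ((x - s) / R))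
    (a := s) (b := x) ?_ ?_ x ⟨hx, le_rfl⟩
  · rw [hGH x hx, hGH s le_rfl]
    simp only [sub_self, zero_div, Real.exp_zero, mul_one] at hconst
    rw [← hconst, Real.exp_neg]
    field_simp
  · exact (hHc.mono Set.Icc_subset_Ici_self).mul (by fun_prop)
  · intro y hy
    have := (hd y hy.1).mul (hexp y).hasDerivWithinAt
    convert! this using 1
    field_simp
    ring

lemma setLIntegral_Ioi_halfLine {f : ℝ≥0 → ℝ≥0∞} (hf : Measurable f) (a : ℝ≥0) :
    ∫⁻ t in Set.Ioi a, f t ∂halfLine = ∫⁻ t in Set.Ioi (a : ℝ), f t.toNNReal := by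
  rw [← lintegral_indicator measurableSet_Ioi, lintegral_halfLine (hf.indicator measurableSet_Ioi),
    ← lintegral_indicator measurableSet_Ici, ← lintegral_indicator measurableSet_Ioi]
  refine lintegral_congr fun t => ?_
  simp only [Set.indicator_apply, Set.mem_Ici, Set.mem_Ioi, Real.lt_toNNReal_iff_coe_lt]
  by_cases h : (a : ℝ) < t
  · simp [h, a.2.trans h.le]
  · simp [h]

lemma setLIntegral_Ioi_halfLine_eq_shift {f : ℝ≥0 → ℝ≥0∞} (hf : Measurable f) (a : ℝ≥0) :
    ∫⁻ t in Set.Ioi a, f t ∂halfLine = ∫⁻ t in Set.Ioi 0, f (a + t) ∂halfLine := by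
  rw [setLIntegral_Ioi_halfLine hf, setLIntegral_Ioi_halfLine (by fun_prop),
    ← lintegral_indicator measurableSet_Ioi, ← lintegral_indicator measurableSet_Ioi,
    ← lintegral_add_left_eq_self _ (a : ℝ)]
  refine lintegral_congr fun t => ?_
  simp only [Set.indicator_apply, Set.mem_Ioi, NNReal.coe_zero, lt_add_iff_pos_right]
  by_cases h : 0 < t
  · rw [if_pos h, if_pos h, Real.toNNReal_add (NNReal.coe_nonneg a) h.le, Real.toNNReal_coe]
  · rw [if_neg h, if_neg h]

lemma lintegral_halfLine_eq_Ioi (f : ℝ≥0 → ℝ≥0∞) :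
    ∫⁻ t, f t ∂halfLine = ∫⁻ t in Set.Ioi 0, f t ∂halfLine := by
  have : (Set.Ioi (0 : ℝ≥0)) =ᵐ[halfLine] Set.univ := by
    have h0 : Set.Ici (0 : ℝ≥0) = Set.univ := Set.Ici_bot
    rw [← h0]
    exact Ioi_ae_eq_Ici
  rw [setLIntegral_congr this, setLIntegral_univ]

lemma exponential_of_tail_lintegral {g : ℝ≥0 → ℝ≥0∞} (hg : Measurable g) (hfin : ∀ r, g r ≠ ∞)
    {s : ℝ≥0} {R : ℝ} (hR : 0 < R) (htop : ∫⁻ r in Set.Ioi s, g r ∂halfLine ≠ ∞)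
    (hh : ∀ a ≥ s, ∫⁻ t in Set.Ioi a, ∫⁻ r in Set.Ioi t, g r ∂halfLine ∂halfLine =
      ENNReal.ofReal R * ∫⁻ r in Set.Ioi a, g r ∂halfLine)
    (hc : ∀ a ≥ s, ContinuousWithinAt g (Set.Ici a) a) {r : ℝ≥0} (hr : s ≤ r) :
    g r = g s * ENNReal.ofReal (Real.exp (-(((r : ℝ) - s) / R))) := by
  set h : ℝ≥0 → ℝ≥0∞ := fun a => ∫⁻ r in Set.Ioi a, g r ∂halfLine with hh_def
  have hhm : Measurable h := by
    refine Antitone.measurable fun a b hab => ?_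
    exact lintegral_mono_set (Set.Ioi_subset_Ioi hab)
  have hhfin : ∀ a ≥ s, h a ≠ ∞ := fun a ha =>
    ne_top_of_le_ne_top htop (lintegral_mono_set (Set.Ioi_subset_Ioi ha))
  set G : ℝ → ℝ := fun x => (g x.toNNReal).toReal
  set H : ℝ → ℝ := fun x => (h x.toNNReal).toReal
  have hGm : Measurable G := (hg.comp measurable_real_toNNReal).ennreal_toReal
  have hHm : Measurable H := (hhm.comp measurable_real_toNNReal).ennreal_toReal
  have int : ∀ {f : ℝ≥0 → ℝ≥0∞}, Measurable f → (∀ a > s, f a ≠ ∞) →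
      ∫⁻ r in Set.Ioi s, f r ∂halfLine ≠ ∞ →
      IntegrableOn (fun x : ℝ => (f x.toNNReal).toReal) (Set.Ioi (s : ℝ)) := by
    intro f hf hf' ht
    rw [setLIntegral_Ioi_halfLine hf] at ht
    exact integrable_toReal_of_lintegral_ne_top (hf.comp measurable_real_toNNReal).aemeasurable ht
  have val : ∀ {f : ℝ≥0 → ℝ≥0∞}, Measurable f → (∀ a > s, f a ≠ ∞) → ∀ x ≥ (s : ℝ),
      (∫⁻ r in Set.Ioi x.toNNReal, f r ∂halfLine).toReal =
        ∫ t in Set.Ioi x, (f t.toNNReal).toReal := by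
    intro f hf hf' x hx
    rw [setLIntegral_Ioi_halfLine hf, Real.coe_toNNReal x (s.2.trans hx), integral_toReal]
    · exact (hf.comp measurable_real_toNNReal).aemeasurable
    · filter_upwards [ae_restrict_mem measurableSet_Ioi] with t ht
      refine (hf' _ ?_).lt_top
      exact Real.lt_toNNReal_iff_coe_lt.2 (lt_of_le_of_lt hx ht)
  have key := exponential_of_tail_integral (G := G) (H := H) (s := s) (x := r) hR
    (int hg (fun a _ => hfin a) htop)
    (int hhm (fun a ha => hhfin a ha.le) ?_) (fun x hx => val hg (fun a _ => hfin a) x hx)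
    (fun x hx => ?_) (fun x hx => ?_) (NNReal.coe_le_coe.2 hr)
  · simp only [G, Real.toNNReal_coe] at key
    rw [← ENNReal.ofReal_toReal (hfin r), key, ENNReal.ofReal_mul ENNReal.toReal_nonneg,
      ENNReal.ofReal_toReal (hfin s)]
  · rw [hh s le_rfl]
    exact ENNReal.mul_ne_top ENNReal.ofReal_ne_top htop
  · have hx' : s ≤ x.toNNReal := (Real.le_toNNReal_iff_coe_le (s.2.trans hx)).2 hx
    have := congrArg ENNReal.toReal (hh _ hx')
    rw [ENNReal.toReal_mul, ENNReal.toReal_ofReal hR.le] at this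
    rw [← val hhm (fun a ha => hhfin a ha.le) x hx]
    exact this.symm
  · have hx' : s ≤ x.toNNReal := (Real.le_toNNReal_iff_coe_le (s.2.trans hx)).2 hx
    have hcont : ContinuousWithinAt (fun y : ℝ => g y.toNNReal) (Set.Ioi x) x :=
      ContinuousWithinAt.comp (hc _ hx') continuous_real_toNNReal.continuousWithinAt
        fun y hy => Real.toNNReal_le_toNNReal (le_of_lt hy)
    exact (ENNReal.tendsto_toReal (hfin _)).comp hcont

end TailIntegral

/-! ### The renewal identity for the Laplace transform of the inverse local time -/

section Renewal

/-- The exponential weight `e^{-z t}`. -/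
noncomputable def expWeight (z : ℝ) (t : ℝ≥0) : ℝ≥0∞ := ENNReal.ofReal (Real.exp (-(z * t)))

lemma measurable_expWeight (z : ℝ) : Measurable (expWeight z) := by
  unfold expWeight; fun_prop

lemma continuous_expWeight (z : ℝ) : Continuous (expWeight z) := by
  unfold expWeight
  exact ENNReal.continuous_ofReal.comp (by fun_prop)

lemma expWeight_le_one {z : ℝ} (hz : 0 ≤ z) (t : ℝ≥0) : expWeight z t ≤ 1 := by
  rw [expWeight, ← ENNReal.ofReal_one]
  exact ENNReal.ofReal_le_ofReal (by simpa using mul_nonneg hz t.2)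

lemma expWeight_add (z : ℝ) (s t : ℝ≥0) : expWeight z (s + t) = expWeight z s * expWeight z t := by
  rw [expWeight, expWeight, expWeight, ← ENNReal.ofReal_mul (Real.exp_pos _).le, ← Real.exp_add]
  congr 2
  push_cast
  ring

lemma lintegral_expWeight {z : ℝ} (hz : 0 < z) :
    ∫⁻ t, expWeight z t ∂halfLine = ENNReal.ofReal (1 / z) := by
  rw [lintegral_halfLine_eq_Ioi, setLIntegral_Ioi_halfLine (measurable_expWeight z)]
  have h1 := integral_exp_mul_Ioi (a := -z) (by linarith) 0
  rw [NNReal.coe_zero]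
  have h2 : ∫⁻ t in Set.Ioi (0 : ℝ), expWeight z t.toNNReal =
      ∫⁻ t in Set.Ioi (0 : ℝ), ENNReal.ofReal (Real.exp (-z * t)) := by
    refine setLIntegral_congr_fun measurableSet_Ioi fun t ht => ?_
    simp only [expWeight]
    rw [Real.coe_toNNReal _ (le_of_lt ht), neg_mul]
  rw [h2, ← ofReal_integral_eq_lintegral_ofReal (integrableOn_exp_mul_Ioi (by linarith) 0)
    (Eventually.of_forall fun t => (Real.exp_pos _).le), h1]
  congr 1
  simp

variable {n : ℕ} {m : FiniteSpeedMeasure n} {W : Type*} [MeasurableSpace W]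
  {P : Fin (n + 1) → Measure W} {X : ℝ≥0 → W → Fin (n + 1)}

omit [MeasurableSpace W] in
lemma killedInverse_expWeight_le_one {z : ℝ} (hz : 0 ≤ z) (w : W) (r : ℝ≥0) :
    killedInverse (zeroSet X w) (expWeight z) r ≤ 1 := by
  rw [killedInverse]
  refine Set.indicator_le_self' (fun _ _ => zero_le) r |>.trans (expWeight_le_one hz _)

/-- The Green function at `0`, in `ℝ≥0∞`. -/
noncomputable def greenFunction (m : FiniteSpeedMeasure n) (z : ℝ) : ℝ≥0∞ :=
  ∫⁻ t, expWeight z t * ENNReal.ofReal (m.transition t 0 0) ∂halfLine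

lemma measurable_ofReal_transition (m : FiniteSpeedMeasure n) (i j : Fin (n + 1)) :
    Measurable fun t : ℝ≥0 => ENNReal.ofReal (m.transition t i j) :=
  ((m.continuous_transition i j).measurable.comp measurable_coe_nnreal_real).ennreal_ofReal

lemma measurable_expWeight_mul_transition (m : FiniteSpeedMeasure n) (z : ℝ) :
    Measurable fun t : ℝ≥0 => expWeight z t * ENNReal.ofReal (m.transition t 0 0) :=
  (measurable_expWeight z).mul (measurable_ofReal_transition m 0 0)

lemma measurable_expWeight_mul_transition_sub (m : FiniteSpeedMeasure n) (z : ℝ) (v : ℝ≥0) :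
    Measurable fun y : ℝ≥0 =>
      expWeight z y * ENNReal.ofReal (m.transition ((y : ℝ) - v) 0 0) :=
  (measurable_expWeight z).mul ((m.continuous_transition 0 0).measurable.comp
    (by fun_prop : Measurable fun y : ℝ≥0 => (y : ℝ) - v)).ennreal_ofReal

lemma greenFunction_eq (m : FiniteSpeedMeasure n) {z : ℝ} (hz : 0 < z) :
    greenFunction m z =
      ENNReal.ofReal (∫ t in Set.Ioi 0, Real.exp (-(z * t)) * m.transition t 0 0) := by
  have hint : IntegrableOn (fun t => Real.exp (-(z * t)) * m.transition t 0 0) (Set.Ioi 0) := by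
    have h := m.isRateMatrix_generator.integrableOn_exp_mulVec hz (Pi.single 0 1) 0
    simp only [Matrix.mulVec_single_one] at h
    exact h
  rw [greenFunction, lintegral_halfLine_eq_Ioi, setLIntegral_Ioi_halfLine
    (measurable_expWeight_mul_transition m z), NNReal.coe_zero,
    ofReal_integral_eq_lintegral_ofReal hint]
  · refine setLIntegral_congr_fun measurableSet_Ioi fun t ht => ?_
    simp only [expWeight]
    rw [Real.coe_toNNReal _ (le_of_lt ht), ENNReal.ofReal_mul (Real.exp_pos _).le]
  · filter_upwards [ae_restrict_mem measurableSet_Ioi] with t ht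
    exact mul_nonneg (Real.exp_pos _).le (m.transition_nonneg (le_of_lt ht) 0 0)

lemma setLIntegral_expWeight_mul_transition (m : FiniteSpeedMeasure n) (z : ℝ) (v : ℝ≥0) :
    ∫⁻ y in Set.Ioi v, expWeight z y * ENNReal.ofReal (m.transition ((y : ℝ) - v) 0 0) ∂halfLine =
      expWeight z v * greenFunction m z := by
  rw [setLIntegral_Ioi_halfLine_eq_shift (measurable_expWeight_mul_transition_sub m z v), ← lintegral_halfLine_eq_Ioi, greenFunction,
    ← lintegral_const_mul (expWeight z v) (measurable_expWeight_mul_transition m z)]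
  refine lintegral_congr fun t => ?_
  rw [expWeight_add, mul_assoc, NNReal.coe_add, add_sub_cancel_left]

lemma measurableSet_prod_occupation_gt (hc : ∀ w, IsCadlagPath fun t => X t w)
    (hX : ∀ t, Measurable (X t)) (a : ℝ≥0) :
    MeasurableSet {p : ℝ≥0 × W | (a : ℝ) < occupation (zeroSet X p.2) p.1} := by
  have h := measurable_uncurry_of_continuous_of_measurable
    (u := fun v w => occupation (zeroSet X w) v)
    (fun w => continuous_occupation (measurableSet_zeroSet hc w))
    (fun v => measurable_occupation hc hX v)
  exact measurableSet_lt measurable_const h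

namespace IsGapDiffusion

/-- Since `s ≤ a`, a local time above `a` at `v` is also above `s`, so the intersection with `A` is
an event of the past of the fixed time `v`. -/
lemma measure_pastLocal_inter (hX : IsGapDiffusion m X P) {s a : ℝ≥0} (hsa : s ≤ a) {A : Set W}
    (hA : MeasurableSet[pastLocalAlgebra hX.cadlag s] A) {v y : ℝ≥0} (hvy : v ≤ y) :
    P 0 (A ∩ {w | (a : ℝ) < occupation (zeroSet X w) v} ∩ {w | X v w = 0} ∩ {w | X y w = 0}) =
      ENNReal.ofReal (m.transition ((y : ℝ) - v) 0 0) *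
        P 0 (A ∩ {w | (a : ℝ) < occupation (zeroSet X w) v} ∩ {w | X v w = 0}) := by
  refine hX.measure_past_inter 0 0 0 hvy ?_
  have h1 : MeasurableSet[pastAlgebra X v] {w | (a : ℝ) < occupation (zeroSet X w) v} :=
    measurable_occupation_pastAlgebra hX.cadlag v measurableSet_Ioi
  convert @MeasurableSet.inter _ (pastAlgebra X v) _ _ (hA.2 v) h1 using 1
  ext w
  simp only [Set.mem_inter_iff, Set.mem_ofPred_eq]
  exact ⟨fun h => ⟨⟨h.1, lt_of_le_of_lt (NNReal.coe_le_coe.2 hsa) h.2⟩, h.2⟩,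
    fun h => ⟨h.1.1, h.2⟩⟩

/-- The Markov property, in integrated form. -/
lemma lintegral_double_eq (hX : IsGapDiffusion m X P) {s a : ℝ≥0} (hsa : s ≤ a) {A : Set W}
    (hA : MeasurableSet[pastLocalAlgebra hX.cadlag s] A) (z : ℝ) :
    ∫⁻ w in A, ∫⁻ v in zeroSet X w, {v | (a : ℝ) < occupation (zeroSet X w) v}.indicator
        (fun v => ∫⁻ y in zeroSet X w, (Set.Ioi v).indicator (expWeight z) y ∂halfLine) v
        ∂halfLine ∂P 0 =
      greenFunction m z * ∫⁻ w in A, ∫⁻ v in zeroSet X w,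
        {v | (a : ℝ) < occupation (zeroSet X w) v}.indicator (expWeight z) v ∂halfLine ∂P 0 := by
  classical
  have := hX.isProbabilityMeasure 0
  have hAm : MeasurableSet A := pastLocalAlgebra_le hX.cadlag s _ hA
  have hzm := measurableSet_zeroSet hX.cadlag
  have hprod := measurableSet_prod_zeroSet hX.cadlag hX.measurable
  have hocc := measurableSet_prod_occupation_gt hX.cadlag hX.measurable a
  set S : Set (ℝ≥0 × W) := {p | p.2 ∈ A} ∩ {p | (a : ℝ) < occupation (zeroSet X p.2) p.1} ∩
    {p | p.1 ∈ zeroSet X p.2} with hS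
  have hSm : MeasurableSet S := ((measurable_snd hAm).inter hocc).inter hprod
  have hsec : ∀ v, {w | (v, w) ∈ S} =
      A ∩ {w | (a : ℝ) < occupation (zeroSet X w) v} ∩ {w | X v w = 0} := fun v => rfl
  have hsecm : ∀ v, MeasurableSet {w | (v, w) ∈ S} := fun v => measurable_prodMk_left hSm
  have hwm := measurable_expWeight z
  -- both sides as integrals over the time `v`
  have right : ∫⁻ w in A, ∫⁻ v in zeroSet X w,
      {v | (a : ℝ) < occupation (zeroSet X w) v}.indicator (expWeight z) v ∂halfLine ∂P 0 =
      ∫⁻ v, expWeight z v * P 0 {w | (v, w) ∈ S} ∂halfLine := by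
    have e : ∀ w, A.indicator (fun w => ∫⁻ v in zeroSet X w,
        {v | (a : ℝ) < occupation (zeroSet X w) v}.indicator (expWeight z) v ∂halfLine) w =
        ∫⁻ v, S.indicator (fun p => expWeight z p.1) (v, w) ∂halfLine := by
      intro w
      by_cases hw : w ∈ A
      · rw [Set.indicator_of_mem hw, ← lintegral_indicator (hzm w)]
        refine lintegral_congr fun v => ?_
        simp only [Set.indicator_apply, hS, Set.mem_inter_iff, Set.mem_ofPred_eq, hw, true_and]
        by_cases h1 : v ∈ zeroSet X w <;> simp [h1]
      · rw [Set.indicator_of_notMem hw]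
        symm
        refine (lintegral_congr fun v => Set.indicator_of_notMem ?_ _).trans lintegral_zero
        exact fun h => hw h.1.1
    rw [← lintegral_indicator hAm, lintegral_congr e,
      lintegral_lintegral_swap
        (f := fun w v => S.indicator (fun p : ℝ≥0 × W => expWeight z p.1) (v, w))
        (((hwm.comp measurable_fst).indicator hSm).comp measurable_swap).aemeasurable]
    refine lintegral_congr fun v => ?_
    rw [← lintegral_indicator_const (hsecm v)]
    rfl
  have left : ∫⁻ w in A, ∫⁻ v in zeroSet X w, {v | (a : ℝ) < occupation (zeroSet X w) v}.indicator
        (fun v => ∫⁻ y in zeroSet X w, (Set.Ioi v).indicator (expWeight z) y ∂halfLine) v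
        ∂halfLine ∂P 0 =
      ∫⁻ v, ∫⁻ y in Set.Ioi v, expWeight z y * P 0 ({w | (v, w) ∈ S} ∩ {w | X y w = 0})
        ∂halfLine ∂halfLine := by
    -- The integrand is written as one jointly measurable function of both times and the path, so
    -- that Tonelli's theorem can bring the path integral innermost.
    set K : (ℝ≥0 × W) × ℝ≥0 → ℝ≥0∞ :=
      ({q | q.1 ∈ S} ∩ {q | q.1.1 < q.2} ∩ {q | q.2 ∈ zeroSet X q.1.2}).indicator
        (fun q => expWeight z q.2) with hK
    have hKm : Measurable K := by
      refine (hwm.comp measurable_snd).indicator ?_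
      refine MeasurableSet.inter (MeasurableSet.inter (measurable_fst hSm)
        (measurableSet_lt (by fun_prop) (by fun_prop))) ?_
      exact (show Measurable fun q : (ℝ≥0 × W) × ℝ≥0 => (q.2, q.1.2) by fun_prop) hprod
    have e : ∀ w, A.indicator (fun w => ∫⁻ v in zeroSet X w,
        {v | (a : ℝ) < occupation (zeroSet X w) v}.indicator
        (fun v => ∫⁻ y in zeroSet X w, (Set.Ioi v).indicator (expWeight z) y ∂halfLine) v
        ∂halfLine) w = ∫⁻ v, ∫⁻ y, K ((v, w), y) ∂halfLine ∂halfLine := by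
      intro w
      by_cases hw : w ∈ A
      · rw [Set.indicator_of_mem hw, ← lintegral_indicator (hzm w)]
        refine lintegral_congr fun v => ?_
        by_cases hv : (v, w) ∈ S
        · have hv2 : v ∈ zeroSet X w := hv.2
          rw [Set.indicator_of_mem hv2, Set.indicator_of_mem (show v ∈ {v | _ < _} from hv.1.2),
            ← lintegral_indicator (hzm w)]
          refine lintegral_congr fun y => ?_
          simp only [hK, Set.indicator_apply, Set.mem_inter_iff, Set.mem_ofPred_eq, hv, true_and,
            Set.mem_Ioi]
          by_cases h1 : y ∈ zeroSet X w <;> simp [h1]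
        · have h0 : ∀ y, K ((v, w), y) = 0 := fun y => Set.indicator_of_notMem (fun h => hv h.1.1) _
          simp only [h0, lintegral_zero, Set.indicator_apply, Set.mem_ofPred_eq]
          by_cases h1 : v ∈ zeroSet X w
          · have h2 : ¬ (a : ℝ) < occupation (zeroSet X w) v := fun h => hv ⟨⟨hw, h⟩, h1⟩
            simp [h2]
          · simp [h1]
      · rw [Set.indicator_of_notMem hw]
        have h0 : ∀ v y, K ((v, w), y) = 0 := fun v y =>
          Set.indicator_of_notMem (fun h => hw h.1.1.1.1) _
        simp [h0]
    rw [← lintegral_indicator hAm, lintegral_congr e,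
      lintegral_lintegral_swap (f := fun w v => ∫⁻ y, K ((v, w), y) ∂halfLine)
        (hKm.lintegral_prod_right'.comp measurable_swap).aemeasurable]
    refine lintegral_congr fun v => ?_
    rw [lintegral_lintegral_swap (f := fun w y => K ((v, w), y))
      (hKm.comp (show Measurable fun q : W × ℝ≥0 => ((v, q.1), q.2) by fun_prop)).aemeasurable,
      ← lintegral_indicator measurableSet_Ioi]
    refine lintegral_congr fun y => ?_
    by_cases hvy : v < y
    · have hym : MeasurableSet ({w | (v, w) ∈ S} ∩ {w | X y w = 0}) :=
        (hsecm v).inter (hX.measurable y (measurableSet_singleton 0))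
      rw [Set.indicator_of_mem (Set.mem_Ioi.2 hvy), ← lintegral_indicator_const hym]
      refine lintegral_congr fun w => ?_
      simp only [hK, Set.indicator_apply, Set.mem_inter_iff, Set.mem_ofPred_eq, hvy, and_true]
      exact if_congr Iff.rfl rfl rfl
    · rw [Set.indicator_of_notMem (by simpa using hvy)]
      refine (lintegral_congr fun w => Set.indicator_of_notMem ?_ _).trans lintegral_zero
      exact fun h => hvy h.1.2
  have hPm : Measurable fun v => P 0 {w | (v, w) ∈ S} := measurable_measure_prodMk_left hSm
  have hwP : Measurable fun v => expWeight z v * P 0 {w | (v, w) ∈ S} := hwm.mul hPm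
  rw [right, left, ← lintegral_const_mul (greenFunction m z) hwP]
  refine lintegral_congr fun v => ?_
  -- For fixed `v`, the Markov property splits off the return probability from `v` to `y`;
  -- integrating over `y` then leaves `expWeight z v * greenFunction m z`.
  have e : ∫⁻ y in Set.Ioi v, expWeight z y * P 0 ({w | (v, w) ∈ S} ∩ {w | X y w = 0}) ∂halfLine =
      ∫⁻ y in Set.Ioi v, (expWeight z y * ENNReal.ofReal (m.transition ((y : ℝ) - v) 0 0)) *
        P 0 {w | (v, w) ∈ S} ∂halfLine := by
    refine setLIntegral_congr_fun measurableSet_Ioi fun y hy => ?_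
    simp only [hsec]
    rw [hX.measure_pastLocal_inter hsa hA (le_of_lt hy), mul_assoc]
  rw [e, lintegral_mul_const, setLIntegral_expWeight_mul_transition]
  · ring
  · exact measurable_expWeight_mul_transition_sub m z v

/-- The Laplace transform of the inverse local time on an event that depends on the past of the
process up to a smaller inverse local time. -/
noncomputable def partialLaplace (P : Measure W) (X : ℝ≥0 → W → Fin (n + 1)) (A : Set W) (z : ℝ)
    (r : ℝ≥0) : ℝ≥0∞ :=
  ∫⁻ w in A, killedInverse (zeroSet X w) (expWeight z) r ∂P

lemma measurable_partialLaplace (hX : IsGapDiffusion m X P) (A : Set W) (z : ℝ) :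
    Measurable (partialLaplace (P 0) X A z) := by
  have := hX.isProbabilityMeasure 0
  exact (measurable_prod_killedInverse hX.cadlag hX.measurable
    (measurable_expWeight z)).lintegral_prod_right'

lemma setLIntegral_partialLaplace (hX : IsGapDiffusion m X P) (A : Set W) (z : ℝ) (a : ℝ≥0) :
    ∫⁻ r in Set.Ioi a, partialLaplace (P 0) X A z r ∂halfLine =
      ∫⁻ w in A, ∫⁻ r in Set.Ioi a, killedInverse (zeroSet X w) (expWeight z) r ∂halfLine ∂P 0 := by
  have := hX.isProbabilityMeasure 0
  have hK := measurable_prod_killedInverse hX.cadlag hX.measurable (measurable_expWeight z)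
  exact lintegral_lintegral_swap (f := fun r w => killedInverse (zeroSet X w) (expWeight z) r)
    hK.aemeasurable

omit [MeasurableSpace W] in
-- A level that is exceeded stays exceeded slightly to its right, where the inverse is
-- right-continuous. Beyond the total local time the function is identically `0`.
lemma continuousWithinAt_killedInverse (hc : ∀ w, IsCadlagPath fun t => X t w) (z : ℝ) (w : W)
    (a : ℝ≥0) :
    ContinuousWithinAt (killedInverse (zeroSet X w) (expWeight z)) (Set.Ici a) a := by
  have hA := measurableSet_zeroSet hc w
  by_cases hv : ∃ s, (a : ℝ) < occupation (zeroSet X w) s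
  · have h1 : ContinuousWithinAt (fun r => expWeight z (rightInverse (occupation (zeroSet X w)) r))
        (Set.Ici a) a :=
      (continuous_expWeight z).continuousAt.comp_continuousWithinAt
        (continuousWithinAt_rightInverse hA hv)
    have hmem : a ∈ {t : ℝ≥0 | ∃ s, (t : ℝ) < occupation (zeroSet X w) s} := hv
    refine h1.congr_of_eventuallyEq ?_ (Set.indicator_of_mem hmem _)
    obtain ⟨u, hu⟩ := hv
    filter_upwards [mem_nhdsWithin_of_mem_nhds (Iio_mem_nhds (Real.lt_toNNReal_iff_coe_lt.2 hu))]
      with r hr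
    have hmem' : r ∈ {t : ℝ≥0 | ∃ s, (t : ℝ) < occupation (zeroSet X w) s} :=
      ⟨u, Real.lt_toNNReal_iff_coe_lt.1 hr⟩
    exact Set.indicator_of_mem hmem' _
  · have hnot : ∀ r ∈ Set.Ici a,
        r ∉ {t : ℝ≥0 | ∃ s, (t : ℝ) < occupation (zeroSet X w) s} :=
      fun r hr h => hv (exists_occupation_gt_mono hr h)
    exact (continuousWithinAt_const (b := (0 : ℝ≥0∞))).congr
      (fun r hr => Set.indicator_of_notMem (hnot r hr) _)
      (Set.indicator_of_notMem (hnot a Set.self_mem_Ici) _)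

lemma partialLaplace_le_one (hX : IsGapDiffusion m X P) (A : Set W) {z : ℝ} (hz : 0 ≤ z)
    (r : ℝ≥0) : partialLaplace (P 0) X A z r ≤ 1 := by
  have := hX.isProbabilityMeasure 0
  calc partialLaplace (P 0) X A z r ≤ ∫⁻ _ in A, 1 ∂P 0 :=
        lintegral_mono fun w => killedInverse_expWeight_le_one hz w r
    _ ≤ 1 := by simpa using prob_le_one

lemma continuousWithinAt_partialLaplace (hX : IsGapDiffusion m X P) (A : Set W) {z : ℝ}
    (hz : 0 ≤ z) (a : ℝ≥0) :
    ContinuousWithinAt (partialLaplace (P 0) X A z) (Set.Ici a) a := by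
  have := hX.isProbabilityMeasure 0
  have hm : ∀ r, Measurable fun w => killedInverse (zeroSet X w) (expWeight z) r := by
    intro r
    have hK := measurable_prod_killedInverse hX.cadlag hX.measurable (measurable_expWeight z)
    exact Measurable.of_uncurry_left
      (f := fun r w => killedInverse (zeroSet X w) (expWeight z) r) hK
  refine tendsto_lintegral_filter_of_dominated_convergence (fun _ => 1)
    (Eventually.of_forall hm) ?_ (by simp) ?_
  · exact Eventually.of_forall fun r => Eventually.of_forall fun w =>
      killedInverse_expWeight_le_one hz w r
  · exact Eventually.of_forall fun w => continuousWithinAt_killedInverse hX.cadlag z w a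

/-- The regenerative property of the inverse local time, for partial Laplace transforms. -/
lemma partialLaplace_eq (hX : IsGapDiffusion m X P) {s : ℝ≥0} {A : Set W}
    (hA : MeasurableSet[pastLocalAlgebra hX.cadlag s] A) {z ψ : ℝ} (hz : 0 < z) (hψ : 0 < ψ)
    (hR : ψ * ∫ t in Set.Ioi 0, Real.exp (-(z * t)) * m.transition t 0 0 = 1) {r : ℝ≥0}
    (hr : s ≤ r) :
    partialLaplace (P 0) X A z r = partialLaplace (P 0) X A z s *
      ENNReal.ofReal (Real.exp (-(((r : ℝ) - s) * ψ))) := by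
  have := hX.isProbabilityMeasure 0
  have hRe : ∫ t in Set.Ioi 0, Real.exp (-(z * t)) * m.transition t 0 0 = ψ⁻¹ :=
    eq_inv_of_mul_eq_one_right hR
  have hzm := measurableSet_zeroSet hX.cadlag
  have hwm := measurable_expWeight z
  have key := exponential_of_tail_lintegral (hX.measurable_partialLaplace A z)
    (fun r => ne_top_of_le_ne_top ENNReal.one_ne_top (hX.partialLaplace_le_one A hz.le r))
    (s := s) (R := ψ⁻¹) (inv_pos.2 hψ) ?_ (fun a ha => ?_)
    (fun a _ => hX.continuousWithinAt_partialLaplace A hz.le a) hr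
  · rw [key, div_inv_eq_mul]
  · rw [hX.setLIntegral_partialLaplace]
    -- In real time, the tail integral only collects `e^{-zv}` over some of the zeros, hence is at
    -- most its integral over the whole half-line.
    have hb : ∀ w, ∫⁻ r in Set.Ioi s, killedInverse (zeroSet X w) (expWeight z) r ∂halfLine ≤
        ENNReal.ofReal (1 / z) := by
      intro w
      rw [setLIntegral_killedInverse (hzm w) hwm, ← lintegral_expWeight hz]
      refine (setLIntegral_le_lintegral _ _).trans (lintegral_mono fun v => ?_)
      exact Set.indicator_le_self' (fun _ _ => zero_le) v
    refine ne_top_of_le_ne_top ?_ (lintegral_mono hb)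
    rw [setLIntegral_const]
    exact ENNReal.mul_ne_top ENNReal.ofReal_ne_top (measure_ne_top _ _)
  · have h1 : ∀ t, ∫⁻ r in Set.Ioi t, partialLaplace (P 0) X A z r ∂halfLine =
        ∫⁻ w in A, ∫⁻ r in Set.Ioi t, killedInverse (zeroSet X w) (expWeight z) r ∂halfLine ∂P 0 :=
      hX.setLIntegral_partialLaplace A z
    have hK := measurable_prod_killedInverse hX.cadlag hX.measurable hwm
    have hm2 : Measurable fun p : ℝ≥0 × W =>
        ∫⁻ r in Set.Ioi p.1, killedInverse (zeroSet X p.2) (expWeight z) r ∂halfLine := by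
      simp_rw [← lintegral_indicator measurableSet_Ioi]
      have : Measurable fun q : (ℝ≥0 × W) × ℝ≥0 => ({q : (ℝ≥0 × W) × ℝ≥0 | q.1.1 < q.2}).indicator
          (fun q => killedInverse (zeroSet X q.1.2) (expWeight z) q.2) q :=
        (hK.comp (show Measurable fun q : (ℝ≥0 × W) × ℝ≥0 => (q.2, q.1.2) by fun_prop)).indicator
          (measurableSet_lt (by fun_prop) (by fun_prop))
      exact this.lintegral_prod_right'
    simp_rw [h1]
    rw [lintegral_lintegral_swap (f := fun t w => ∫⁻ r in Set.Ioi t,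
      killedInverse (zeroSet X w) (expWeight z) r ∂halfLine) hm2.aemeasurable]
    simp_rw [setLIntegral_setLIntegral_killedInverse (hzm _) hwm,
      setLIntegral_killedInverse (hzm _) hwm]
    rw [hX.lintegral_double_eq ha hA z, greenFunction_eq m hz, hRe]

end IsGapDiffusion

end Renewal

/-! ### Recurrence and the compound Poisson structure of the inverse local time -/

section InverseLocalTime

lemma tendsto_laplaceTransform_zero (μ : Measure ℝ) [IsProbabilityMeasure μ]
    (h : μ (Set.Iio 0) = 0) :
    Tendsto (fun k : ℕ => laplaceTransform μ (1 / ((k : ℝ) + 1))) atTop (𝓝 1) := by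
  have h1 : (1 : ℝ≥0∞) = ∫⁻ _, 1 ∂μ := by simp
  rw [h1]
  refine tendsto_lintegral_of_dominated_convergence (fun _ => 1)
    (fun k => measurable_ofReal_exp_neg_mul _) (fun k => ?_) (by simp) ?_
  · filter_upwards [ae_nonneg_of_measure_Iio h] with x hx
    rw [← ENNReal.ofReal_one]
    refine ENNReal.ofReal_le_ofReal ?_
    rw [Real.exp_le_one_iff]
    have : 0 ≤ 1 / ((k : ℝ) + 1) * x := by positivity
    linarith
  · refine Eventually.of_forall fun x => ?_
    have h2 : Tendsto (fun k : ℕ => Real.exp (-(1 / ((k : ℝ) + 1) * x))) atTop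
        (𝓝 (Real.exp (-(0 * x)))) :=
      (Real.continuous_exp.tendsto _).comp
        ((tendsto_one_div_add_atTop_nhds_zero_nat.mul_const x).neg)
    have := ENNReal.tendsto_ofReal h2
    simpa using this

lemma occupation_pos_of_eventually {A : Set ℝ≥0} (h : ∀ᶠ s in 𝓝[≥] (0 : ℝ≥0), s ∈ A)
    {v : ℝ≥0} (hv : 0 < v) : 0 < occupation A v := by
  obtain ⟨u, hu, hsub⟩ := (mem_nhdsGE_iff_exists_Ico_subset' hv).1 h
  have hu0 : (0 : ℝ≥0) < u := hu
  have hw : 0 < min (u / 2) v := lt_min (by positivity) hv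
  refine ENNReal.toReal_pos (ne_of_gt ?_) (halfLine_inter_Iic_ne_top A v)
  calc (0 : ℝ≥0∞) < halfLine (Set.Iic (min (u / 2) v)) := by
        rw [halfLine_Iic]; exact_mod_cast hw
    _ ≤ halfLine (A ∩ Set.Iic v) := by
        refine measure_mono fun x hx => ⟨hsub ⟨zero_le, ?_⟩,
          Set.mem_Iic.2 ((Set.mem_Iic.1 hx).trans (min_le_right _ _))⟩
        exact lt_of_le_of_lt ((Set.mem_Iic.1 hx).trans (min_le_left _ _)) (NNReal.half_lt_self hu0.ne')

lemma rightInverse_zero_of_occupation_pos {A : Set ℝ≥0} (hA : MeasurableSet A)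
    (h : ∀ v, 0 < v → 0 < occupation A v) : rightInverse (occupation A) 0 = 0 := by
  have hv : ∃ s, ((0 : ℝ≥0) : ℝ) < occupation A s := ⟨1, h 1 one_pos⟩
  by_contra hne
  have hpos : 0 < rightInverse (occupation A) 0 := pos_iff_ne_zero.2 hne
  exact lt_irrefl _ ((rightInverse_lt_iff hA hv).2 (by simpa using h _ hpos))

/-- Occupation time grows at speed at most one, so gaining local time `t` takes at least real time
`t`. Hence the excess is nondecreasing. -/
lemma le_rightInverse_sub {A : Set ℝ≥0} (hA : MeasurableSet A)
    (hrec : ∀ t : ℝ≥0, ∃ s, (t : ℝ) < occupation A s) (s t : ℝ≥0) :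
    (t : ℝ) ≤ rightInverse (occupation A) (s + t) - rightInverse (occupation A) s := by
  have h := occupation_sub_le hA (rightInverse_mono (A := A) (le_self_add : s ≤ s + t) (hrec _))
  rw [occupation_rightInverse hA (hrec _), occupation_rightInverse hA (hrec _)] at h
  push_cast at h
  linarith

lemma isCadlagPath_rightInverse_sub {A : Set ℝ≥0} (hA : MeasurableSet A)
    (hrec : ∀ t : ℝ≥0, ∃ s, (t : ℝ) < occupation A s) :
    IsCadlagPath fun t : ℝ≥0 => (rightInverse (occupation A) t : ℝ) - t := by
  intro t
  constructor
  · exact (NNReal.continuous_coe.continuousAt.comp_continuousWithinAt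
      (continuousWithinAt_rightInverse hA (hrec t))).sub (by fun_prop)
  · have hm : Monotone fun t : ℝ≥0 => (rightInverse (occupation A) t : ℝ) := fun s t hst =>
      NNReal.coe_le_coe.2 (rightInverse_mono hst (hrec t))
    have h1 := hm.tendsto_nhdsLT t
    have h2 : Tendsto (fun t : ℝ≥0 => (t : ℝ)) (𝓝[<] t) (𝓝 (t : ℝ)) :=
      (NNReal.continuous_coe.tendsto t).mono_left nhdsWithin_le_nhds
    exact ⟨_, h1.sub h2⟩

variable {n : ℕ} {m : FiniteSpeedMeasure n} {W : Type*} [MeasurableSpace W]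
  {P : Fin (n + 1) → Measure W} {X : ℝ≥0 → W → Fin (n + 1)}

/-- The inverse local time, written with the occupation time of the zero set. -/
noncomputable def inverseLocal (X : ℝ≥0 → W → Fin (n + 1)) (t : ℝ≥0) (w : W) : ℝ≥0 :=
  rightInverse (occupation (zeroSet X w)) t

/-- The excess of the inverse local time, that is the time spent away from `0`. -/
noncomputable def excess (X : ℝ≥0 → W → Fin (n + 1)) (t : ℝ≥0) (w : W) : ℝ :=
  (inverseLocal X t w : ℝ) - t

namespace IsGapDiffusion

lemma ae_occupation_pos (hX : IsGapDiffusion m X P) :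
    ∀ᵐ w ∂P 0, ∀ v, 0 < v → 0 < occupation (zeroSet X w) v := by
  filter_upwards [hX.ae_start 0] with w hw v hv
  refine occupation_pos_of_eventually ?_ hv
  filter_upwards [eventually_eq_of_cadlag hX.cadlag w 0] with s hs
  exact hs.trans hw

lemma ae_inverseLocal_zero (hX : IsGapDiffusion m X P) : ∀ᵐ w ∂P 0, inverseLocal X 0 w = 0 := by
  filter_upwards [hX.ae_occupation_pos] with w hw
  exact rightInverse_zero_of_occupation_pos (measurableSet_zeroSet hX.cadlag w) hw

/-- The local time at `0` grows beyond all bounds. -/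
lemma ae_recurrent (hX : IsGapDiffusion m X P) {μS : Measure ℝ} [IsProbabilityMeasure μS]
    (h0 : μS (Set.Iic 0) = 0) {a : ℝ} (ha : 0 ≤ a)
    (hS : ∀ z : ℝ, 0 < z → (z + a * (1 - (laplaceTransform μS z).toReal)) *
      ∫ t in Set.Ioi 0, Real.exp (-(z * t)) * m.transition t 0 0 = 1) :
    ∀ᵐ w ∂P 0, ∀ t : ℝ≥0, ∃ s, (t : ℝ) < occupation (zeroSet X w) s := by
  have := hX.isProbabilityMeasure 0
  have h0' : μS (Set.Iio 0) = 0 := measure_mono_null Set.Iio_subset_Iic_self h0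
  -- On the whole space and from level `0`, the killed Laplace transform starts at `1` and equals
  -- the stated exponential; it is at most the probability that `r` is exceeded.
  have bound : ∀ (r : ℝ≥0) (z : ℝ), 0 < z →
      ENNReal.ofReal (Real.exp (-((r : ℝ) * (z + a * (1 - (laplaceTransform μS z).toReal))))) ≤
        P 0 {w | ∃ s, (r : ℝ) < occupation (zeroSet X w) s} := by
    intro r z hz
    have hle : (laplaceTransform μS z).toReal ≤ 1 :=
      ENNReal.toReal_le_of_le_ofReal zero_le_one
        (by simpa using laplaceTransform_le_one h0' hz.le)
    have hψ : 0 < z + a * (1 - (laplaceTransform μS z).toReal) := by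
      have := mul_nonneg ha (sub_nonneg.2 hle)
      linarith
    have key := hX.partialLaplace_eq (s := 0) (A := Set.univ)
      (@MeasurableSet.univ _ (pastLocalAlgebra hX.cadlag 0)) hz hψ (hS z hz) (zero_le (a := r))
    have hstart : partialLaplace (P 0) X Set.univ z 0 = 1 := by
      rw [partialLaplace, Measure.restrict_univ]
      have : ∀ᵐ w ∂P 0, killedInverse (zeroSet X w) (expWeight z) 0 = 1 := by
        filter_upwards [hX.ae_occupation_pos, hX.ae_inverseLocal_zero] with w hw hw0
        have hmem : (0 : ℝ≥0) ∈ {t : ℝ≥0 | ∃ s, (t : ℝ) < occupation (zeroSet X w) s} :=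
          ⟨1, by simpa using hw 1 one_pos⟩
        rw [inverseLocal] at hw0
        rw [killedInverse, Set.indicator_of_mem hmem, hw0]
        simp [expWeight]
      rw [lintegral_congr_ae this]
      simp
    rw [hstart, one_mul, NNReal.coe_zero, sub_zero] at key
    rw [← key, partialLaplace, Measure.restrict_univ,
      ← lintegral_indicator_one (measurableSet_exists_occupation_gt_left hX.cadlag hX.measurable r)]
    refine lintegral_mono fun w => ?_
    by_cases hw : ∃ s, (r : ℝ) < occupation (zeroSet X w) s
    · have hmem : w ∈ {w | ∃ s, (r : ℝ) < occupation (zeroSet X w) s} := hw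
      rw [Set.indicator_of_mem hmem]
      exact killedInverse_expWeight_le_one hz.le w r
    · have hmem : r ∉ {t : ℝ≥0 | ∃ s, (t : ℝ) < occupation (zeroSet X w) s} := hw
      rw [killedInverse, Set.indicator_of_notMem hmem]
      exact zero_le
  -- As `z` tends to `0` along `1 / (k + 1)`, the transform of the probability measure `μS` tends to
  -- `1`, so the exponent vanishes in the limit.
  have full : ∀ r : ℝ≥0, P 0 {w | ∃ s, (r : ℝ) < occupation (zeroSet X w) s} = 1 := by
    intro r
    refine le_antisymm prob_le_one ?_
    have hz : Tendsto (fun k : ℕ => 1 / ((k : ℝ) + 1)) atTop (𝓝 0) :=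
      tendsto_one_div_add_atTop_nhds_zero_nat
    have hL := (ENNReal.tendsto_toReal ENNReal.one_ne_top).comp
      (tendsto_laplaceTransform_zero μS h0')
    have hlim : Tendsto (fun k : ℕ => ENNReal.ofReal (Real.exp (-((r : ℝ) * (1 / ((k : ℝ) + 1) +
        a * (1 - (laplaceTransform μS (1 / ((k : ℝ) + 1))).toReal)))))) atTop (𝓝 1) := by
      have h1 : Tendsto (fun k : ℕ => Real.exp (-((r : ℝ) * (1 / ((k : ℝ) + 1) +
          a * (1 - (laplaceTransform μS (1 / ((k : ℝ) + 1))).toReal))))) atTop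
          (𝓝 (Real.exp (-((r : ℝ) * (0 + a * (1 - (1 : ℝ≥0∞).toReal)))))) :=
        (Real.continuous_exp.tendsto _).comp
          (((hz.add ((tendsto_const_nhds.sub hL).const_mul a)).const_mul (r : ℝ)).neg)
      have := ENNReal.tendsto_ofReal h1
      simpa using this
    exact le_of_tendsto' hlim fun k => bound r _ (by positivity)
  have hall : ∀ᵐ w ∂P 0, ∀ k : ℕ, ∃ s, ((k : ℝ≥0) : ℝ) < occupation (zeroSet X w) s := by
    rw [ae_all_iff]
    intro k
    exact (prob_compl_eq_zero_iff
      (measurableSet_exists_occupation_gt_left hX.cadlag hX.measurable k)).2 (full k)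
  filter_upwards [hall] with w hw t
  obtain ⟨k, hk⟩ := exists_nat_ge t
  exact exists_occupation_gt_mono hk (hw k)

lemma measurable_inverseLocal (hX : IsGapDiffusion m X P) (t : ℝ≥0) :
    Measurable (inverseLocal X t) :=
  measurable_rightInverse_right hX.cadlag hX.measurable t

lemma measurable_excess (hX : IsGapDiffusion m X P) (t : ℝ≥0) : Measurable (excess X t) :=
  (measurable_coe_nnreal_real.comp (hX.measurable_inverseLocal t)).sub_const _

lemma measurable_excess_pastLocalAlgebra (hX : IsGapDiffusion m X P) {u s : ℝ≥0} (hus : u ≤ s) :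
    Measurable[pastLocalAlgebra hX.cadlag s] (excess X u) :=
  (measurable_coe_nnreal_real.comp (measurable_rightInverse_pastLocalAlgebra hX.cadlag
    hX.measurable hus)).sub_const _

/-- The Laplace transform of an increment of the inverse local time, on an event of its past. -/
lemma lintegral_exp_increment (hX : IsGapDiffusion m X P)
    (hrec : ∀ᵐ w ∂P 0, ∀ t : ℝ≥0, ∃ s, (t : ℝ) < occupation (zeroSet X w) s) {s : ℝ≥0} {A : Set W}
    (hA : MeasurableSet[pastLocalAlgebra hX.cadlag s] A) {z ψ : ℝ} (hz : 0 < z) (hψ : 0 < ψ)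
    (hR : ψ * ∫ t in Set.Ioi 0, Real.exp (-(z * t)) * m.transition t 0 0 = 1) (t : ℝ≥0) :
    ∫⁻ w in A, ENNReal.ofReal (Real.exp (-(z * ((inverseLocal X (s + t) w : ℝ) -
      inverseLocal X s w)))) ∂P 0 = P 0 A * ENNReal.ofReal (Real.exp (-((t : ℝ) * ψ))) := by
  have := hX.isProbabilityMeasure 0
  have hle := pastLocalAlgebra_le hX.cadlag s
  set c := ENNReal.ofReal (Real.exp (-((t : ℝ) * ψ))) with hc
  have hwm : ∀ r, Measurable fun w => expWeight z (inverseLocal X r w) := fun r =>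
    (measurable_expWeight z).comp (hX.measurable_inverseLocal r)
  have hpl : ∀ (r : ℝ≥0) (A' : Set W), partialLaplace (P 0) X A' z r =
      ∫⁻ w in A', expWeight z (inverseLocal X r w) ∂P 0 := by
    intro r A'
    refine lintegral_congr_ae (ae_restrict_of_ae ?_)
    filter_upwards [hrec] with w hw
    have hmem : r ∈ {t : ℝ≥0 | ∃ s, (t : ℝ) < occupation (zeroSet X w) s} := hw r
    rw [killedInverse, Set.indicator_of_mem hmem]
    rfl
  -- The regenerative property for all past events is an equality of two measures on the past
  -- σ-algebra.
  have htrim : ((P 0).withDensity fun w => expWeight z (inverseLocal X (s + t) w)).trim hle =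
      (c • (P 0).withDensity fun w => expWeight z (inverseLocal X s w)).trim hle := by
    refine @Measure.ext _ (pastLocalAlgebra hX.cadlag s) _ _ fun A' hA' => ?_
    rw [trim_measurableSet_eq hle hA', trim_measurableSet_eq hle hA', Measure.smul_apply,
      withDensity_apply _ (hle _ hA'), withDensity_apply _ (hle _ hA'), ← hpl, ← hpl,
      hX.partialLaplace_eq hA' hz hψ hR le_self_add, hc, smul_eq_mul, mul_comm]
    congr 4
    push_cast
    ring
  -- The reciprocal of the weight at `s` is measurable with respect to the past; integrating it over
  -- `A` turns the inverse local time at `s + t` into its increment.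
  set f : W → ℝ≥0∞ := A.indicator fun w => ENNReal.ofReal (Real.exp (z * inverseLocal X s w))
    with hf
  have hfm : Measurable[pastLocalAlgebra hX.cadlag s] f := by
    refine Measurable.indicator ?_ hA
    have h1 : Measurable[pastLocalAlgebra hX.cadlag s] fun w => inverseLocal X s w :=
      measurable_rightInverse_pastLocalAlgebra hX.cadlag hX.measurable le_rfl
    exact (by fun_prop : Measurable fun x : ℝ≥0 => ENNReal.ofReal (Real.exp (z * x))).comp h1
  have hfm' : Measurable f := hfm.mono hle le_rfl
  have h1 := congrArg (fun ρ => @lintegral W (pastLocalAlgebra hX.cadlag s) ρ f) htrim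
  simp only [lintegral_trim hle hfm] at h1
  rw [lintegral_smul_measure, lintegral_withDensity_eq_lintegral_mul _ (hwm _) hfm',
    lintegral_withDensity_eq_lintegral_mul _ (hwm _) hfm'] at h1
  have hAm := hle _ hA
  have e1 : ∫⁻ w, ((fun w => expWeight z (inverseLocal X (s + t) w)) * f) w ∂P 0 =
      ∫⁻ w in A, ENNReal.ofReal (Real.exp (-(z * ((inverseLocal X (s + t) w : ℝ) -
        inverseLocal X s w)))) ∂P 0 := by
    rw [← lintegral_indicator hAm]
    refine lintegral_congr fun w => ?_
    by_cases hw : w ∈ A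
    · simp only [hf, Pi.mul_apply, Set.indicator_of_mem hw, expWeight]
      rw [← ENNReal.ofReal_mul (Real.exp_pos _).le, ← Real.exp_add]
      congr 2
      ring
    · simp [hf, Set.indicator_of_notMem hw]
  have e2 : ∫⁻ w, ((fun w => expWeight z (inverseLocal X s w)) * f) w ∂P 0 = P 0 A := by
    rw [← lintegral_indicator_one hAm]
    refine lintegral_congr fun w => ?_
    by_cases hw : w ∈ A
    · simp only [hf, Pi.mul_apply, Set.indicator_of_mem hw, expWeight, Pi.one_apply]
      rw [← ENNReal.ofReal_mul (Real.exp_pos _).le, ← Real.exp_add]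
      simp
    · simp [hf, Set.indicator_of_notMem hw]
  rw [e1, e2, smul_eq_mul, mul_comm] at h1
  exact h1

/-- The law of an increment of the excess, on an event of its past. -/
lemma map_excess_increment (hX : IsGapDiffusion m X P) {μS : Measure ℝ} [IsProbabilityMeasure μS]
    (h0 : μS (Set.Iic 0) = 0) {a : ℝ} (ha : 0 ≤ a)
    (hS : ∀ z : ℝ, 0 < z → (z + a * (1 - (laplaceTransform μS z).toReal)) *
      ∫ t in Set.Ioi 0, Real.exp (-(z * t)) * m.transition t 0 0 = 1)
    {s : ℝ≥0} {A : Set W} (hA : MeasurableSet[pastLocalAlgebra hX.cadlag s] A) (t : ℝ≥0) :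
    ((P 0).restrict A).map (fun w => excess X (s + t) w - excess X s w) =
      P 0 A • compoundPoissonLaw (a * t) μS := by
  have := hX.isProbabilityMeasure 0
  have hrec := hX.ae_recurrent h0 ha hS
  have h0' : μS (Set.Iio 0) = 0 := measure_mono_null Set.Iio_subset_Iic_self h0
  have hat : 0 ≤ a * t := mul_nonneg ha t.2
  have hprob := isProbabilityMeasure_compoundPoissonLaw hat μS
  have hm : Measurable fun w => excess X (s + t) w - excess X s w :=
    (hX.measurable_excess _).sub (hX.measurable_excess _)
  have hinc : ∀ w, excess X (s + t) w - excess X s w =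
      ((inverseLocal X (s + t) w : ℝ) - inverseLocal X s w) - t := by
    intro w; simp only [excess]; push_cast; ring
  have := Measure.isFiniteMeasure_map ((P 0).restrict A) (fun w => excess X (s + t) w - excess X s w)
  have : IsFiniteMeasure (P 0 A • compoundPoissonLaw (a * t) μS) :=
    Measure.smul_finite _ (measure_ne_top _ _)
  refine measure_ext_of_laplaceTransform ?_ ?_ fun k => ?_
  · rw [Measure.map_apply hm measurableSet_Iio]
    refine measure_mono_null (t := {w | ¬ ∀ t : ℝ≥0, ∃ s, (t : ℝ) < occupation (zeroSet X w) s}) ?_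
      (ae_restrict_of_ae hrec)
    intro w hw hw'
    have h1 := le_rightInverse_sub (measurableSet_zeroSet hX.cadlag w) hw' s t
    simp only [Set.mem_preimage, Set.mem_Iio, hinc] at hw
    change (t : ℝ) ≤ inverseLocal X (s + t) w - inverseLocal X s w at h1
    linarith
  · rw [Measure.smul_apply, compoundPoissonLaw_Iio _ _ h0, smul_zero]
  · rw [laplaceTransform, lintegral_map (measurable_ofReal_exp_neg_mul _) hm, laplaceTransform,
      lintegral_smul_measure]
    change _ = P 0 A • laplaceTransform _ _
    rw [laplaceTransform_compoundPoissonLaw hat μS h0' (Nat.cast_nonneg k)]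
    -- At `k = 0`, where the Green function identity is not available, only total masses are
    -- compared.
    rcases Nat.eq_zero_or_pos k with rfl | hk
    · simp [laplaceTransform]
    · have hz : (0 : ℝ) < k := by exact_mod_cast hk
      have hle : (laplaceTransform μS k).toReal ≤ 1 :=
        ENNReal.toReal_le_of_le_ofReal zero_le_one
          (by simpa using laplaceTransform_le_one h0' hz.le)
      have hψ : 0 < k + a * (1 - (laplaceTransform μS k).toReal) := by
        have := mul_nonneg ha (sub_nonneg.2 hle)
        linarith
      have key := hX.lintegral_exp_increment hrec hA hz hψ (hS k hz) t
      have e : ∀ w, ENNReal.ofReal (Real.exp (-(k * (excess X (s + t) w - excess X s w)))) =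
          ENNReal.ofReal (Real.exp (k * t)) * ENNReal.ofReal (Real.exp
            (-(k * ((inverseLocal X (s + t) w : ℝ) - inverseLocal X s w)))) := by
        intro w
        rw [← ENNReal.ofReal_mul (Real.exp_pos _).le, ← Real.exp_add, hinc]
        congr 2
        ring
      simp_rw [e]
      have hm2 : Measurable fun w => ENNReal.ofReal (Real.exp
            (-(k * ((inverseLocal X (s + t) w : ℝ) - inverseLocal X s w)))) :=
        (measurable_ofReal_exp_neg_mul k).comp
          ((measurable_coe_nnreal_real.comp (hX.measurable_inverseLocal _)).sub
            (measurable_coe_nnreal_real.comp (hX.measurable_inverseLocal _)))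
      rw [lintegral_const_mul _ hm2, key, smul_eq_mul, mul_left_comm,
        ← ENNReal.ofReal_mul (Real.exp_pos _).le, ← Real.exp_add]
      congr 3
      ring

/-- The excess of the inverse local time is a compound Poisson process. -/
lemma isCompoundPoissonProcess_excess (hX : IsGapDiffusion m X P) {μS : Measure ℝ}
    [IsProbabilityMeasure μS] (h0 : μS (Set.Iic 0) = 0) {a : ℝ} (ha : 0 ≤ a)
    (hS : ∀ z : ℝ, 0 < z → (z + a * (1 - (laplaceTransform μS z).toReal)) *
      ∫ t in Set.Ioi 0, Real.exp (-(z * t)) * m.transition t 0 0 = 1) :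
    IsCompoundPoissonProcess (P 0) (excess X) a μS := by
  have := hX.isProbabilityMeasure 0
  have hrec := hX.ae_recurrent h0 ha hS
  have law : ∀ s t : ℝ≥0, (P 0).map (fun w => excess X (s + t) w - excess X s w) =
      compoundPoissonLaw (a * t) μS := by
    intro s t
    have := hX.map_excess_increment h0 ha hS (s := s) (A := Set.univ)
      (@MeasurableSet.univ _ (pastLocalAlgebra hX.cadlag s)) t
    rwa [Measure.restrict_univ, measure_univ, one_smul] at this
  have hm : ∀ s t, Measurable fun w => excess X t w - excess X s w := fun s t =>
    (hX.measurable_excess t).sub (hX.measurable_excess s)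
  refine ⟨fun t => (hX.measurable_excess t).aemeasurable, ?_, ?_, ?_, law⟩
  · filter_upwards [hX.ae_inverseLocal_zero] with w hw
    simp [excess, hw]
  · filter_upwards [hrec] with w hw
    exact isCadlagPath_rightInverse_sub (measurableSet_zeroSet hX.cadlag w) hw
  · refine HasIndepIncrements.of_nat fun t ht _ => ?_
    rw [iIndepFun_iff_measure_inter_preimage_eq_mul]
    intro F B hB
    -- The increments with smaller index end by local time `t i`, so their joint event lies in the
    -- past there and the last increment splits off.
    induction F using Finset.induction_on_max with
    | empty => simp
    | insert i F hi ih =>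
      have hBi := hB i (Finset.mem_insert_self i F)
      have ih' := ih fun j hj => hB j (Finset.mem_insert_of_mem hj)
      have hnot : i ∉ F := fun h => lt_irrefl _ (hi i h)
      rw [Finset.prod_insert hnot, ← ih', Finset.set_biInter_insert]
      set A : Set W := ⋂ j ∈ F, (fun w => excess X (t (j + 1)) w - excess X (t j) w) ⁻¹' B j
        with hAdef
      have hA : MeasurableSet[pastLocalAlgebra hX.cadlag (t i)] A := by
        refine @Finset.measurableSet_biInter _ _ (pastLocalAlgebra hX.cadlag (t i)) _ F fun j hj => ?_
        have hji := hi j hj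
        have h1 : Measurable[pastLocalAlgebra hX.cadlag (t i)]
            fun w => excess X (t (j + 1)) w - excess X (t j) w :=
          (hX.measurable_excess_pastLocalAlgebra (ht (by omega))).sub
            (hX.measurable_excess_pastLocalAlgebra (ht (by omega)))
        exact h1 (hB j (Finset.mem_insert_of_mem hj))
      obtain ⟨d, hd⟩ : ∃ d, t (i + 1) = t i + d := exists_add_of_le (ht (Nat.le_succ i))
      have h1 := congrArg (fun ρ => ρ (B i)) (hX.map_excess_increment h0 ha hS hA d)
      have h2 := congrArg (fun ρ => ρ (B i)) (law (t i) d)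
      rw [Measure.map_apply (hm _ _) hBi] at h1 h2
      rw [Measure.restrict_apply (hm _ _ hBi), Measure.smul_apply, ← h2, smul_eq_mul] at h1
      rw [hd, h1, mul_comm]

end IsGapDiffusion

end InverseLocalTime

/-! ### Departures from a set as the points of growth of the excess -/

section Departures

/-- The times at which a set of times is left. -/
def departures (A : Set ℝ≥0) : Set ℝ≥0 := {s | 0 < s ∧ (∀ᶠ r in 𝓝[<] s, r ∈ A) ∧ s ∉ A}

variable {A : Set ℝ≥0}

lemma occupation_sub_eq_of_Ioo_subset (hA : MeasurableSet A) {s t : ℝ≥0} (hst : s ≤ t)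
    (h : Set.Ioo s t ⊆ A) : occupation A t - occupation A s = (t : ℝ) - s := by
  refine le_antisymm (occupation_sub_le hA hst) ?_
  rw [occupation_sub hA hst]
  have hne : halfLine (A ∩ Set.Ioc s t) ≠ ∞ :=
    ne_top_of_le_ne_top (by rw [halfLine_Ioc hst]; exact ENNReal.ofReal_ne_top)
      (measure_mono Set.inter_subset_right)
  rw [← ENNReal.ofReal_le_iff_le_toReal hne, ← halfLine_Ioc hst, measure_congr Ioo_ae_eq_Ioc.symm]
  exact measure_mono fun x hx => ⟨h hx, Set.Ioo_subset_Ioc_self hx⟩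

lemma occupation_eq_of_Ioc_disjoint (hA : MeasurableSet A) {s t : ℝ≥0} (hst : s ≤ t)
    (h : ∀ x ∈ Set.Ioc s t, x ∉ A) : occupation A t = occupation A s := by
  have h1 := occupation_sub hA hst
  have : A ∩ Set.Ioc s t = ∅ := by
    ext x
    simp only [Set.mem_inter_iff, Set.mem_empty_iff_false, iff_false]
    exact fun hx => h x hx.2 hx.1
  rw [this, measure_empty, ENNReal.toReal_zero] at h1
  linarith

/-- The set is occupied throughout some interval just before a departure. Consequently different
departures occur at different local times. -/
lemma occupation_lt_of_mem_departures (hA : MeasurableSet A) {s y : ℝ≥0} (hs : s ∈ departures A)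
    (hy : y < s) : occupation A y < occupation A s := by
  obtain ⟨l, hl, hsub⟩ := (mem_nhdsLT_iff_exists_Ioo_subset' hy).1 hs.2.1
  have hls : max l y < s := max_lt hl hy
  have h1 := occupation_sub_eq_of_Ioo_subset hA hls.le
    ((Set.Ioo_subset_Ioo_left (le_max_left l y)).trans hsub)
  have h2 := occupation_mono A (le_max_right l y)
  have h3 : ((max l y : ℝ≥0) : ℝ) < s := NNReal.coe_lt_coe.2 hls
  linarith

lemma occupation_pos_of_mem_departures (hA : MeasurableSet A) {s : ℝ≥0} (hs : s ∈ departures A) :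
    0 < occupation A s := by
  simpa [occupation_zero] using occupation_lt_of_mem_departures hA hs hs.1

variable (hA : MeasurableSet A) (hrc : ∀ t, ∀ᶠ s in 𝓝[≥] t, (s ∈ A ↔ t ∈ A))
  (hrec : ∀ t : ℝ≥0, ∃ s, (t : ℝ) < occupation A s)
include hA hrc hrec

/-- If this time were outside `A`, right-continuity would keep the occupation time equal to `a` a
little longer, whereas it exceeds `a` at every later time. -/
lemma rightInverse_mem (a : ℝ≥0) : rightInverse (occupation A) a ∈ A := by
  set T := rightInverse (occupation A) a with hT
  by_contra hn
  obtain ⟨u, hu, hsub⟩ := (mem_nhdsGE_iff_exists_Ico_subset' (lt_add_one T)).1 (hrc T)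
  obtain ⟨y, hTy, hyu⟩ := exists_between (Set.mem_Ioi.1 hu)
  have h1 : occupation A y = occupation A T :=
    occupation_eq_of_Ioc_disjoint hA hTy.le fun x hx hxA =>
      hn ((hsub ⟨hx.1.le, lt_of_le_of_lt hx.2 hyu⟩).1 hxA)
  have h2 := (rightInverse_lt_iff hA (hrec a)).1 hTy
  rw [h1, hT, occupation_rightInverse hA (hrec a)] at h2
  exact lt_irrefl _ h2

/-- The excess grows exactly at the local times at which the set is left. -/
lemma excess_lt_iff {a b : ℝ≥0} (hab : a ≤ b) :
    (rightInverse (occupation A) a : ℝ) - a < rightInverse (occupation A) b - b ↔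
      ∃ s ∈ departures A, (a : ℝ) < occupation A s ∧ occupation A s ≤ b := by
  set Ta := rightInverse (occupation A) a with hTa
  set Tb := rightInverse (occupation A) b with hTb
  have hTab : Ta ≤ Tb := rightInverse_mono hab (hrec b)
  have ha : occupation A Ta = a := occupation_rightInverse hA (hrec a)
  have hb : occupation A Tb = b := occupation_rightInverse hA (hrec b)
  constructor
  · intro h
    obtain ⟨r, hr, hrA⟩ : ∃ r ∈ Set.Ioo Ta Tb, r ∉ A := by
      by_contra! hsub
      have := occupation_sub_eq_of_Ioo_subset hA hTab hsub
      rw [ha, hb] at this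
      linarith
    -- The first time outside `A` from `Ta` on: right-continuity puts it outside `A`, and `Ta`
    -- itself belongs to `A`, so it is a departure strictly after `Ta`.
    set s := sInf {r | Ta ≤ r ∧ r ∉ A} with hs
    have hne : {r | Ta ≤ r ∧ r ∉ A}.Nonempty := ⟨r, hr.1.le, hrA⟩
    have hTs : Ta ≤ s := le_csInf hne fun x hx => hx.1
    have hsA : s ∉ A := by
      intro hsA
      obtain ⟨u, hu, hsub⟩ := (mem_nhdsGE_iff_exists_Ico_subset' (lt_add_one s)).1 (hrc s)
      obtain ⟨x, hx, hxu⟩ := exists_lt_of_csInf_lt hne hu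
      exact hx.2 ((hsub ⟨csInf_le (OrderBot.bddBelow _) hx, hxu⟩).2 hsA)
    have hTs' : Ta < s := lt_of_le_of_ne hTs fun h => hsA (h ▸ rightInverse_mem hA hrc hrec a)
    have hsr : s ≤ r := csInf_le (OrderBot.bddBelow _) ⟨hr.1.le, hrA⟩
    refine ⟨s, ⟨lt_of_le_of_lt zero_le hTs', ?_, hsA⟩, ?_, ?_⟩
    · filter_upwards [Ioo_mem_nhdsLT hTs'] with y hy
      by_contra hyA
      have hmem : y ∈ {r | Ta ≤ r ∧ r ∉ A} := ⟨hy.1.le, hyA⟩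
      exact absurd (csInf_le (OrderBot.bddBelow _) hmem) (not_le.2 hy.2)
    · exact (rightInverse_lt_iff hA (hrec a)).1 hTs'
    · refine not_lt.1 fun h' => ?_
      have := (rightInverse_lt_iff hA (hrec b)).2 h'
      exact absurd (this.trans_le hsr) (not_lt.2 hr.2.le)
  · rintro ⟨s, hs, has, hsb⟩
    have hTs : Ta < s := (rightInverse_lt_iff hA (hrec a)).2 has
    -- The set is avoided from `s` up to some `y > s`. The occupation time stands still meanwhile,
    -- so `y ≤ Tb`, and the excess gains at least `y - s`.
    obtain ⟨u, hu, hsub⟩ := (mem_nhdsGE_iff_exists_Ico_subset' (lt_add_one s)).1 (hrc s)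
    obtain ⟨y, hsy, hyu⟩ := exists_between (Set.mem_Ioi.1 hu)
    have h1 : occupation A y = occupation A s :=
      occupation_eq_of_Ioc_disjoint hA hsy.le fun x hx hxA =>
        hs.2.2 ((hsub ⟨hx.1.le, lt_of_le_of_lt hx.2 hyu⟩).1 hxA)
    have hyT : y ≤ Tb := by
      refine not_lt.1 fun h' => ?_
      have := (rightInverse_lt_iff hA (hrec b)).1 h'
      rw [h1] at this
      exact absurd this (not_lt.2 hsb)
    have h2 := occupation_sub_le hA hyT
    have h3 := occupation_sub_le hA hTs.le
    have h4 : (s : ℝ) < y := NNReal.coe_lt_coe.2 hsy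
    rw [hb, h1] at h2
    rw [ha] at h3
    linarith

omit hrc hrec in
lemma injOn_occupation_departures : Set.InjOn (occupation A) (departures A) := by
  intro s hs s' hs' h
  rcases lt_trichotomy s s' with hlt | heq | hlt
  · exact absurd h (occupation_lt_of_mem_departures hA hs' hlt).ne
  · exact heq
  · exact absurd h (occupation_lt_of_mem_departures hA hs hlt).ne'

/-- There is exactly one departure up to local time `t` if and only if the excess grows on exactly
one interval of a sufficiently fine partition. -/
lemma eventually_existsUnique_excess_lt_iff {t : ℝ≥0} (ht : 0 < t) :
    ∀ᶠ N : ℕ in atTop, (∃ j < N, ∀ i < N,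
      ((rightInverse (occupation A) (i * (t / N)) : ℝ) - ((i * (t / N) : ℝ≥0) : ℝ) <
        rightInverse (occupation A) ((i + 1 : ℕ) * (t / N)) - (((i + 1 : ℕ) * (t / N) : ℝ≥0) : ℝ)) ↔
        i = j) ↔
      ∃ s, {s ∈ departures A | occupation A s ≤ t} = {s} := by
  -- the interval of the partition that contains a given local time
  have locate : ∀ N : ℕ, 0 < N → ∀ x : ℝ, 0 < x → x ≤ t → ∃ j < N,
      ((j * (t / N) : ℝ≥0) : ℝ) < x ∧ x ≤ (((j + 1 : ℕ) * (t / N) : ℝ≥0) : ℝ) := by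
    intro N hN x hx hxt
    have htN : (0 : ℝ) < t / N := by positivity
    -- The intervals are open on the left and closed on the right, as in `excess_lt_iff`; the index
    -- is therefore one less than a ceiling.
    obtain ⟨k, hk⟩ : ∃ k, ⌈x / (t / N)⌉₊ = k + 1 :=
      Nat.exists_eq_succ_of_ne_zero (Nat.ceil_pos.2 (by positivity)).ne'
    have h1 : x / (t / N) ≤ ((k + 1 : ℕ) : ℝ) := hk ▸ Nat.le_ceil _
    have h2 : (k : ℝ) < x / (t / N) := Nat.lt_ceil.1 (by omega)
    have h3 : k < N := by
      have : (k : ℝ) < N := by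
        refine h2.trans_le ?_
        rw [div_le_iff₀ htN, mul_div_cancel₀ _ (by positivity)]
        exact hxt
      exact_mod_cast this
    refine ⟨k, h3, ?_, ?_⟩
    · push_cast
      exact (lt_div_iff₀ htN).1 h2
    · push_cast
      rw [div_le_iff₀ htN] at h1
      push_cast at h1
      exact h1
  have mono : ∀ N i : ℕ, (i : ℝ≥0) * (t / N) ≤ ((i + 1 : ℕ) : ℝ≥0) * (t / N) := by
    intro N i
    gcongr
    omega
  have sep : ∀ (N i j : ℕ) (x : ℝ), ((i * (t / N) : ℝ≥0) : ℝ) < x →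
      x ≤ (((j + 1 : ℕ) * (t / N) : ℝ≥0) : ℝ) → i ≤ j := by
    intro N i j x h1 h2
    by_contra hij
    have : (((j + 1 : ℕ) * (t / N) : ℝ≥0) : ℝ) ≤ ((i * (t / N) : ℝ≥0) : ℝ) := by
      refine NNReal.coe_le_coe.2 ?_
      gcongr
      omega
    linarith
  have upto : ∀ N i : ℕ, i < N → (((i + 1 : ℕ) * (t / N) : ℝ≥0) : ℝ) ≤ t := by
    intro N i hi
    have hN : 0 < N := by omega
    have h1 : ((i + 1 : ℕ) : ℝ) ≤ N := by exact_mod_cast hi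
    push_cast at h1 ⊢
    calc ((i : ℝ) + 1) * (t / N) ≤ N * (t / N) := by gcongr
      _ = t := mul_div_cancel₀ _ (by positivity)
  simp_rw [excess_lt_iff hA hrc hrec (mono _ _)]
  by_cases huniq : ∃ s, {s ∈ departures A | occupation A s ≤ t} = {s}
  · simp only [huniq, iff_true]
    obtain ⟨s, hs⟩ := huniq
    have hmem : s ∈ departures A ∧ occupation A s ≤ t := by
      have : s ∈ {s ∈ departures A | occupation A s ≤ t} := hs ▸ rfl
      exact this
    filter_upwards [eventually_gt_atTop 0] with N hN
    obtain ⟨j, hj, h1, h2⟩ := locate N hN _ (occupation_pos_of_mem_departures hA hmem.1) hmem.2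
    refine ⟨j, hj, fun i hi => ⟨?_, ?_⟩⟩
    · rintro ⟨s', hs', h1', h2'⟩
      have : s' ∈ {s ∈ departures A | occupation A s ≤ t} := ⟨hs', h2'.trans (upto N i hi)⟩
      rw [hs] at this
      rw [Set.mem_singleton_iff.1 this] at h1' h2'
      exact le_antisymm (sep N i j _ h1' h2) (sep N j i _ h1 h2')
    · rintro rfl
      exact ⟨s, hmem.1, h1, h2⟩
  · simp only [huniq, iff_false]
    by_cases hemp : {s ∈ departures A | occupation A s ≤ t} = ∅
    · refine Eventually.of_forall fun N => ?_
      rintro ⟨j, hj, h⟩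
      obtain ⟨s, hs, -, h2⟩ := (h j hj).2 rfl
      have : s ∈ {s ∈ departures A | occupation A s ≤ t} := ⟨hs, h2.trans (upto N j hj)⟩
      rw [hemp] at this
      exact this
    · obtain ⟨s, hs⟩ := Set.nonempty_iff_ne_empty.2 hemp
      obtain ⟨s', hs', hne⟩ : ∃ s' ∈ {s ∈ departures A | occupation A s ≤ t}, s' ≠ s := by
        by_contra! hall
        exact huniq ⟨s, Set.eq_singleton_iff_unique_mem.2 ⟨hs, hall⟩⟩
      -- Two departures have distinct local times, so a mesh below their distance puts them in
      -- different intervals, and growth is not confined to one.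
      have hocc : occupation A s' ≠ occupation A s := fun h =>
        hne (injOn_occupation_departures hA hs'.1 hs.1 h)
      have hlim : Tendsto (fun N : ℕ => (t : ℝ) / N) atTop (𝓝 0) :=
        tendsto_const_div_atTop_nhds_zero_nat _
      filter_upwards [eventually_gt_atTop 0, hlim.eventually_lt_const
        (abs_pos.2 (sub_ne_zero.2 hocc))] with N hN hsmall
      rintro ⟨j, hj, h⟩
      obtain ⟨i, hi, h1, h2⟩ := locate N hN _ (occupation_pos_of_mem_departures hA hs.1) hs.2
      obtain ⟨i', hi', h1', h2'⟩ := locate N hN _ (occupation_pos_of_mem_departures hA hs'.1) hs'.2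
      have e1 := (h i hi).1 ⟨s, hs.1, h1, h2⟩
      have e2 := (h i' hi').1 ⟨s', hs'.1, h1', h2'⟩
      rw [e1] at h1 h2
      rw [e2] at h1' h2'
      push_cast at h1 h2 h1' h2'
      refine absurd hsmall (not_lt.2 (abs_le.2 ⟨?_, ?_⟩)) <;> linarith

end Departures

/-! ### The joint law of a compound Poisson process and the event of a single jump -/

section UniqueJump

variable {Ω : Type*} [MeasurableSpace Ω] {μ : Measure Ω} {Y : ℝ≥0 → Ω → ℝ} {r : ℝ} {S : Measure ℝ}

/-- The event that `Y` grows on exactly one of the `N` intervals of the uniform partition of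
`[0, t]`. -/
def uniqueGrowth (Y : ℝ≥0 → Ω → ℝ) (t : ℝ≥0) (N : ℕ) : Set Ω :=
  {w | ∃ j < N, ∀ i < N, (Y (i * (t / N)) w < Y ((i + 1 : ℕ) * (t / N)) w ↔ i = j)}

lemma measurableSet_uniqueGrowth (hYm : ∀ t, Measurable (Y t)) (t : ℝ≥0) (N : ℕ) :
    MeasurableSet (uniqueGrowth Y t N) := by
  have h : ∀ i j : ℕ, MeasurableSet {w | Y (i * (t / N)) w < Y ((i + 1 : ℕ) * (t / N)) w ↔ i = j} :=
    fun i j => (measurableSet_lt (hYm _) (hYm _)).iff (MeasurableSet.const _)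
  have : uniqueGrowth Y t N = ⋃ j, ⋃ (_ : j < N), ⋂ i, ⋂ (_ : i < N),
      {w | Y (i * (t / N)) w < Y ((i + 1 : ℕ) * (t / N)) w ↔ i = j} := by
    ext w
    simp [uniqueGrowth]
  rw [this]
  exact .iUnion fun j => .iUnion fun _ => .iInter fun i => .iInter fun _ => h i j

/-- When only one of the nonnegative increments is positive, `Y t` equals that increment.
Independence gives the product for each of the `N` disjoint choices of the interval. -/
lemma measure_uniqueGrowth_inter (hY : IsCompoundPoissonProcess μ Y r S)
    (hYm : ∀ t, Measurable (Y t)) (hmono : ∀ᵐ w ∂μ, Monotone fun t => Y t w) (t : ℝ≥0) {N : ℕ}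
    (hN : 0 < N) {B : Set ℝ} (hB : MeasurableSet B) :
    μ (uniqueGrowth Y t N ∩ Y t ⁻¹' B) =
      N * (compoundPoissonLaw (r * t / N) S (B ∩ Set.Ioi 0) *
        compoundPoissonLaw (r * t / N) S (Set.Iic 0) ^ (N - 1)) := by
  set T : ℕ → ℝ≥0 := fun i => i * (t / N) with hT
  have hTm : Monotone T := fun i j hij => by
    simp only [hT]
    gcongr
  have hTN : T N = t := mul_div_cancel₀ _ (by positivity)
  set D : ℕ → Ω → ℝ := fun i w => Y (T (i + 1)) w - Y (T i) w with hD
  have hDm : ∀ i, Measurable (D i) := fun i => (hYm _).sub (hYm _)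
  have hlaw : ∀ i, ∀ A, MeasurableSet A → μ (D i ⁻¹' A) = compoundPoissonLaw (r * t / N) S A := by
    intro i A hA
    have h := hY.law_increment (T i) (t / N)
    have hTi : T i + t / N = T (i + 1) := by simp only [hT]; push_cast; ring
    rw [hTi] at h
    rw [← Measure.map_apply (hDm i) hA, h]
    push_cast
    rw [mul_div_assoc]
  set F : ℕ → Set Ω := fun j => ⋂ i ∈ Finset.range N,
    D i ⁻¹' (if i = j then B ∩ Set.Ioi 0 else Set.Iic 0) with hF
  have hset : ∀ i j : ℕ, MeasurableSet (if i = j then B ∩ Set.Ioi 0 else Set.Iic (0 : ℝ)) := by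
    intro i j
    split_ifs
    · exact hB.inter measurableSet_Ioi
    · exact measurableSet_Iic
  have hFmem : ∀ j w, w ∈ F j ↔
      ∀ i < N, D i w ∈ (if i = j then B ∩ Set.Ioi 0 else Set.Iic (0 : ℝ)) := by
    intro j w
    simp [hF]
  have hFμ : ∀ j ∈ Finset.range N, μ (F j) = compoundPoissonLaw (r * t / N) S (B ∩ Set.Ioi 0) *
        compoundPoissonLaw (r * t / N) S (Set.Iic 0) ^ (N - 1) := by
    intro j hj
    have h := (iIndepFun_iff_measure_inter_preimage_eq_mul.1 (hY.indep_increments.nat hTm))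
      (Finset.range N) (sets := fun i => if i = j then B ∩ Set.Ioi 0 else Set.Iic (0 : ℝ))
      fun i _ => hset i j
    refine h.trans ?_
    rw [← Finset.mul_prod_erase _ _ hj]
    congr 1
    · simpa using hlaw j _ (hB.inter measurableSet_Ioi)
    · rw [Finset.prod_congr rfl (g := fun _ => compoundPoissonLaw (r * t / N) S (Set.Iic 0)),
        Finset.prod_const, Finset.card_erase_of_mem hj, Finset.card_range]
      intro i hi
      rw [if_neg (Finset.ne_of_mem_erase hi)]
      exact hlaw i _ measurableSet_Iic
  have hae : (uniqueGrowth Y t N ∩ Y t ⁻¹' B : Set Ω) =ᵐ[μ] ⋃ j ∈ Finset.range N, F j := by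
    filter_upwards [hmono, hY.start] with w hw h0
    have hD0 : ∀ i, 0 ≤ D i w := fun i => sub_nonneg.2 (hw (hTm (Nat.le_succ i)))
    have hsum : Y t w = ∑ i ∈ Finset.range N, D i w := by
      simp only [hD]
      rw [Finset.sum_range_sub (fun i => Y (T i) w), hTN]
      simp [hT, h0]
    have hgrow : ∀ i : ℕ, Y (i * (t / N)) w < Y ((i + 1 : ℕ) * (t / N)) w ↔ 0 < D i w := fun i =>
      sub_pos.symm
    have hone : ∀ j < N, (∀ i < N, i ≠ j → D i w ≤ 0) → Y t w = D j w := by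
      intro j hj h
      rw [hsum]
      exact Finset.sum_eq_single_of_mem j (Finset.mem_range.2 hj) fun i hi hij =>
        le_antisymm (h i (Finset.mem_range.1 hi) hij) (hD0 i)
    refine propext ?_
    change (w ∈ uniqueGrowth Y t N ∧ Y t w ∈ B) ↔ w ∈ ⋃ j ∈ Finset.range N, F j
    simp only [Set.mem_iUnion, Finset.mem_range, exists_prop, hFmem, uniqueGrowth,
      Set.mem_ofPred_eq, hgrow]
    constructor
    · rintro ⟨⟨j, hj, h⟩, hwB⟩
      refine ⟨j, hj, fun i hi => ?_⟩
      split_ifs with hij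
      · subst hij
        rw [hone i hi fun k hk hki => not_lt.1 fun h' => hki ((h k hk).1 h')] at hwB
        exact ⟨hwB, (h i hi).2 rfl⟩
      · exact not_lt.1 fun h' => hij ((h i hi).1 h')
    · rintro ⟨j, hj, h⟩
      have hjj := h j hj
      rw [if_pos rfl] at hjj
      have hoth : ∀ i < N, i ≠ j → D i w ≤ 0 := fun i hi hij => by simpa [hij] using h i hi
      refine ⟨⟨j, hj, fun i hi => ⟨fun h' => ?_, ?_⟩⟩, ?_⟩
      · by_contra hij
        exact absurd h' (not_lt.2 (hoth i hi hij))
      · rintro rfl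
        exact hjj.2
      · rw [hone j hj hoth]
        exact hjj.1
  rw [measure_congr hae, measure_biUnion_finset, Finset.sum_congr rfl hFμ, Finset.sum_const,
    Finset.card_range, nsmul_eq_mul]
  · intro j hj k hk hjk
    refine Set.disjoint_left.2 fun w h1 h2 => ?_
    have e1 := (hFmem j w).1 h1 j (Finset.mem_range.1 hj)
    have e2 := (hFmem k w).1 h2 j (Finset.mem_range.1 hj)
    rw [if_pos rfl] at e1
    rw [if_neg hjk] at e2
    exact absurd (Set.mem_Ioi.1 e1.2) (not_lt.2 e2)
  · exact fun j _ => Finset.measurableSet_biInter _ fun i _ => hDm i (hset i j)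

/-- The sum over the choices of the growing interval tends to `r t S(B)`, while absence of growth on
the other `N - 1` intervals has probability `e^{-rt(N-1)/N}`. -/
lemma tendsto_measure_uniqueGrowth_inter [IsProbabilityMeasure S]
    (hY : IsCompoundPoissonProcess μ Y r S) (hr : 0 ≤ r) (hS : S (Set.Iic 0) = 0)
    (hYm : ∀ t, Measurable (Y t)) (hmono : ∀ᵐ w ∂μ, Monotone fun t => Y t w) (t : ℝ≥0)
    {B : Set ℝ} (hB : MeasurableSet B) :
    Tendsto (fun N => μ (uniqueGrowth Y t N ∩ Y t ⁻¹' B)) atTop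
      (𝓝 (ENNReal.ofReal (r * t) * S B * ENNReal.ofReal (Real.exp (-(r * t))))) := by
  have hrt : 0 ≤ r * t := mul_nonneg hr t.2
  have h1 := tendsto_mul_compoundPoissonLaw hrt S hS hB
  have h2 : Tendsto (fun N : ℕ => compoundPoissonLaw (r * t / N) S (Set.Iic 0) ^ (N - 1)) atTop
      (𝓝 (ENNReal.ofReal (Real.exp (-(r * t))))) := by
    -- Passing to `N = k + 1` removes the truncated subtraction from the exponent.
    rw [← tendsto_add_atTop_iff_nat 1]
    have h3 : Tendsto (fun k : ℕ => Real.exp (-(r * t * ((k : ℝ) / (k + 1))))) atTop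
        (𝓝 (Real.exp (-(r * t * 1)))) :=
      (Real.continuous_exp.tendsto _).comp
        ((tendsto_natCast_div_add_atTop (1 : ℝ)).const_mul (r * t)).neg
    rw [mul_one] at h3
    refine (ENNReal.tendsto_ofReal h3).congr fun k => ?_
    rw [compoundPoissonLaw_Iic _ S hS, ← ENNReal.ofReal_pow (Real.exp_pos _).le, ← Real.exp_nat_mul]
    congr 2
    push_cast
    ring
  refine (ENNReal.Tendsto.mul h1 (Or.inr ENNReal.ofReal_ne_top) h2
    (Or.inr (ENNReal.mul_ne_top ENNReal.ofReal_ne_top (measure_ne_top _ _)))).congr' ?_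
  filter_upwards [eventually_gt_atTop 0] with N hN
  rw [measure_uniqueGrowth_inter hY hYm hmono t hN hB, mul_assoc]

/-- The joint law of a nondecreasing compound Poisson process and the event that it has exactly one
jump. -/
lemma measure_inter_of_eventually_uniqueGrowth [IsFiniteMeasure μ] [IsProbabilityMeasure S]
    (hY : IsCompoundPoissonProcess μ Y r S) (hr : 0 ≤ r) (hS : S (Set.Iic 0) = 0)
    (hYm : ∀ t, Measurable (Y t)) (hmono : ∀ᵐ w ∂μ, Monotone fun t => Y t w) (t : ℝ≥0)
    {B : Set ℝ} (hB : MeasurableSet B) {C : Set Ω}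
    (hC : ∀ᵐ w ∂μ, ∀ᶠ N in atTop, (w ∈ uniqueGrowth Y t N ↔ w ∈ C)) :
    μ (C ∩ Y t ⁻¹' B) =
      ENNReal.ofReal (r * t) * S B * ENNReal.ofReal (Real.exp (-(r * t))) := by
  -- The event `C` is not assumed measurable; the limit inferior of the growth events is a
  -- measurable set that agrees with it almost surely.
  set C' : Set Ω := {w | ∀ᶠ N in atTop, w ∈ uniqueGrowth Y t N} with hC'
  have hC'm : MeasurableSet C' := by
    simp only [hC', eventually_atTop, Set.ofPred_exists, Set.ofPred_forall]
    exact .iUnion fun k => .iInter fun N => .iInter fun _ => measurableSet_uniqueGrowth hYm t N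
  have hmem : ∀ᵐ w ∂μ, (w ∈ C' ↔ w ∈ C) := by
    filter_upwards [hC] with w hw
    constructor
    · intro h
      obtain ⟨N, h1, h2⟩ := (hw.and h).exists
      exact h1.1 h2
    · exact fun h => hw.mono fun N hN => hN.2 h
  have hae : (C ∩ Y t ⁻¹' B : Set Ω) =ᵐ[μ] (C' ∩ Y t ⁻¹' B : Set Ω) := by
    filter_upwards [hmem] with w hw
    exact propext (and_congr_left' hw.symm)
  rw [measure_congr hae]
  refine tendsto_nhds_unique (tendsto_measure_of_ae_tendsto_indicator_of_isFiniteMeasure atTop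
    (hC'm.inter (hYm t hB))
    (fun N => (measurableSet_uniqueGrowth hYm t N).inter (hYm t hB)) ?_)
    (tendsto_measure_uniqueGrowth_inter hY hr hS hYm hmono t hB)
  filter_upwards [hC, hmem] with w hw hw'
  filter_upwards [hw] with N hN
  exact and_congr_left' (hN.trans hw'.symm)

end UniqueJump

/-! ### The excursion law -/

section Excursion

variable {n : ℕ} {m : FiniteSpeedMeasure n} {W : Type*} [MeasurableSpace W]
  {P : Fin (n + 1) → Measure W} {X : ℝ≥0 → W → Fin (n + 1)}

namespace IsGapDiffusion

lemma invLocalTime_eq_inverseLocal (hX : IsGapDiffusion m X P) :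
    invLocalTime X = inverseLocal X := by
  funext t w
  exact invLocalTime_eq_rightInverse hX.cadlag t w

/-- For levels that are exceeded, `rightInverse_lt_iff` turns the real-time bound on the jumps,
endpoint included, into the bound `t` on their local times. -/
lemma jumpCount_eq_one_iff (hX : IsGapDiffusion m X P) {w : W}
    (hrec : ∀ t : ℝ≥0, ∃ s, (t : ℝ) < occupation (zeroSet X w) s) (t : ℝ≥0) :
    jumpCount X t w = 1 ↔
      ∃ s, {s ∈ departures (zeroSet X w) | occupation (zeroSet X w) s ≤ t} = {s} := by
  have hA := measurableSet_zeroSet hX.cadlag w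
  rw [jumpCount, Set.encard_eq_one]
  have : {s : ℝ≥0 | 0 < s ∧ s ≤ invLocalTime X t w ∧ (∀ᶠ r in 𝓝[<] s, X r w = 0) ∧ X s w ≠ 0} =
      {s ∈ departures (zeroSet X w) | occupation (zeroSet X w) s ≤ t} := by
    ext s
    have h : s ≤ invLocalTime X t w ↔ occupation (zeroSet X w) s ≤ t := by
      rw [hX.invLocalTime_eq_inverseLocal, ← not_lt, ← not_lt]
      exact not_congr (rightInverse_lt_iff hA (hrec t))
    simp only [Set.mem_ofPred_eq, h, departures, zeroSet]
    tauto
  rw [this]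

lemma ae_monotone_excess (hX : IsGapDiffusion m X P)
    (hrec : ∀ᵐ w ∂P 0, ∀ t : ℝ≥0, ∃ s, (t : ℝ) < occupation (zeroSet X w) s) :
    ∀ᵐ w ∂P 0, Monotone fun t => excess X t w := by
  filter_upwards [hrec] with w hw s t hst
  obtain ⟨d, rfl⟩ := exists_add_of_le hst
  have h := le_rightInverse_sub (measurableSet_zeroSet hX.cadlag w) hw s d
  simp only [excess, inverseLocal]
  push_cast
  linarith

lemma ae_eventually_uniqueGrowth_iff (hX : IsGapDiffusion m X P)
    (hrec : ∀ᵐ w ∂P 0, ∀ t : ℝ≥0, ∃ s, (t : ℝ) < occupation (zeroSet X w) s) {t : ℝ≥0}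
    (ht : 0 < t) :
    ∀ᵐ w ∂P 0, ∀ᶠ N in atTop,
      (w ∈ uniqueGrowth (excess X) t N ↔ w ∈ {w | jumpCount X t w = 1}) := by
  filter_upwards [hrec] with w hw
  filter_upwards [eventually_existsUnique_excess_lt_iff (measurableSet_zeroSet hX.cadlag w)
    (eventually_mem_zeroSet_iff hX.cadlag w) hw ht] with N hN
  exact hN.trans (hX.jumpCount_eq_one_iff hw t).symm

variable {μS : Measure ℝ} [IsProbabilityMeasure μS] {a : ℝ}

lemma measure_jumpCount_eq_one_inter (hX : IsGapDiffusion m X P)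
    (hrec : ∀ᵐ w ∂P 0, ∀ t : ℝ≥0, ∃ s, (t : ℝ) < occupation (zeroSet X w) s)
    (hY : IsCompoundPoissonProcess (P 0) (excess X) a μS) (h0 : μS (Set.Iic 0) = 0) (ha : 0 ≤ a)
    {t : ℝ≥0} (ht : 0 < t) {B : Set ℝ} (hB : MeasurableSet B) :
    P 0 ({w | jumpCount X t w = 1} ∩ excess X t ⁻¹' B) =
      ENNReal.ofReal (a * t) * μS B * ENNReal.ofReal (Real.exp (-(a * t))) :=
  have := hX.isProbabilityMeasure 0
  measure_inter_of_eventually_uniqueGrowth hY ha h0 hX.measurable_excess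
    (hX.ae_monotone_excess hrec) t hB (hX.ae_eventually_uniqueGrowth_iff hrec ht)

lemma measure_jumpCount_eq_one (hX : IsGapDiffusion m X P)
    (hrec : ∀ᵐ w ∂P 0, ∀ t : ℝ≥0, ∃ s, (t : ℝ) < occupation (zeroSet X w) s)
    (hY : IsCompoundPoissonProcess (P 0) (excess X) a μS) (h0 : μS (Set.Iic 0) = 0) (ha : 0 ≤ a)
    {t : ℝ≥0} (ht : 0 < t) :
    P 0 {w | jumpCount X t w = 1} =
      ENNReal.ofReal (a * t) * ENNReal.ofReal (Real.exp (-(a * t))) := by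
  simpa using hX.measure_jumpCount_eq_one_inter hrec hY h0 ha ht MeasurableSet.univ

lemma measure_jumpCount_eq_one_ne_zero (hX : IsGapDiffusion m X P)
    (hrec : ∀ᵐ w ∂P 0, ∀ t : ℝ≥0, ∃ s, (t : ℝ) < occupation (zeroSet X w) s)
    (hY : IsCompoundPoissonProcess (P 0) (excess X) a μS) (h0 : μS (Set.Iic 0) = 0) (ha : 0 < a)
    {t : ℝ≥0} (ht : 0 < t) : P 0 {w | jumpCount X t w = 1} ≠ 0 := by
  rw [hX.measure_jumpCount_eq_one hrec hY h0 ha.le ht, ← ENNReal.ofReal_mul (by positivity)]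
  have : 0 < a * t * Real.exp (-(a * t)) := by positivity
  simpa using this

/-- In the joint law, the dependence on `t` is a common factor equal to the probability of a single
jump; conditioning cancels it. -/
lemma excursionLaw_eq (hX : IsGapDiffusion m X P)
    (hrec : ∀ᵐ w ∂P 0, ∀ t : ℝ≥0, ∃ s, (t : ℝ) < occupation (zeroSet X w) s)
    (hY : IsCompoundPoissonProcess (P 0) (excess X) a μS) (h0 : μS (Set.Iic 0) = 0) (ha : 0 < a)
    {t : ℝ≥0} (ht : 0 < t) : excursionLaw X (P 0) t = μS := by
  have := hX.isProbabilityMeasure 0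
  ext B hB
  have hfun : (fun w => (invLocalTime X t w : ℝ) - (t : ℝ)) = excess X t := by
    rw [hX.invLocalTime_eq_inverseLocal]
    rfl
  have hm := hX.measurable_excess t
  rw [excursionLaw, hfun, Measure.map_apply hm hB, ProbabilityTheory.cond, Measure.smul_apply,
    Measure.restrict_apply (hm hB), Set.inter_comm,
    hX.measure_jumpCount_eq_one_inter hrec hY h0 ha.le ht hB, smul_eq_mul]
  have hne := hX.measure_jumpCount_eq_one_ne_zero hrec hY h0 ha ht
  rw [mul_right_comm, ← hX.measure_jumpCount_eq_one hrec hY h0 ha.le ht, ← mul_assoc,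
    ENNReal.inv_mul_cancel hne (measure_ne_top _ _), one_mul]

end IsGapDiffusion

end Excursion

/-! ### Drift and Lévy measure of the inverse local time -/

section DriftLevy

variable {Ω : Type*} [MeasurableSpace Ω] {μ : Measure Ω}

/-- Time `1` and integer arguments already determine the exponent sufficiently for
`drift_levy_unique`. -/
lemma HasDriftLevyMeasure.unique {Y : ℝ≥0 → Ω → ℝ} {b b' : ℝ} {ν ν' : Measure ℝ}
    (h : HasDriftLevyMeasure μ Y b ν) (h' : HasDriftLevyMeasure μ Y b' ν') : b = b' ∧ ν = ν' := by
  refine drift_levy_unique h.drift_nonneg h'.drift_nonneg h.null_nonpos h'.null_nonpos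
    h.lintegral_lt_top h'.lintegral_lt_top fun k => ?_
  have e := (h.laplace k 1 (Nat.cast_nonneg k)).symm.trans (h'.laplace k 1 (Nat.cast_nonneg k))
  have e' := Real.exp_injective e
  simp only [NNReal.coe_one, one_mul] at e'
  exact neg_injective e'

lemma integral_one_sub_exp_eq (S : Measure ℝ) [IsProbabilityMeasure S] (hS : S (Set.Iio 0) = 0)
    {z : ℝ} (hz : 0 ≤ z) :
    ∫ s, (1 - Real.exp (-(z * s))) ∂S = 1 - (laplaceTransform S z).toReal := by
  rw [integral_sub (integrable_const 1), integral_exp_neg_mul_eq_toReal]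
  · simp
  · refine Integrable.of_bound (by fun_prop) 1 ?_
    filter_upwards [ae_nonneg_of_measure_Iio hS] with x hx
    rw [Real.norm_eq_abs, abs_of_pos (Real.exp_pos _), Real.exp_le_one_iff]
    have := mul_nonneg hz hx
    linarith

/-- The drift and the Lévy measure of a drift plus a compound Poisson process. -/
lemma IsCompoundPoissonProcess.hasDriftLevyMeasure {Y : ℝ≥0 → Ω → ℝ} {r : ℝ} {S : Measure ℝ}
    [IsProbabilityMeasure S] (hY : IsCompoundPoissonProcess μ Y r S) (hr : 0 ≤ r)
    (hS : S (Set.Iic 0) = 0) {Z : ℝ≥0 → Ω → ℝ} {b c : ℝ≥0} (hZ : ∀ t w, Z t w = b * t + Y (c * t) w) :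
    HasDriftLevyMeasure μ Z b (ENNReal.ofReal (c * r) • S) := by
  have hS' : S (Set.Iio 0) = 0 := measure_mono_null Set.Iio_subset_Iic_self hS
  refine ⟨b.2, by simp [hS], ?_, fun z t hz => ?_⟩
  · rw [lintegral_smul_measure, smul_eq_mul]
    refine ENNReal.mul_lt_top ENNReal.ofReal_lt_top ?_
    calc ∫⁻ s, ENNReal.ofReal (1 - Real.exp (-s)) ∂S ≤ ∫⁻ _, 1 ∂S := by
          refine lintegral_mono fun s => ENNReal.ofReal_le_one.2 ?_
          linarith [Real.exp_pos (-s)]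
      _ < ∞ := by simp
  · have hlaw := hY.law_increment 0 (c * t)
    have hmap : μ.map (Y (c * t)) = compoundPoissonLaw (r * (c * t : ℝ≥0)) S := by
      rw [← hlaw, zero_add]
      refine Measure.map_congr ?_
      filter_upwards [hY.start] with w hw
      rw [hw, sub_zero]
    have hrt : 0 ≤ r * (c * t : ℝ≥0) := mul_nonneg hr (NNReal.coe_nonneg _)
    have h1 : ∫ w, Real.exp (-(z * Y (c * t) w)) ∂μ =
        Real.exp (-(r * (c * t : ℝ≥0) * (1 - (laplaceTransform S z).toReal))) := by
      rw [← integral_map (hY.aemeasurable (c * t)) (f := fun y => Real.exp (-(z * y)))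
        (by fun_prop), hmap, integral_exp_neg_mul_eq_toReal,
        laplaceTransform_compoundPoissonLaw hrt S hS' hz, ENNReal.toReal_ofReal (Real.exp_pos _).le]
    have h2 : ∀ w, Real.exp (-(z * Z t w)) =
        Real.exp (-(z * (b * t))) * Real.exp (-(z * Y (c * t) w)) := by
      intro w
      rw [hZ, ← Real.exp_add]
      congr 1
      ring
    simp_rw [h2]
    rw [integral_const_mul, h1, ← Real.exp_add, integral_smul_measure,
      integral_one_sub_exp_eq S hS' hz, ENNReal.toReal_ofReal (by positivity), smul_eq_mul]
    congr 1
    push_cast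
    ring

lemma rightInverse_const_mul {A : ℝ≥0 → ℝ} {a : ℝ≥0} (ha : 0 < a) (t : ℝ≥0) :
    rightInverse (fun s => a * A s) t = rightInverse A (a⁻¹ * t) := by
  have ha' : (0 : ℝ) < a := ha
  simp only [rightInverse]
  congr 1
  ext s
  simp only [Set.mem_ofPred_eq]
  push_cast
  rw [inv_mul_lt_iff₀ ha']

end DriftLevy

theorem lemma2 {n : ℕ} (hn : 1 ≤ n) (m : FiniteSpeedMeasure n)
    {W : Type*} [MeasurableSpace W] (P : Fin (n + 1) → Measure W)
    (X : ℝ≥0 → W → Fin (n + 1)) (hX : IsGapDiffusion m X P) :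
    (∀ᵐ w ∂P 0, ∀ t : ℝ≥0, ∃ s : ℝ≥0, (t : ℝ) < localTime X 0 s w) ∧
    ∃ S : ℝ → ℝ≥0∞, Measurable S ∧
      IsProbabilityMeasure (volume.withDensity S) ∧
      volume.withDensity S (Set.Iic 0) = 0 ∧
      (∀ t : ℝ≥0, 0 < t → P 0 {w | jumpCount X t w = 1} ≠ 0 ∧
        excursionLaw X (P 0) t = volume.withDensity S) ∧
      IsCompoundPoissonProcess (P 0) (fun t w => (invLocalTime X t w : ℝ) - (t : ℝ))
        (m.holdingRate 0) (volume.withDensity S) ∧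
      (∀ (b : ℝ) (ν : Measure ℝ),
        HasDriftLevyMeasure (P 0) (fun t w => (invLocalTime X t w : ℝ)) b ν ↔
          b = 1 ∧ ν = ENNReal.ofReal (m.holdingRate 0) • volume.withDensity S) ∧
      (∀ (b : ℝ) (ν : Measure ℝ),
        HasDriftLevyMeasure (P 0)
            (fun t w => (rightInverse (fun s => m.holdingRate 0 * localTime X 0 s w) t : ℝ)) b ν ↔
          b = (m.holdingRate 0)⁻¹ ∧ ν = volume.withDensity S) := by
  obtain ⟨S, hSm, hSp, hS0, hS⟩ := m.exists_excursion_density hn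
  have ha := m.holdingRate_zero_pos hn
  have hrec := hX.ae_recurrent hS0 ha.le hS
  have hY := hX.isCompoundPoissonProcess_excess hS0 ha.le hS
  have hexc : (fun t w => (invLocalTime X t w : ℝ) - (t : ℝ)) = excess X := by
    rw [hX.invLocalTime_eq_inverseLocal]
    rfl
  refine ⟨?_, S, hSm, hSp, hS0, fun t ht => ⟨?_, ?_⟩, ?_, fun b ν => ?_, fun b ν => ?_⟩
  · simpa only [localTime_eq_occupation hX.cadlag] using hrec
  · exact hX.measure_jumpCount_eq_one_ne_zero hrec hY hS0 ha ht
  · exact hX.excursionLaw_eq hrec hY hS0 ha ht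
  · rwa [hexc]
  · have h := hY.hasDriftLevyMeasure ha.le hS0 (Z := fun t w => (invLocalTime X t w : ℝ))
      (b := 1) (c := 1) fun t w => by
        simp [hX.invLocalTime_eq_inverseLocal, excess]
    simp only [NNReal.coe_one, one_mul] at h
    constructor
    · exact fun h' => h'.unique h
    · rintro ⟨rfl, rfl⟩
      exact h
  · lift m.holdingRate 0 to ℝ≥0 using ha.le with a
    have ha' : 0 < a := ha
    -- Multiplying the local time by `a` replaces the level `t` by `a⁻¹ * t`. The drift is thus
    -- `a⁻¹`, and the jump rate becomes `a⁻¹ * a = 1`.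
    have h := hY.hasDriftLevyMeasure ha.le hS0
      (Z := fun t w => (rightInverse (fun s => a * localTime X 0 s w) t : ℝ))
      (b := a⁻¹) (c := a⁻¹) fun t w => by
        rw [rightInverse_const_mul ha']
        change (invLocalTime X (a⁻¹ * t) w : ℝ) = _
        rw [hX.invLocalTime_eq_inverseLocal, excess]
        push_cast
        ring
    rw [NNReal.coe_inv, inv_mul_cancel₀ ha.ne', ENNReal.ofReal_one, one_smul] at h
    constructor
    · exact fun h' => h'.unique h
    · rintro ⟨rfl, rfl⟩
      exact h
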